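/- Let $k$ be a commutative ring and let $R=\bigoplus_{i\in\mathbb Z}R_i$ be a $\mathbb Z$-graded commutative $k$-algebra. Let $\pi,\sigma\colon R\to R[u,u^{-1}]$ be the $k$-algebra maps with $\pi(r)=r$ and $\sigma(r)=r\,u^{\deg r}$ for homogeneous $r$, and let $Q(R)\subseteq R[u,u^{-1}]$ be the $k$-subalgebra generated by $\pi(R)$, $\sigma(R)$ and $u$. Write $p,s\colon R\to Q(R)$ for the maps given by $\pi,\sigma$. The algebra $Q(R)$ is $\mathbb Z^2$-graded, with $\deg p(r)=(\deg r,0)$, $\deg s(r)=(0,\deg r)$ and $\deg u=(-1,1)$. A graded $k$-algebra map $f\colon R\to S$ induces $Q(f)\colon Q(R)\to Q(S)$, the restriction of the map $R[u,u^{-1}]\to S[u,u^{-1}]$ that applies $f$ to the coefficients. Let $D(R)$ be the unbounded derived category of $\mathbb Z$-graded $R$-modules (equivalently, of $\mathbb G_m$-equivariant $R$-modules). Let $\Phi_{Q(R)}\colon D(R)\to D(R)$ be the Fourier--Mukai transform with kernel $Q(R)$, that is, the total left derived functor of $$M\longmapsto (Q(R)\otimes_{s,R}M)_{(*,0)}=\bigoplus_{a\in\mathbb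 Z}(Q(R)\otimes_{s,R}M)_{(a,0)},$$ where $q\otimes m$ has degree $\deg q+(0,\deg m)$ and the result is a graded $R$-module through $p$. Let $\Phi'_{Q(R)}\colon D(R)\to D(R)$ be the transform in the opposite direction, the total left derived functor of $M\mapsto(Q(R)\otimes_{p,R}M)_{(0,*)}$, where $q\otimes m$ has degree $\deg q+(\deg m,0)$ and the result is a graded $R$-module through $s$. For $f\colon R\to S$ let $f^*\colon D(R)\to D(S)$ be the total left derived functor of $M\mapsto S\otimes_R M$. (All these total left derived functors exist.) A graded $k$-algebra map $f\colon R\to S$ is called strongly étale if the induced map $R_0\to S_0$ is étale and the map $R\otimes_{R_0}S_0\to S$, $r\otimes x\mapsto f(r)x$, is an isomorphism. **Proposition.** Let $f\colon R\to S$ be a strongly étale map of $\mathbb Z$-graded commutative $k$-algebras. Then: (a) The maps $$S\otimes_{f,R,s}Q(R)\to Q(S),\quad x\otimes q\mapsto s(x)\,Q(f)(q),\qquad\qquad Q(R)\otimes_{p,R,f}S\to Q(S),\quad q\otimes x\mapsto Q(f)(q)\,p(x),$$ are isomorphisms of rings and of $\mathbb Z^2$-graded bimodules (where $x\otimes q$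 and $q\otimes x$ have degrees $\deg q+(0,\deg x)$ and $\deg q+(\deg x,0)$); in particular $S\otimes_{f,R,s}Q(R)\cong Q(R)\otimes_{p,R,f}S\cong Q(S)$. (b) There are isomorphisms of functors $D(R)\to D(S)$ $$f^*\circ\Phi_{Q(R)}\;\cong\;\Phi_{Q(S)}\circ f^*,\qquad\qquad f^*\circ\Phi'_{Q(R)}\;\cong\;\Phi'_{Q(S)}\circ f^*.$$ -/

import Mathlib

open CategoryTheory TensorProduct
open scoped LaurentPolynomial

universe w u

namespace StronglyEtaleQ

/-! ### Rings and modules along ring homomorphisms -/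

section Along

variable {R B : Type*} [CommRing R] [CommRing B]

/-- The ring `B`, regarded as an `R`-algebra through `s : R → B`. Thus
`Along s ⊗[R] Along t` is the tensor product formed with respect to `s` on the left factor
and `t` on the right factor. -/
def Along (_ : R →+* B) : Type _ := B

noncomputable instance (s : R →+* B) : CommRing (Along s) := inferInstanceAs (CommRing B)

noncomputable instance (s : R →+* B) : Algebra R (Along s) := s.toAlgebra

/-- The identity map of `B`, from `B` to `B` regarded as an `R`-algebra through `s`. -/
def Along.of (s : R →+* B) : B ≃+* Along s := RingEquiv.refl B

theorem Along.smul_of (s : R →+* B) (r : R) (b : B) :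
    r • Along.of s b = Along.of s (s r * b) := by
  rw [Algebra.smul_def]; rfl

end Along

/-! ### Internal direct sums and graded tensor products -/

section Internal

theorem isInternal_of_detect {ι T P σ : Type*} [DecidableEq ι] [AddCommGroup T] [AddCommGroup P]
    [SetLike σ T] [AddSubgroupClass σ T] (A : ι → σ) (c : ι → T →+ P)
    (hne : ∀ x y t, t ∈ A y → y ≠ x → c x t = 0)
    (hinj : ∀ x t, t ∈ A x → c x t = 0 → t = 0)
    (hspan : AddSubmonoid.closure {t : T | ∃ x, t ∈ A x} = ⊤) :
    DirectSum.IsInternal A := by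
  classical
  have key : ∀ x (v : DirectSum ι fun i => A i),
      c x (DirectSum.coeAddMonoidHom A v) = c x (v x : T) := by
    intro x v
    induction v using DirectSum.induction_on with
    | zero => simp
    | of i a =>
      rw [DirectSum.coeAddMonoidHom_of]
      by_cases h : i = x
      · subst h; simp
      · rw [hne x i a a.2 h, DirectSum.of_eq_of_ne _ _ _ (Ne.symm h)]; simp
    | add v w hv hw => simp [map_add, hv, hw]
  constructor
  · rw [injective_iff_map_eq_zero]
    intro v hv
    refine DFinsupp.ext fun x => Subtype.ext ?_
    refine hinj x _ (v x).2 ?_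
    rw [← key, hv, map_zero]
  · rw [← AddMonoidHom.mrange_eq_top, eq_top_iff, ← hspan, AddSubmonoid.closure_le]
    rintro t ⟨x, hx⟩
    exact ⟨DirectSum.of (fun i => A i) x ⟨t, hx⟩, DirectSum.coeAddMonoidHom_of A x ⟨t, hx⟩⟩

variable {R N M : Type*} [CommRing R] [AddCommGroup N] [AddCommGroup M] [Module R N] [Module R M]
  {ι₁ ι₂ ι : Type*}

/-- The degree `x` part of `N ⊗[R] M`, for gradings on `N` and `M` and a rule `δ` that says which
degree `n ⊗ m` has when `n` and `m` are homogeneous: the additive span of the pure tensors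
of homogeneous elements whose degree is `x`. -/
def tensorPiece (𝒩 : ι₁ → AddSubgroup N) (ℳ : ι₂ → AddSubgroup M) (δ : ι₁ → ι₂ → ι) (x : ι) :
    AddSubgroup (N ⊗[R] M) :=
  AddSubgroup.closure {t | ∃ y z n m, n ∈ 𝒩 y ∧ m ∈ ℳ z ∧ δ y z = x ∧ t = n ⊗ₜ[R] m}

variable [DecidableEq ι₁] [DecidableEq ι₂] [DecidableEq ι]

theorem exists_tensorProj {𝒩 : ι₁ → AddSubgroup N} {ℳ : ι₂ → AddSubgroup M} (δ : ι₁ → ι₂ → ι)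
    (h𝒩 : DirectSum.IsInternal 𝒩) (hℳ : DirectSum.IsInternal ℳ)
    {κ : Type*} (G : κ → Set R) (hG : AddSubmonoid.closure {r | ∃ i, r ∈ G i} = ⊤)
    (a : κ → ι₁ → ι₁) (b : κ → ι₂ → ι₂)
    (ha : ∀ i y r n, r ∈ G i → n ∈ 𝒩 y → r • n ∈ 𝒩 (a i y))
    (hb : ∀ i z r m, r ∈ G i → m ∈ ℳ z → r • m ∈ ℳ (b i z))
    (hδ : ∀ i y z, δ (a i y) z = δ y (b i z)) (x : ι) :
    ∃ P : N ⊗[R] M →+ N ⊗[R] M,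
      ∀ x' t, t ∈ tensorPiece (R := R) 𝒩 ℳ δ x' → P t = if x' = x then t else 0 := by
  classical
  let _ := h𝒩.chooseDecomposition
  let _ := hℳ.chooseDecomposition
  let F₀ : ∀ (y : ι₁) (z : ι₂), 𝒩 y →+ ℳ z →+ N ⊗[R] M := fun y z =>
    if δ y z = x then
      { toFun := fun n =>
          { toFun := fun m => (n : N) ⊗ₜ[R] (m : M)
            map_zero' := by simp
            map_add' := by intros; simp [TensorProduct.tmul_add] }
        map_zero' := by ext; simp
        map_add' := by intros; ext; simp [TensorProduct.add_tmul] }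
    else 0
  let F₁ : (DirectSum ι₁ fun y => 𝒩 y) →+ (DirectSum ι₂ fun z => ℳ z) →+ N ⊗[R] M :=
    DirectSum.toAddMonoid fun y => AddMonoidHom.flip
      (DirectSum.toAddMonoid fun z => AddMonoidHom.flip (F₀ y z))
  let F : N →+ M →+ N ⊗[R] M :=
    (((AddMonoidHom.compHom' (DirectSum.decomposeAddEquiv ℳ).toAddMonoidHom).comp F₁)).comp
      (DirectSum.decomposeAddEquiv 𝒩).toAddMonoidHom
  have hF : ∀ y z n m, n ∈ 𝒩 y → m ∈ ℳ z →
      F n m = if δ y z = x then n ⊗ₜ[R] m else 0 := by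
    intro y z n m hn hm
    have h1 : DirectSum.decompose 𝒩 n = DirectSum.of (fun y => 𝒩 y) y ⟨n, hn⟩ :=
      DirectSum.decompose_of_mem 𝒩 hn
    have h2 : DirectSum.decompose ℳ m = DirectSum.of (fun z => ℳ z) z ⟨m, hm⟩ :=
      DirectSum.decompose_of_mem ℳ hm
    change F₁ (DirectSum.decompose 𝒩 n) (DirectSum.decompose ℳ m) = _
    rw [h1, h2]
    simp only [F₁, DirectSum.toAddMonoid_of, AddMonoidHom.flip_apply, F₀]
    split_ifs <;> rfl
  have hNspan : ∀ p : N → Prop, p 0 → (∀ n n', p n → p n' → p (n + n')) →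
      (∀ y n, n ∈ 𝒩 y → p n) → ∀ n, p n := by
    intro p h0 hadd hmem n
    induction n using DirectSum.Decomposition.inductionOn 𝒩 with
    | zero => exact h0
    | homogeneous m => exact hmem _ _ m.2
    | add _ _ h h' => exact hadd _ _ h h'
  have hMspan : ∀ p : M → Prop, p 0 → (∀ n n', p n → p n' → p (n + n')) →
      (∀ y n, n ∈ ℳ y → p n) → ∀ n, p n := by
    intro p h0 hadd hmem n
    induction n using DirectSum.Decomposition.inductionOn ℳ with
    | zero => exact h0
    | homogeneous m => exact hmem _ _ m.2
    | add _ _ h h' => exact hadd _ _ h h'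
  have hbal : ∀ (r : R) (n : N) (m : M), F (r • n) m = F n (r • m) := by
    intro r
    have hr : r ∈ AddSubmonoid.closure {r | ∃ i, r ∈ G i} := hG ▸ AddSubmonoid.mem_top r
    induction hr using AddSubmonoid.closure_induction with
    | zero => intros; simp
    | add r r' _ _ h h' => intro n m; simp [add_smul, h, h']
    | mem r hr =>
      obtain ⟨i, hi⟩ := hr
      refine hNspan _ (fun m => by simp) (fun n n' h h' m => by simp [smul_add, h, h']) ?_
      intro y n hn
      refine hMspan _ (by simp) (fun m m' h h' => by simp [smul_add, h, h']) ?_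
      intro z m hm
      rw [hF _ _ _ _ (ha i y r n hi hn) hm, hF _ _ _ _ hn (hb i z r m hi hm), hδ,
        TensorProduct.smul_tmul]
  refine ⟨TensorProduct.liftAddHom F hbal, fun x' t ht => ?_⟩
  induction ht using AddSubgroup.closure_induction with
  | zero => simp
  | add t t' _ _ h h' => rw [map_add, h, h']; split_ifs <;> simp
  | neg t _ h => rw [map_neg, h]; split_ifs <;> simp
  | mem t ht =>
    obtain ⟨y, z, n, m, hn, hm, rfl, rfl⟩ := ht
    rw [TensorProduct.liftAddHom_tmul, hF y z n m hn hm]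

end Internal

/-! ### Graded modules -/

section GrMod

variable {k : Type w} {R : Type u} [CommRing k] [CommRing R] [Algebra k R]

theorem closure_homogeneous {ι : Type*} [DecidableEq ι] [AddMonoid ι]
    (𝒜 : ι → Submodule k R) [GradedAlgebra 𝒜] :
    AddSubmonoid.closure {r | ∃ i, r ∈ (𝒜 i : Set R)} = ⊤ := by
  rw [eq_top_iff]
  intro r _
  induction r using DirectSum.Decomposition.inductionOn 𝒜 with
  | zero => exact zero_mem _
  | homogeneous m => exact AddSubmonoid.subset_closure ⟨_, m.2⟩
  | add _ _ h h' => exact add_mem (h trivial) (h' trivial)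

/-- A `ℤ`-graded module over the `ℤ`-graded ring `R = ⨁ 𝒜 i`, that is, a `𝔾ₘ`-equivariant
module. -/
structure GrMod (𝒜 : ℤ → Submodule k R) where
  /-- the underlying module -/
  carrier : Type u
  [addCommGroup : AddCommGroup carrier]
  [module : Module R carrier]
  /-- the homogeneous parts -/
  grading : ℤ → AddSubgroup carrier
  isInternal : DirectSum.IsInternal grading
  smul_mem : ∀ {i j : ℤ} {r : R} {m : carrier},
    r ∈ 𝒜 i → m ∈ grading j → r • m ∈ grading (i + j)

attribute [instance] GrMod.addCommGroup GrMod.module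

namespace GrMod

variable {𝒜 : ℤ → Submodule k R}

/-- Morphisms of graded modules: the `R`-linear maps that preserve degrees. -/
def homs (M N : GrMod 𝒜) : AddSubgroup (M.carrier →ₗ[R] N.carrier) where
  carrier := {φ | ∀ i, ∀ m ∈ M.grading i, φ m ∈ N.grading i}
  zero_mem' := fun _ _ _ => zero_mem _
  add_mem' := fun h h' i m hm => add_mem (h i m hm) (h' i m hm)
  neg_mem' := fun h i m hm => neg_mem (h i m hm)

instance : Category (GrMod 𝒜) where
  Hom M N := homs M N
  id M := ⟨LinearMap.id, fun _ _ h => h⟩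
  comp φ ψ := ⟨ψ.1.comp φ.1, fun i m hm => ψ.2 i _ (φ.2 i m hm)⟩

/-- The linear map underlying a morphism of graded modules. -/
def Hom.lin {M N : GrMod 𝒜} (φ : M ⟶ N) : M.carrier →ₗ[R] N.carrier := φ.1

/-- A degree-preserving linear map, as a morphism of graded modules. -/
def Hom.mk {M N : GrMod 𝒜} (φ : M.carrier →ₗ[R] N.carrier)
    (h : ∀ i, ∀ m ∈ M.grading i, φ m ∈ N.grading i) : M ⟶ N := ⟨φ, h⟩

theorem Hom.mem {M N : GrMod 𝒜} (φ : M ⟶ N) {i : ℤ} {m : M.carrier} (h : m ∈ M.grading i) :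
    Hom.lin φ m ∈ N.grading i := φ.2 i m h

theorem Hom.ext {M N : GrMod 𝒜} {φ ψ : M ⟶ N} (h : Hom.lin φ = Hom.lin ψ) : φ = ψ :=
  Subtype.ext h

instance (M N : GrMod 𝒜) : AddCommGroup (M ⟶ N) := inferInstanceAs (AddCommGroup (homs M N))

theorem Hom.lin_add {M N : GrMod 𝒜} (φ ψ : M ⟶ N) :
    Hom.lin (φ + ψ) = Hom.lin φ + Hom.lin ψ := rfl

theorem Hom.lin_comp {L M N : GrMod 𝒜} (φ : L ⟶ M) (ψ : M ⟶ N) :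
    Hom.lin (φ ≫ ψ) = (Hom.lin ψ).comp (Hom.lin φ) := rfl

theorem Hom.lin_id (M : GrMod 𝒜) : Hom.lin (𝟙 M) = LinearMap.id := rfl

instance : Preadditive (GrMod 𝒜) where
  add_comp _ _ _ φ φ' ψ := Hom.ext (by
    simp only [Hom.lin_add, Hom.lin_comp, LinearMap.comp_add])
  comp_add _ _ _ φ ψ ψ' := Hom.ext (by
    simp only [Hom.lin_add, Hom.lin_comp, LinearMap.add_comp])

variable (𝒜)

/-- Forgetting the grading. -/
def forget : GrMod 𝒜 ⥤ ModuleCat.{u} R where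
  obj M := ModuleCat.of R M.carrier
  map φ := ModuleCat.ofHom (Hom.lin φ)

instance : (forget 𝒜).Additive where

/-- The quasi-isomorphisms of (unbounded) cochain complexes of graded modules, that is, the maps
of complexes which induce isomorphisms on cohomology. A kernel or cokernel of graded modules is
computed on the underlying modules, and so is cohomology. -/
def quasiIso : MorphismProperty (CochainComplex (GrMod 𝒜) ℤ) :=
  (HomologicalComplex.quasiIso (ModuleCat.{u} R) (ComplexShape.up ℤ)).inverseImage
    ((forget 𝒜).mapHomologicalComplex (ComplexShape.up ℤ))

/-- The unbounded derived category of graded `R`-modules: complexes of graded modules,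
localized at the quasi-isomorphisms. -/
abbrev Derived := (quasiIso 𝒜).Localization

end GrMod

end GrMod

section Transform

variable {k : Type w} {R S : Type u} [CommRing k] [CommRing R] [CommRing S] [Algebra k R]
  [Algebra k S] {𝒜 : ℤ → Submodule k R} {ℬ : ℤ → Submodule k S}

/-- The functor induced by `F` on complexes, followed by passage to the derived category. -/
noncomputable abbrev GrMod.toDerived (F : GrMod 𝒜 ⥤ GrMod ℬ) [F.Additive] :
    CochainComplex (GrMod 𝒜) ℤ ⥤ GrMod.Derived ℬ :=
  F.mapHomologicalComplex (ComplexShape.up ℤ) ⋙ (GrMod.quasiIso ℬ).Q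

/-- `F` has a total left derived functor on the unbounded derived categories. -/
abbrev GrMod.HasLeftDerived (F : GrMod 𝒜 ⥤ GrMod ℬ) [F.Additive] : Prop :=
  (GrMod.toDerived F).HasLeftDerivedFunctor (GrMod.quasiIso 𝒜)

/-- The total left derived functor of `F`. -/
noncomputable def GrMod.leftDerived (F : GrMod 𝒜 ⥤ GrMod ℬ) [F.Additive] [GrMod.HasLeftDerived F] :
    GrMod.Derived 𝒜 ⥤ GrMod.Derived ℬ :=
  (GrMod.toDerived F).totalLeftDerived (GrMod.quasiIso 𝒜).Q (GrMod.quasiIso 𝒜)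

variable (𝒜 ℬ)

/-- A graded `k`-algebra `B` with maps `R → B ← S` from two `ℤ`-graded algebras, which are
compatible with the degrees by means of additive maps `ℤ → ι ← ℤ`; it is the kernel of the functor
from graded `R`-modules to graded `S`-modules defined below. -/
structure Kernel where
  /-- the degrees of `B` -/
  ι : Type
  [addCommGroup : AddCommGroup ι]
  [decidableEq : DecidableEq ι]
  /-- the algebra -/
  B : Type u
  [commRing : CommRing B]
  [algebra : Algebra k B]
  /-- its homogeneous parts -/
  gr : ι → Submodule k B
  [gradedAlgebra : GradedAlgebra gr]
  /-- the structure map on the source side -/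
  src : R →ₐ[k] B
  srcDeg : ℤ →+ ι
  src_mem : ∀ {i r}, r ∈ 𝒜 i → src r ∈ gr (srcDeg i)
  /-- the structure map on the target side -/
  tgt : S →ₐ[k] B
  tgtDeg : ℤ →+ ι
  tgt_mem : ∀ {i r}, r ∈ ℬ i → tgt r ∈ gr (tgtDeg i)
  tgtDeg_injective : Function.Injective tgtDeg

attribute [instance] Kernel.addCommGroup Kernel.decidableEq Kernel.commRing Kernel.algebra
  Kernel.gradedAlgebra

namespace Kernel

variable {𝒜 ℬ} (K : Kernel 𝒜 ℬ)

/-- The homogeneous parts of `B`, as subgroups of `B` regarded as an `R`-module through the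
source map. -/
noncomputable def pieces (x : K.ι) : AddSubgroup (Along (K.src : R →+* K.B)) :=
  ((K.gr x).toAddSubgroup).map (Along.of (K.src : R →+* K.B)).toAddMonoidHom

theorem isInternal_pieces : DirectSum.IsInternal K.pieces := by
  have h := DirectSum.Decomposition.isInternal K.gr
  refine isInternal_of_detect (P := K.B) K.pieces (fun x => ?_) ?_ ?_ ?_
  · exact (GradedRing.proj K.gr x).comp
      (Along.of (K.src : R →+* K.B)).symm.toAddMonoidHom
  · rintro x y _ ⟨b, hb, rfl⟩ hne
    exact DirectSum.decompose_of_mem_ne K.gr hb hne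
  · rintro x _ ⟨b, hb, rfl⟩ h0
    have h1 : (DirectSum.decompose K.gr b x : K.B) = 0 := h0
    rw [DirectSum.decompose_of_mem_same K.gr hb] at h1
    rw [h1, map_zero]
  · rw [eq_top_iff]
    intro t _
    induction (show K.B from t) using DirectSum.Decomposition.inductionOn K.gr with
    | zero => exact zero_mem _
    | homogeneous m => exact AddSubmonoid.subset_closure ⟨_, m, m.2, rfl⟩
    | add _ _ h h' => exact add_mem h h'

/-- `B ⊗[R] M`, the tensor product being formed along the source map. -/
def Tens (M : Type u) [AddCommGroup M] [Module R M] : Type u :=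
  Along (K.src : R →+* K.B) ⊗[R] M

section Tens

variable (M : Type u) [AddCommGroup M] [Module R M]

noncomputable instance : AddCommGroup (K.Tens M) :=
  inferInstanceAs (AddCommGroup (Along (K.src : R →+* K.B) ⊗[R] M))

/-- The action of `B` on the left factor of `B ⊗[R] M`. -/
noncomputable instance : Module K.B (K.Tens M) :=
  inferInstanceAs (Module (Along (K.src : R →+* K.B)) (Along (K.src : R →+* K.B) ⊗[R] M))

/-- The action of `S` on `B ⊗[R] M` through the target map. -/
noncomputable instance : Module S (K.Tens M) :=
  Module.compHom _ (K.tgt : S →+* K.B)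

end Tens

/-- The pure tensor `b ⊗ m`. -/
noncomputable def tmul {M : Type u} [AddCommGroup M] [Module R M] (b : K.B) (m : M) : K.Tens M :=
  Along.of (K.src : R →+* K.B) b ⊗ₜ[R] m

/-- The degree `x` part of `B ⊗[R] M`, where `b ⊗ m` has degree `deg b + deg m`, the degree of `m`
being transported to `ι`. -/
noncomputable def tensGrading (M : GrMod 𝒜) (x : K.ι) : AddSubgroup (K.Tens M.carrier) :=
  tensorPiece (R := R) K.pieces M.grading (fun y z => y + K.srcDeg z) x

theorem smul_tmul {M : Type u} [AddCommGroup M] [Module R M] (r : S) (b : K.B) (m : M) :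
    r • K.tmul b m = K.tmul (K.tgt r * b) m := rfl

theorem tens_induction {M : Type u} [AddCommGroup M] [Module R M] {P : K.Tens M → Prop}
    (zero : P 0) (add : ∀ t t', P t → P t' → P (t + t')) (tmul : ∀ b m, P (K.tmul b m))
    (t : K.Tens M) : P t :=
  TensorProduct.induction_on (motive := P) t zero (fun b m => tmul b m) add

theorem mem_tensGrading_iff (M : GrMod 𝒜) (x : K.ι) :
    K.tensGrading M x = AddSubgroup.closure
      {t | ∃ y z b m, b ∈ K.gr y ∧ m ∈ M.grading z ∧ y + K.srcDeg z = x ∧ t = K.tmul b m} := by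
  unfold tensGrading tensorPiece
  congr 1
  ext t
  constructor
  · rintro ⟨y, z, _, m, ⟨b, hb, rfl⟩, hm, hx, rfl⟩
    exact ⟨y, z, b, m, hb, hm, hx, rfl⟩
  · rintro ⟨y, z, b, m, hb, hm, hx, rfl⟩
    exact ⟨y, z, _, m, ⟨b, hb, rfl⟩, hm, hx, rfl⟩

theorem smul_mem_tensGrading (M : GrMod 𝒜) {i : ℤ} {r : S} (hr : r ∈ ℬ i) {x : K.ι}
    {t : K.Tens M.carrier} (ht : t ∈ K.tensGrading M x) :
    r • t ∈ K.tensGrading M (K.tgtDeg i + x) := by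
  rw [mem_tensGrading_iff] at ht ⊢
  induction ht using AddSubgroup.closure_induction with
  | zero => rw [smul_zero]; exact zero_mem _
  | add _ _ _ _ h h' => rw [smul_add]; exact add_mem h h'
  | neg _ _ h => rw [smul_neg]; exact neg_mem h
  | mem t ht =>
    obtain ⟨y, z, b, m, hb, hm, rfl, rfl⟩ := ht
    exact AddSubgroup.subset_closure ⟨K.tgtDeg i + y, z, _, m,
      SetLike.mul_mem_graded (K.tgt_mem hr) hb, hm, add_assoc _ _ _, K.smul_tmul r b m⟩

/-- `1 ⊗ φ`. -/
noncomputable def tensMap {M N : GrMod 𝒜} (φ : M ⟶ N) :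
    K.Tens M.carrier →ₗ[S] K.Tens N.carrier :=
  let L : K.Tens M.carrier →+ K.Tens N.carrier :=
    ((GrMod.Hom.lin φ).lTensor (Along (K.src : R →+* K.B))).toAddMonoidHom
  { L with
    map_smul' := fun r => by
      refine K.tens_induction ?_ ?_ ?_
      · change L (r • 0) = r • L 0
        rw [smul_zero, map_zero, smul_zero]
      · intro t t' h h'
        change L (r • (t + t')) = r • L (t + t')
        change L (r • t) = r • L t at h
        change L (r • t') = r • L t' at h'
        rw [smul_add, map_add, h, h', map_add, smul_add]
      · intro b m
        rfl }

theorem tensMap_tmul {M N : GrMod 𝒜} (φ : M ⟶ N) (b : K.B) (m : M.carrier) :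
    K.tensMap φ (K.tmul b m) = K.tmul b (GrMod.Hom.lin φ m) := rfl

theorem tensMap_mem {M N : GrMod 𝒜} (φ : M ⟶ N) {x : K.ι} {t : K.Tens M.carrier}
    (ht : t ∈ K.tensGrading M x) : K.tensMap φ t ∈ K.tensGrading N x := by
  rw [mem_tensGrading_iff] at ht ⊢
  induction ht using AddSubgroup.closure_induction with
  | zero => rw [map_zero]; exact zero_mem _
  | add _ _ _ _ h h' => rw [map_add]; exact add_mem h h'
  | neg _ _ h => rw [map_neg]; exact neg_mem h
  | mem t ht =>
    obtain ⟨y, z, b, m, hb, hm, rfl, rfl⟩ := ht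
    exact AddSubgroup.subset_closure ⟨y, z, b, _, hb, GrMod.Hom.mem φ hm, rfl, rfl⟩

theorem tensMap_ext {M N : GrMod 𝒜} {φ ψ : K.Tens M.carrier →ₗ[S] K.Tens N.carrier}
    (h : ∀ b m, φ (K.tmul b m) = ψ (K.tmul b m)) (t : K.Tens M.carrier) : φ t = ψ t :=
  K.tens_induction (P := fun t => φ t = ψ t) (by rw [map_zero, map_zero])
    (fun t t' h₁ h₂ => by rw [map_add, map_add, h₁, h₂]) h t

theorem exists_proj [GradedAlgebra 𝒜] (M : GrMod 𝒜) (x : K.ι) :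
    ∃ P : K.Tens M.carrier →+ K.Tens M.carrier,
      ∀ x' t, t ∈ K.tensGrading M x' → P t = if x' = x then t else 0 := by
  refine exists_tensorProj (R := R) (fun y z => y + K.srcDeg z) K.isInternal_pieces M.isInternal
    (fun i : ℤ => (𝒜 i : Set R)) (closure_homogeneous 𝒜)
    (fun i y => K.srcDeg i + y) (fun i z => i + z) ?_ ?_ ?_ x
  · rintro i y r _ hr ⟨b, hb, rfl⟩
    exact ⟨K.src r * b, SetLike.mul_mem_graded (K.src_mem hr) hb,
      (Along.smul_of (K.src : R →+* K.B) r b).symm⟩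
  · intro i z r m hr hm
    exact M.smul_mem hr hm
  · intro i y z
    simp only [map_add]
    abel

variable [GradedAlgebra ℬ]

/-- The part of `B ⊗[R] M` whose degrees come from the target side, that is, the sum over `a : ℤ`
of its parts of degree `tgtDeg a`, as an `S`-module. -/
noncomputable def subm (M : GrMod 𝒜) : Submodule S (K.Tens M.carrier) where
  carrier := (⨆ a : ℤ, K.tensGrading M (K.tgtDeg a) : AddSubgroup (K.Tens M.carrier))
  zero_mem' := zero_mem _
  add_mem' := fun h h' => add_mem h h'
  smul_mem' := by
    intro r t ht
    change t ∈ (⨆ a : ℤ, K.tensGrading M (K.tgtDeg a) : AddSubgroup (K.Tens M.carrier)) at ht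
    change r • t ∈ (⨆ a : ℤ, K.tensGrading M (K.tgtDeg a) : AddSubgroup (K.Tens M.carrier))
    induction r using DirectSum.Decomposition.inductionOn ℬ with
    | zero => rw [zero_smul]; exact zero_mem _
    | add _ _ h h' => rw [add_smul]; exact add_mem h h'
    | @homogeneous i r =>
      induction ht using AddSubgroup.iSup_induction' with
      | h1 => rw [smul_zero]; exact zero_mem _
      | hadd _ _ _ _ h h' => rw [smul_add]; exact add_mem h h'
      | hp a t ht =>
        have h := K.smul_mem_tensGrading M r.2 ht
        rw [← map_add] at h
        exact (le_iSup (fun a : ℤ => K.tensGrading M (K.tgtDeg a)) (i + a)) h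

/-- The homogeneous parts of `subm`. -/
noncomputable def submGrading (M : GrMod 𝒜) (a : ℤ) : AddSubgroup (K.subm M) :=
  (K.tensGrading M (K.tgtDeg a)).comap (K.subm M).subtype.toAddMonoidHom

theorem isInternal_submGrading [GradedAlgebra 𝒜] (M : GrMod 𝒜) : DirectSum.IsInternal (K.submGrading M) := by
  choose P hP using K.exists_proj M
  refine isInternal_of_detect (P := K.Tens M.carrier) (K.submGrading M)
    (fun a => (P (K.tgtDeg a)).comp (K.subm M).subtype.toAddMonoidHom) ?_ ?_ ?_
  · intro a a' t ht hne
    have := hP (K.tgtDeg a) (K.tgtDeg a') t ht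
    rw [if_neg (fun h => hne (K.tgtDeg_injective h))] at this
    exact this
  · intro a t ht h0
    have := hP (K.tgtDeg a) (K.tgtDeg a) t ht
    rw [if_pos rfl] at this
    exact Subtype.ext (this.symm.trans h0)
  · rw [eq_top_iff]
    rintro ⟨t, ht⟩ -
    have ht' : t ∈ (⨆ a : ℤ, K.tensGrading M (K.tgtDeg a) : AddSubgroup (K.Tens M.carrier)) := ht
    induction ht' using AddSubgroup.iSup_induction' with
    | h1 => exact zero_mem _
    | hadd t t' h₁ h₂ h h' => exact add_mem (h h₁) (h' h₂)
    | hp a t h => exact AddSubmonoid.subset_closure ⟨a, h⟩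

theorem tensMap_mem_subm {M N : GrMod 𝒜} (φ : M ⟶ N) {t : K.Tens M.carrier}
    (ht : t ∈ K.subm M) : K.tensMap φ t ∈ K.subm N := by
  have ht' : t ∈ (⨆ a : ℤ, K.tensGrading M (K.tgtDeg a) : AddSubgroup (K.Tens M.carrier)) := ht
  induction ht' using AddSubgroup.iSup_induction' with
  | h1 => rw [map_zero]; exact zero_mem _
  | hadd t t' h₁ h₂ h h' => rw [map_add]; exact add_mem (h h₁) (h' h₂)
  | hp a t h =>
    exact (le_iSup (fun a : ℤ => K.tensGrading N (K.tgtDeg a)) a) (K.tensMap_mem φ h)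

variable [GradedAlgebra 𝒜]

/-- The graded `S`-module `⨁ₐ (B ⊗[R] M)_{tgtDeg a}` obtained from a graded `R`-module `M`. -/
noncomputable def onObj (M : GrMod 𝒜) : GrMod ℬ where
  carrier := K.subm M
  grading := K.submGrading M
  isInternal := K.isInternal_submGrading M
  smul_mem := by
    intro i j r m hr hm
    have h := K.smul_mem_tensGrading M hr hm
    rw [← map_add] at h
    exact h

/-- The functor `M ↦ ⨁ₐ (B ⊗[R] M)_{tgtDeg a}` from graded `R`-modules to graded `S`-modules. -/
noncomputable def functor : GrMod 𝒜 ⥤ GrMod ℬ where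
  obj M := K.onObj M
  map {M N} φ := GrMod.Hom.mk (M := K.onObj M) (N := K.onObj N)
    ((K.tensMap φ).restrict fun _ ht => K.tensMap_mem_subm φ ht)
    (fun _ _ hm => K.tensMap_mem φ hm)
  map_id M := GrMod.Hom.ext <| LinearMap.ext fun t => Subtype.ext <|
    K.tensMap_ext (φ := K.tensMap (𝟙 M)) (ψ := LinearMap.id) (fun _ _ => rfl) t.1
  map_comp φ ψ := GrMod.Hom.ext <| LinearMap.ext fun t => Subtype.ext <|
    K.tensMap_ext (φ := K.tensMap (φ ≫ ψ)) (ψ := (K.tensMap ψ).comp (K.tensMap φ))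
      (fun _ _ => rfl) t.1

instance : K.functor.Additive where
  map_add {_ _ φ ψ} := GrMod.Hom.ext <| LinearMap.ext fun t => Subtype.ext <|
    K.tensMap_ext (φ := K.tensMap (φ + ψ)) (ψ := K.tensMap φ + K.tensMap ψ)
      (fun _ _ => TensorProduct.tmul_add _ _ _) t.1

end Kernel

end Transform

/-! ### The algebra `Q(R)` -/

section Q

variable {k : Type w} {R S : Type u} [CommRing k] [CommRing R] [CommRing S] [Algebra k R]
  [Algebra k S] (𝒜 : ℤ → Submodule k R) (ℬ : ℤ → Submodule k S) [GradedAlgebra 𝒜]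
  [GradedAlgebra ℬ]

/-- The projection `π : R → R[u, u⁻¹]`, `π r = r`; the variable `u` is `T 1`. -/
noncomputable def proj (k : Type w) (R : Type u) [CommRing k] [CommRing R] [Algebra k R] :
    R →ₐ[k] R[T;T⁻¹] :=
  { LaurentPolynomial.C with commutes' := fun _ => rfl }

/-- The co-action `σ : R → R[u, u⁻¹]`, with `σ r = r uⁱ` for `r` homogeneous of degree `i`. -/
noncomputable def coact : R →ₐ[k] R[T;T⁻¹] :=
  (DirectSum.toAlgebra k (fun i => 𝒜 i)
    (fun i => ((AddMonoidAlgebra.lsingle i : R →ₗ[R] R[T;T⁻¹]).restrictScalars k).comp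
      (𝒜 i).subtype)
    (by rfl)
    (fun {i j} r s =>
      (AddMonoidAlgebra.single_mul_single i j (r : R) (s : R)).symm)).comp
    (DirectSum.decomposeAlgEquiv 𝒜).toAlgHom

theorem coact_of_mem {i : ℤ} {r : R} (hr : r ∈ 𝒜 i) :
    coact 𝒜 r = LaurentPolynomial.C r * LaurentPolynomial.T i := by
  have h : DirectSum.decomposeAlgEquiv 𝒜 r = DirectSum.of (fun i => 𝒜 i) i ⟨r, hr⟩ :=
    DirectSum.decompose_of_mem 𝒜 hr
  rw [← LaurentPolynomial.single_eq_C_mul_T]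
  unfold coact
  rw [AlgHom.comp_apply]
  erw [h]
  exact DirectSum.toAddMonoid_of _ i _

/-- `Q(R)`, the `k`-subalgebra of `R[u, u⁻¹]` generated by `π(R)`, `σ(R)` and `u`. -/
noncomputable def Q : Subalgebra k R[T;T⁻¹] :=
  Algebra.adjoin k
    (Set.range (proj k R) ∪ Set.range (coact 𝒜) ∪ {LaurentPolynomial.T 1})

/-- `p : R → Q(R)`, the corestriction of `π`. -/
noncomputable def Q.p : R →ₐ[k] Q 𝒜 :=
  (proj k R).codRestrict (Q 𝒜) fun r =>
    Algebra.subset_adjoin (Or.inl (Or.inl ⟨r, rfl⟩))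

/-- `s : R → Q(R)`, the corestriction of `σ`. -/
noncomputable def Q.s : R →ₐ[k] Q 𝒜 :=
  (coact 𝒜).codRestrict (Q 𝒜) fun r =>
    Algebra.subset_adjoin (Or.inl (Or.inr ⟨r, rfl⟩))

/-- The part of `Q(R)` of bidegree `(a, b)`. In `R[u, u⁻¹]` the bidegree of `r` is `(deg r, 0)`
and that of `u` is `(-1, 1)`, so this part consists of the `r uᵇ` with `r` of degree `a + b`. -/
def Q.gr (x : ℤ × ℤ) : Submodule k (Q 𝒜) where
  carrier := {q | ∃ r ∈ 𝒜 (x.1 + x.2),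
    (q : R[T;T⁻¹]) = LaurentPolynomial.C r * LaurentPolynomial.T x.2}
  zero_mem' := ⟨0, zero_mem _, by simp⟩
  add_mem' := by
    rintro _ _ ⟨r, hr, h⟩ ⟨r', hr', h'⟩
    exact ⟨r + r', add_mem hr hr', by simp [h, h', add_mul]⟩
  smul_mem' := by
    rintro c _ ⟨r, hr, h⟩
    refine ⟨c • r, (𝒜 _).smul_mem c hr, ?_⟩
    have h1 : LaurentPolynomial.C (c • r) = c • LaurentPolynomial.C r :=
      map_smul (proj k R) c r
    rw [h1, smul_mul_assoc, ← h]
    rfl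

theorem Q.p_mem {i : ℤ} {r : R} (hr : r ∈ 𝒜 i) : Q.p 𝒜 r ∈ Q.gr 𝒜 (i, 0) :=
  ⟨r, by simpa using hr, by rw [LaurentPolynomial.T_zero, mul_one]; rfl⟩

theorem Q.s_mem {i : ℤ} {r : R} (hr : r ∈ 𝒜 i) : Q.s 𝒜 r ∈ Q.gr 𝒜 (0, i) :=
  ⟨r, by simpa using hr, coact_of_mem 𝒜 hr⟩

instance : SetLike.GradedMonoid (Q.gr 𝒜) where
  one_mem := ⟨1, by simpa using SetLike.one_mem_graded 𝒜, by simp⟩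
  mul_mem := by
    rintro ⟨a, b⟩ ⟨a', b'⟩ _ _ ⟨r, hr, h⟩ ⟨r', hr', h'⟩
    refine ⟨r * r', ?_, ?_⟩
    · have := SetLike.mul_mem_graded hr hr'
      convert this using 2
      simp only [Prod.mk_add_mk]
      ring
    · simp only [MulMemClass.coe_mul, h, h', map_mul, Prod.mk_add_mk, LaurentPolynomial.T_add]
      ring

theorem Q.closure_gr : AddSubmonoid.closure {q : Q 𝒜 | ∃ x, q ∈ Q.gr 𝒜 x} = ⊤ := by
  set H := AddSubmonoid.closure {q : Q 𝒜 | ∃ x, q ∈ Q.gr 𝒜 x} with hH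
  have hmem : ∀ {x q}, q ∈ Q.gr 𝒜 x → q ∈ H := fun h => AddSubmonoid.subset_closure ⟨_, h⟩
  have hmul : ∀ q ∈ H, ∀ q' ∈ H, q * q' ∈ H := by
    intro q hq q' hq'
    induction hq using AddSubmonoid.closure_induction with
    | zero => rw [zero_mul]; exact zero_mem _
    | add _ _ _ _ h h' => rw [add_mul]; exact add_mem h h'
    | mem q hq =>
      obtain ⟨x, hx⟩ := hq
      induction hq' using AddSubmonoid.closure_induction with
      | zero => rw [mul_zero]; exact zero_mem _
      | add _ _ _ _ h h' => rw [mul_add]; exact add_mem h h'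
      | mem q' hq' =>
        obtain ⟨x', hx'⟩ := hq'
        exact hmem (SetLike.mul_mem_graded hx hx')
  have hp : ∀ r, Q.p 𝒜 r ∈ H := by
    intro r
    induction r using DirectSum.Decomposition.inductionOn 𝒜 with
    | zero => rw [map_zero]; exact zero_mem _
    | homogeneous m => exact hmem (Q.p_mem 𝒜 m.2)
    | add _ _ h h' => rw [map_add]; exact add_mem h h'
  have hs : ∀ r, Q.s 𝒜 r ∈ H := by
    intro r
    induction r using DirectSum.Decomposition.inductionOn 𝒜 with
    | zero => rw [map_zero]; exact zero_mem _
    | homogeneous m => exact hmem (Q.s_mem 𝒜 m.2)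
    | add _ _ h h' => rw [map_add]; exact add_mem h h'
  rw [eq_top_iff]
  rintro ⟨q, hq⟩ -
  have hq' : q ∈ Algebra.adjoin k
    (Set.range (proj k R) ∪ Set.range (coact 𝒜) ∪ {LaurentPolynomial.T 1}) := hq
  induction hq' using Algebra.adjoin_induction with
  | mem q h =>
    rcases h with (⟨r, rfl⟩ | ⟨r, rfl⟩) | h
    · exact hp r
    · exact hs r
    · exact hmem (x := (-1, 1)) ⟨1, by simpa using SetLike.one_mem_graded 𝒜, by simpa using h⟩
  | algebraMap c =>
    have := hp (algebraMap k R c)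
    rw [AlgHom.commutes] at this
    exact this
  | add q q' h₁ h₂ h h' => exact add_mem (h h₁) (h' h₂)
  | mul q q' h₁ h₂ h h' => exact hmul ⟨q, h₁⟩ (h h₁) ⟨q', h₂⟩ (h' h₂)

theorem Q.isInternal_gr : DirectSum.IsInternal (Q.gr 𝒜) := by
  let c : ℤ × ℤ → Q 𝒜 →+ R := fun x =>
    (GradedRing.proj 𝒜 (x.1 + x.2)).comp ((Finsupp.applyAddHom x.2).comp
      (AddMonoidAlgebra.coeffAddEquiv.toAddMonoidHom.comp (Q 𝒜).val.toLinearMap.toAddMonoidHom))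
  have hc : ∀ (x y : ℤ × ℤ) (q : Q 𝒜) (r : R),
      (q : R[T;T⁻¹]) = LaurentPolynomial.C r * LaurentPolynomial.T y.2 →
      c x q = if y.2 = x.2 then GradedRing.proj 𝒜 (x.1 + x.2) r else 0 := by
    intro x y q r h
    change GradedRing.proj 𝒜 (x.1 + x.2) ((q : R[T;T⁻¹]).coeff x.2) = _
    rw [h, ← LaurentPolynomial.single_eq_C_mul_T, AddMonoidAlgebra.coeff_single,
      Finsupp.single_apply]
    split_ifs
    · rfl
    · exact map_zero _
  refine isInternal_of_detect (Q.gr 𝒜) c ?_ ?_ (Q.closure_gr 𝒜)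
  · rintro x y q ⟨r, hr, h⟩ hne
    rw [hc x y q r h]
    split_ifs with hb
    · refine DirectSum.decompose_of_mem_ne 𝒜 hr fun h' => hne (Prod.ext ?_ hb)
      rw [hb] at h'
      exact add_right_cancel h'
    · rfl
  · rintro x q ⟨r, hr, h⟩ h0
    rw [hc x x q r h, if_pos rfl] at h0
    have h1 : r = 0 := (DirectSum.decompose_of_mem_same 𝒜 hr).symm.trans h0
    subst h1
    exact Subtype.ext (by rw [h]; simp)

noncomputable instance : GradedAlgebra (Q.gr 𝒜) where
  toDecomposition := (Q.isInternal_gr 𝒜).chooseDecomposition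

variable {𝒜 ℬ}

theorem mapAlgHom_coact (f : 𝒜 →ₐᵍ[k] ℬ) (r : R) :
    AddMonoidAlgebra.mapAlgHom ℤ f.toAlgHom (coact 𝒜 r) = coact ℬ (f r) := by
  induction r using DirectSum.Decomposition.inductionOn 𝒜 with
  | zero => simp
  | homogeneous m =>
    rw [coact_of_mem 𝒜 m.2, coact_of_mem ℬ (r := f m) (f.map_mem m.2),
      ← LaurentPolynomial.single_eq_C_mul_T, ← LaurentPolynomial.single_eq_C_mul_T,
      AddMonoidAlgebra.mapAlgHom_single]
    rfl
  | add _ _ h h' => simp only [map_add, h, h']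

theorem mapAlgHom_mem (f : 𝒜 →ₐᵍ[k] ℬ) {q : R[T;T⁻¹]} (hq : q ∈ Q 𝒜) :
    AddMonoidAlgebra.mapAlgHom ℤ f.toAlgHom q ∈ Q ℬ := by
  have h : (Q 𝒜) ≤ (Q ℬ).comap (AddMonoidAlgebra.mapAlgHom ℤ f.toAlgHom) := by
    refine Algebra.adjoin_le ?_
    rintro _ ((⟨r, rfl⟩ | ⟨r, rfl⟩) | rfl)
    · have : AddMonoidAlgebra.mapAlgHom ℤ f.toAlgHom (proj k R r) = proj k S (f r) :=
        AddMonoidAlgebra.mapAlgHom_single _ _ _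
      change AddMonoidAlgebra.mapAlgHom ℤ f.toAlgHom (proj k R r) ∈ Q ℬ
      rw [this]
      exact (Q.p ℬ (f r)).2
    · change AddMonoidAlgebra.mapAlgHom ℤ f.toAlgHom (coact 𝒜 r) ∈ Q ℬ
      rw [mapAlgHom_coact f r]
      exact (Q.s ℬ (f r)).2
    · refine Algebra.subset_adjoin (Or.inr ?_)
      exact (AddMonoidAlgebra.mapAlgHom_single _ _ _).trans (by rw [map_one]; rfl)
  exact h hq

/-- `Q(f) : Q(R) → Q(S)`, the restriction of the map `R[u, u⁻¹] → S[u, u⁻¹]` that applies `f` to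
the coefficients. -/
noncomputable def Q.map (f : 𝒜 →ₐᵍ[k] ℬ) : Q 𝒜 →ₐ[k] Q ℬ :=
  ((AddMonoidAlgebra.mapAlgHom ℤ f.toAlgHom).comp (Q 𝒜).val).codRestrict (Q ℬ)
    fun q => mapAlgHom_mem f q.2

/-! ### The functors -/

variable (𝒜)

/-- `Q(R)`, as a kernel from the `s`-side to the `p`-side. -/
noncomputable def Q.kernel : Kernel 𝒜 𝒜 where
  ι := ℤ × ℤ
  B := Q 𝒜
  gr := Q.gr 𝒜
  src := Q.s 𝒜
  srcDeg := AddMonoidHom.inr ℤ ℤ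
  src_mem := Q.s_mem 𝒜
  tgt := Q.p 𝒜
  tgtDeg := AddMonoidHom.inl ℤ ℤ
  tgt_mem := Q.p_mem 𝒜
  tgtDeg_injective := fun _ _ h => congrArg Prod.fst h

/-- `Q(R)`, as a kernel from the `p`-side to the `s`-side. -/
noncomputable def Q.kernelOp : Kernel 𝒜 𝒜 where
  ι := ℤ × ℤ
  B := Q 𝒜
  gr := Q.gr 𝒜
  src := Q.p 𝒜
  srcDeg := AddMonoidHom.inl ℤ ℤ
  src_mem := Q.p_mem 𝒜
  tgt := Q.s 𝒜
  tgtDeg := AddMonoidHom.inr ℤ ℤ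
  tgt_mem := Q.s_mem 𝒜
  tgtDeg_injective := fun _ _ h => congrArg Prod.snd h

/-- `M ↦ (Q(R) ⊗[R] M)_{(*, 0)}`: tensor along `s`, take the invariants for the `𝔾ₘ` that acts on
the `s`-side, and regard the result as a graded `R`-module through `p`. Taking invariants is exact,
so the Fourier-Mukai transform with kernel `Q(R)` is the total left derived functor of it. -/
noncomputable abbrev Phi : GrMod 𝒜 ⥤ GrMod 𝒜 := (Q.kernel 𝒜).functor

/-- The transform with kernel `Q(R)` in the opposite direction, `M ↦ (Q(R) ⊗[R] M)_{(0, *)}`: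
tensor along `p` and regard the result as a graded `R`-module through `s`. -/
noncomputable abbrev PhiOp : GrMod 𝒜 ⥤ GrMod 𝒜 := (Q.kernelOp 𝒜).functor

variable {𝒜}

/-- `S`, as a kernel from graded `R`-modules to graded `S`-modules. -/
def pullbackKernel (f : 𝒜 →ₐᵍ[k] ℬ) : Kernel 𝒜 ℬ where
  ι := ℤ
  B := S
  gr := ℬ
  src := f.toAlgHom
  srcDeg := AddMonoidHom.id ℤ
  src_mem := fun h => f.map_mem h
  tgt := AlgHom.id k S
  tgtDeg := AddMonoidHom.id ℤ
  tgt_mem := fun h => h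
  tgtDeg_injective := fun _ _ h => h

/-- `f^* : M ↦ S ⊗[R] M`, with `s ⊗ m` of degree `deg s + deg m`. (All degrees of `S ⊗[R] M` come
from the target side, so `subm` is all of it here.) -/
noncomputable abbrev pullback (f : 𝒜 →ₐᵍ[k] ℬ) : GrMod 𝒜 ⥤ GrMod ℬ := (pullbackKernel f).functor

/-! ### Strongly étale maps -/

/-- The map `R₀ → S₀` of invariant subrings induced by `f`. -/
def zeroHom (f : 𝒜 →ₐᵍ[k] ℬ) : 𝒜 0 →+* ℬ 0 where
  toFun r := ⟨f r, f.map_mem r.2⟩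
  map_one' := Subtype.ext (map_one f)
  map_mul' r r' := Subtype.ext (map_mul f (r : R) r')
  map_zero' := Subtype.ext (map_zero f)
  map_add' r r' := Subtype.ext (map_add f (r : R) r')

/-- `f : R → S` is strongly étale if the induced map `R₀ → S₀` of invariant subrings is étale and
`r ⊗ x ↦ f(r) x` is an isomorphism `R ⊗_{R₀} S₀ ≅ S`. -/
structure IsStronglyEtale (f : 𝒜 →ₐᵍ[k] ℬ) : Prop where
  etale : (zeroHom f).Etale
  exists_equiv : ∃ e : Along (algebraMap (𝒜 0) R) ⊗[𝒜 0] Along (zeroHom f) ≃+* S,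
    ∀ (r : R) (x : ℬ 0), e (Along.of _ r ⊗ₜ Along.of _ x) = f r * x

/-! ### The graded bimodules `S ⊗ Q(R)` and `Q(R) ⊗ S` -/

/-- `S ⊗[R] Q(R)`, with `R` acting on `S` through `f` and on `Q(R)` through `s`. -/
abbrev STensorQ (f : 𝒜 →ₐᵍ[k] ℬ) : Type u :=
  Along (f.toAlgHom : R →+* S) ⊗[R] Along (Q.s 𝒜 : R →+* Q 𝒜)

/-- The part of bidegree `d` of `S ⊗[R] Q(R)`: if `x` has degree `i` and `q` has bidegree `(a, b)`,
then `x ⊗ q` has bidegree `(a, b + i)`. -/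
noncomputable def STensorQ.gr (f : 𝒜 →ₐᵍ[k] ℬ) (d : ℤ × ℤ) : AddSubgroup (STensorQ f) :=
  tensorPiece (R := R)
    (fun i => (ℬ i).toAddSubgroup.map (Along.of (f.toAlgHom : R →+* S)).toAddMonoidHom)
    (fun y => (Q.gr 𝒜 y).toAddSubgroup.map (Along.of (Q.s 𝒜 : R →+* Q 𝒜)).toAddMonoidHom)
    (fun i y => (y.1, y.2 + i)) d

/-- `Q(R) ⊗[R] S`, with `R` acting on `Q(R)` through `p` and on `S` through `f`. -/
abbrev QTensorS (f : 𝒜 →ₐᵍ[k] ℬ) : Type u :=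
  Along (Q.p 𝒜 : R →+* Q 𝒜) ⊗[R] Along (f.toAlgHom : R →+* S)

/-- The part of bidegree `d` of `Q(R) ⊗[R] S`: if `q` has bidegree `(a, b)` and `x` has degree `i`,
then `q ⊗ x` has bidegree `(a + i, b)`. -/
noncomputable def QTensorS.gr (f : 𝒜 →ₐᵍ[k] ℬ) (d : ℤ × ℤ) : AddSubgroup (QTensorS f) :=
  tensorPiece (R := R)
    (fun y => (Q.gr 𝒜 y).toAddSubgroup.map (Along.of (Q.p 𝒜 : R →+* Q 𝒜)).toAddMonoidHom)
    (fun i => (ℬ i).toAddSubgroup.map (Along.of (f.toAlgHom : R →+* S)).toAddMonoidHom)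
    (fun y i => (y.1 + i, y.2)) d

end Q

end StronglyEtaleQ

open StronglyEtaleQ

/-! The coaction is trivial in degree zero, so `p` and `s` coincide on R₀, and a strongly étale S is
R ⊗_{R₀} S₀. Hence S ⊗_R Q(R), formed along either `p` or `s`, is a quotient of S₀ ⊗_{R₀} Q(R).

For (a), étaleness enters through the flatness of S₀ over R₀. The inclusion of Q(R) in R[u,u⁻¹]
stays injective after tensoring with S₀, and S₀ ⊗_{R₀} R[u,u⁻¹] is S[u,u⁻¹] coefficient by
coefficient. The resulting embedding factors through the map to Q(S), which is therefore injective
(`tensorQHom_injective`). Its image is a subring that contains u, p(S) and s(S), since S is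
additively spanned by products f(r)x with x in S₀ (`tensorQHom_surjective`). Homogeneous tensors go
to homogeneous elements of the right degree, and subgroups of the pieces of Q(S) that together
generate Q(S) must be all of these pieces (`map_eq_gr_of_le`).

For (b), the isomorphism is first established before deriving. There is a natural map S ⊗ (Q(R) ⊗ M)
→ Q(S) ⊗ (S ⊗ M), restricted to the parts selected by the transform. Part (a) supplies a map in the
other direction on the full tensor products. Together with the flatness of S over R it gives
injectivity on the selected part, and a degree count gives surjectivity
(`Kernel.BaseChange.isIso_nat_app`).

To pass to derived functors, every unbounded complex of graded modules is resolved by a semi-free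
one, built as the total complex of free covers of iterated syzygies (`quasiIso_totMap`,
`totSemiFree`). Semi-free complexes are K-projective, and left derived functors are computed on
K-projectives (`IsResolving.isLeftDerivedFunctor`). The composite of derived functors is the derived
functor of the composite as soon as the second functor needs no further resolution on the values of
the first. In one order this holds since f^* is exact, in the other since f^* preserves
K-projectives, being left adjoint to the exact restriction functor. -/

namespace StronglyEtaleQ

/-! ### Left derived functors from resolutions -/

section LeftDerived

variable {C D H K : Type*} [Category* C] [Category* D] [Category* H] [Category* K]

/-- A class `P` of objects of `C` by which all objects can be resolved with respect to `W`, and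
such that morphisms from objects in `P` to `W`-equivalent objects correspond to each other,
up to a congruence on `C` given by a full functor `q`. -/
structure IsResolving (W : MorphismProperty C) (q : C ⥤ K) (P : ObjectProperty C) : Prop where
  full : q.Full
  exists_resolution : ∀ X, ∃ (Y : C) (p : Y ⟶ X), P Y ∧ W p
  bijective : ∀ {Y X X' : C} (s : X ⟶ X'), P Y → W s →
    Function.Bijective fun g : q.obj Y ⟶ q.obj X => g ≫ q.map s

namespace IsResolving

variable {W : MorphismProperty C} {q : C ⥤ K} {P : ObjectProperty C} (h : IsResolving W q P)

include h in
theorem exists_lift {Y X X' : C} (s : X ⟶ X') (hY : P Y) (hs : W s) (g : Y ⟶ X') :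
    ∃ g' : Y ⟶ X, q.map (g' ≫ s) = q.map g := by
  have := h.full
  obtain ⟨a, ha⟩ := (h.bijective s hY hs).2 (q.map g)
  obtain ⟨g', rfl⟩ := q.map_surjective a
  exact ⟨g', by rw [q.map_comp]; exact ha⟩

include h in
theorem map_eq {Y X X' : C} (s : X ⟶ X') (hY : P Y) (hs : W s) {g g' : Y ⟶ X}
    (e : q.map (g ≫ s) = q.map (g' ≫ s)) : q.map g = q.map g' :=
  (h.bijective s hY hs).1 (by simpa only [q.map_comp] using e)

/-- A chosen resolution. -/
noncomputable def res (X : C) : C := (h.exists_resolution X).choose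

/-- The augmentation of the chosen resolution. -/
noncomputable def aug (X : C) : h.res X ⟶ X := (h.exists_resolution X).choose_spec.choose

theorem res_mem (X : C) : P (h.res X) := (h.exists_resolution X).choose_spec.choose_spec.1

theorem aug_mem (X : C) : W (h.aug X) := (h.exists_resolution X).choose_spec.choose_spec.2

/-- A lift of a morphism to the chosen resolutions. -/
noncomputable def lift {X X' : C} (f : X ⟶ X') : h.res X ⟶ h.res X' :=
  (h.exists_lift (h.aug X') (h.res_mem X) (h.aug_mem X') (h.aug X ≫ f)).choose

theorem map_lift_aug {X X' : C} (f : X ⟶ X') :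
    q.map (h.lift f ≫ h.aug X') = q.map (h.aug X ≫ f) :=
  (h.exists_lift (h.aug X') (h.res_mem X) (h.aug_mem X') (h.aug X ≫ f)).choose_spec

variable (F : C ⥤ H) (hF : ∀ {X Y : C} (f g : X ⟶ Y), q.map f = q.map g → F.map f = F.map g)

/-- The functor `F`, evaluated on resolutions. -/
noncomputable def onRes : C ⥤ H where
  obj X := F.obj (h.res X)
  map f := F.map (h.lift f)
  map_id X := by
    rw [← F.map_id]
    refine hF _ _ (h.map_eq (h.aug X) (h.res_mem X) (h.aug_mem X) ?_)
    rw [h.map_lift_aug, Category.comp_id, Category.id_comp]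
  map_comp {X Y Z} f g := by
    rw [← F.map_comp]
    refine hF _ _ (h.map_eq (h.aug Z) (h.res_mem X) (h.aug_mem Z) ?_)
    rw [h.map_lift_aug, Category.assoc, q.map_comp, q.map_comp (h.lift f), h.map_lift_aug g,
      ← q.map_comp, ← q.map_comp, ← Category.assoc (h.lift f), q.map_comp _ g,
      h.map_lift_aug f, ← q.map_comp, Category.assoc]

/-- The comparison between `F` on resolutions and `F`. -/
noncomputable def onResCounit : h.onRes F hF ⟶ F where
  app X := F.map (h.aug X)
  naturality X Y f := by
    change F.map (h.lift f) ≫ F.map (h.aug Y) = F.map (h.aug X) ≫ F.map f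
    rw [← F.map_comp, ← F.map_comp]
    exact hF _ _ (h.map_lift_aug f)

-- Whitehead's argument: lifting the identity of `Y` through `f` gives a right inverse up to the
-- congruence, and uniqueness of lifts makes it a left inverse as well.
include h hF in
theorem isIso_map {X Y : C} (f : X ⟶ Y) (hX : P X) (hY : P Y) (hf : W f) : IsIso (F.map f) := by
  obtain ⟨g, hg⟩ := h.exists_lift f hY hf (𝟙 Y)
  have hg' : q.map (f ≫ g) = q.map (𝟙 X) := by
    refine h.map_eq f hX hf ?_
    rw [Category.assoc, q.map_comp, hg, ← q.map_comp, Category.comp_id, Category.id_comp]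
  refine ⟨F.map g, ?_, ?_⟩
  · rw [← F.map_comp, hF _ _ hg', F.map_id]
  · rw [← F.map_comp, hF _ _ hg, F.map_id]

/-- Two-out-of-three puts the lift of `f` to resolutions in `W`; a `W`-map between objects of `P` is
invertible modulo the congruence. -/
theorem onRes_inverts [W.HasTwoOutOfThreeProperty]
    (hW : ∀ {X Y : C} (f g : X ⟶ Y), q.map f = q.map g → W f → W g) :
    W.IsInvertedBy (h.onRes F hF) := by
  intro X Y f hf
  refine h.isIso_map F hF (h.lift f) (h.res_mem X) (h.res_mem Y) ?_
  have h1 : W (h.lift f ≫ h.aug Y) :=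
    hW _ _ (h.map_lift_aug f).symm (W.comp_mem _ _ (h.aug_mem X) hf)
  exact W.of_postcomp _ _ (h.aug_mem Y) h1

variable (L : C ⥤ D) [L.IsLocalization W]

variable {F} in
/-- The factorization of a transformation to `F` through a functor which agrees with `F`
on resolutions, before localization. -/
noncomputable def factorApp
    (hL : ∀ {X Y : C} (f g : X ⟶ Y), q.map f = q.map g → L.map f = L.map g)
    (G : D ⥤ H) (β : L ⋙ G ⟶ F) [∀ X, IsIso (β.app (h.res X))]
    (G' : D ⥤ H) (ε : L ⋙ G' ⟶ F) : L ⋙ G' ⟶ L ⋙ G :=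
  have hi : ∀ X, IsIso (L.map (h.aug X)) := fun X => Localization.inverts L W _ (h.aug_mem X)
  -- Go from `X` to its resolution, where `β` is invertible, apply `ε` followed by the inverse of
  -- `β`, and return along the augmentation.
  { app := fun X => G'.map (inv (L.map (h.aug X))) ≫ ε.app (h.res X) ≫
        inv (β.app (h.res X)) ≫ G.map (L.map (h.aug X))
    naturality := fun X Y f => by
      have e : L.map f = inv (L.map (h.aug X)) ≫ L.map (h.lift f) ≫ L.map (h.aug Y) := by
        rw [IsIso.eq_inv_comp, ← L.map_comp, ← L.map_comp]
        exact (hL _ _ (h.map_lift_aug f)).symm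
      have e1 : G'.map (L.map (h.lift f)) ≫ ε.app _ = ε.app _ ≫ F.map (h.lift f) :=
        ε.naturality (h.lift f)
      have e2 : G.map (L.map (h.lift f)) ≫ β.app _ = β.app _ ≫ F.map (h.lift f) :=
        β.naturality (h.lift f)
      have e3 : F.map (h.lift f) ≫ inv (β.app (h.res Y)) =
          inv (β.app (h.res X)) ≫ G.map (L.map (h.lift f)) := by
        rw [IsIso.comp_inv_eq, Category.assoc, IsIso.eq_inv_comp, e2]
      simp only [Functor.comp_map, Functor.comp_obj]
      rw [e]
      simp only [Functor.map_comp, Category.assoc, Functor.map_inv]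
      rw [IsIso.hom_inv_id_assoc, IsIso.hom_inv_id_assoc, reassoc_of% e1, reassoc_of% e3] }

include h in
/-- A functor on the localization which agrees with `F` on the class `P` is a
left derived functor of `F`. -/
theorem isLeftDerivedFunctor
    (hL : ∀ {X Y : C} (f g : X ⟶ Y), q.map f = q.map g → L.map f = L.map g)
    (G : D ⥤ H) (β : L ⋙ G ⟶ F) (hβ : ∀ X, P X → IsIso (β.app X)) :
    G.IsLeftDerivedFunctor β W := by
  have hi : ∀ X, IsIso (L.map (h.aug X)) := fun X => Localization.inverts L W _ (h.aug_mem X)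
  have hb : ∀ X, IsIso (β.app (h.res X)) := fun X => hβ _ (h.res_mem X)
  have key : ∀ (G' : D ⥤ H) (γ γ' : G' ⟶ G),
      Functor.whiskerLeft L γ ≫ β = Functor.whiskerLeft L γ' ≫ β → γ = γ' := by
    intro G' γ γ' e
    refine Localization.natTrans_ext L W fun X => ?_
    -- The augmentation is invertible after `L`, so the two transformations need only be compared on
    -- the resolution, where `β` can be cancelled.
    rw [← cancel_epi (G'.map (L.map (h.aug X))), γ.naturality, γ'.naturality]
    congr 1
    rw [← cancel_mono (β.app (h.res X))]
    exact NatTrans.congr_app e (h.res X)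
  have exist : ∀ (G' : D ⥤ H) (ε : L ⋙ G' ⟶ F), ∃ γ : G' ⟶ G,
      Functor.whiskerLeft L γ ≫ β = ε := by
    intro G' ε
    refine ⟨Localization.liftNatTrans L W (L ⋙ G') (L ⋙ G) G' G (h.factorApp L hL G β G' ε),
      NatTrans.ext (funext fun X => ?_)⟩
    change (Localization.liftNatTrans L W (L ⋙ G') (L ⋙ G) G' G
      (h.factorApp L hL G β G' ε)).app (L.obj X) ≫ β.app X = ε.app X
    rw [Localization.liftNatTrans_app]
    have e1 : G.map (L.map (h.aug X)) ≫ β.app _ = β.app _ ≫ F.map (h.aug X) :=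
      β.naturality (h.aug X)
    have e2 : G'.map (L.map (h.aug X)) ≫ ε.app _ = ε.app _ ≫ F.map (h.aug X) :=
      ε.naturality (h.aug X)
    simp only [factorApp, Localization.Lifting.iso, Category.assoc]
    erw [Category.id_comp, Category.id_comp]
    rw [e1, IsIso.inv_hom_id_assoc, Functor.map_inv, IsIso.inv_comp_eq]
    exact e2.symm
  choose γ hγ using exist
  exact ⟨⟨⟨Limits.IsTerminal.ofUniqueHom
    (fun E => CostructuredArrow.homMk (γ E.left E.hom) (hγ E.left E.hom))
    fun E m => CostructuredArrow.hom_ext _ _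
      (key _ _ _ ((CostructuredArrow.w m).trans (hγ E.left E.hom).symm))⟩⟩⟩

-- The values of `F` on resolutions descend to the localization; on an object of `P` the counit is
-- `F` of a `W`-map between objects of `P`, hence invertible.
include h hF in
theorem hasLeftDerivedFunctor [W.HasTwoOutOfThreeProperty]
    (hW : ∀ {X Y : C} (f g : X ⟶ Y), q.map f = q.map g → W f → W g)
    (hL : ∀ {X Y : C} (f g : X ⟶ Y), q.map f = q.map g → W.Q.map f = W.Q.map g) :
    F.HasLeftDerivedFunctor W := by
  let G := Localization.lift (h.onRes F hF) (h.onRes_inverts F hF hW) W.Q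
  let i : W.Q ⋙ G ≅ h.onRes F hF := Localization.fac _ _ _
  have : G.IsLeftDerivedFunctor (i.hom ≫ h.onResCounit F hF) W := by
    refine h.isLeftDerivedFunctor F W.Q hL G _ fun X hX => ?_
    have : IsIso (F.map (h.aug X)) :=
      h.isIso_map F hF (h.aug X) (h.res_mem X) hX (h.aug_mem X)
    change IsIso (i.hom.app X ≫ F.map (h.aug X))
    exact IsIso.comp_isIso' inferInstance this
  exact Functor.HasLeftDerivedFunctor.mk' G (i.hom ≫ h.onResCounit F hF)

-- By uniqueness of derived functors it suffices to treat the one built from resolutions, whose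
-- counit is visibly invertible on `P`.
include h hF in
theorem isIso_counit_app [W.HasTwoOutOfThreeProperty]
    (hW : ∀ {X Y : C} (f g : X ⟶ Y), q.map f = q.map g → W f → W g)
    (hL : ∀ {X Y : C} (f g : X ⟶ Y), q.map f = q.map g → L.map f = L.map g)
    (G : D ⥤ H) (β : L ⋙ G ⟶ F) [G.IsLeftDerivedFunctor β W] {X : C} (hX : P X) :
    IsIso (β.app X) := by
  let G' := Localization.lift (h.onRes F hF) (h.onRes_inverts F hF hW) L
  let i : L ⋙ G' ≅ h.onRes F hF := Localization.fac _ _ _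
  have hi : ∀ X, P X → IsIso ((i.hom ≫ h.onResCounit F hF).app X) := by
    intro X hX
    have : IsIso (F.map (h.aug X)) :=
      h.isIso_map F hF (h.aug X) (h.res_mem X) hX (h.aug_mem X)
    change IsIso (i.hom.app X ≫ F.map (h.aug X))
    exact IsIso.comp_isIso' inferInstance this
  have : G'.IsLeftDerivedFunctor (i.hom ≫ h.onResCounit F hF) W :=
    h.isLeftDerivedFunctor F L hL G' _ hi
  let e := Functor.leftDerivedUnique G' G β (i.hom ≫ h.onResCounit F hF) W
  have e1 : e.hom.app (L.obj X) ≫ (i.hom ≫ h.onResCounit F hF).app X = β.app X :=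
    (Functor.leftDerivedNatTrans_app G G' β (i.hom ≫ h.onResCounit F hF) W (𝟙 F) X).trans
      (Category.comp_id _)
  have := hi X hX
  rw [← e1]
  infer_instance

end IsResolving
end LeftDerived

/-! ### Constructions with graded modules -/

section Constructions

variable {k : Type w} {R : Type u} [CommRing k] [CommRing R] [Algebra k R]

namespace GrMod

section Basic

variable {𝒜 : ℤ → Submodule k R}

/-- The projection of a graded module to its part of degree `i`. -/
noncomputable def component (M : GrMod 𝒜) (i : ℤ) : M.carrier →+ M.carrier :=
  let _ := M.isInternal.chooseDecomposition
  (M.grading i).subtype.comp ((DFinsupp.evalAddMonoidHom i).comp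
    (DirectSum.decomposeAddEquiv M.grading).toAddMonoidHom)

theorem component_mem (M : GrMod 𝒜) (i : ℤ) (m : M.carrier) : M.component i m ∈ M.grading i :=
  Subtype.property _

theorem component_of_mem (M : GrMod 𝒜) {i : ℤ} {m : M.carrier} (hm : m ∈ M.grading i) :
    M.component i m = m :=
  let _ := M.isInternal.chooseDecomposition
  DirectSum.decompose_of_mem_same M.grading hm

theorem component_of_mem_ne (M : GrMod 𝒜) {i j : ℤ} {m : M.carrier} (hm : m ∈ M.grading j)
    (h : j ≠ i) : M.component i m = 0 :=
  let _ := M.isInternal.chooseDecomposition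
  DirectSum.decompose_of_mem_ne M.grading hm h

theorem homogeneous_induction (M : GrMod 𝒜) {p : M.carrier → Prop} (zero : p 0)
    (homogeneous : ∀ i, ∀ m ∈ M.grading i, p m) (add : ∀ m m', p m → p m' → p (m + m'))
    (m : M.carrier) : p m := by
  let _ := M.isInternal.chooseDecomposition
  induction m using DirectSum.Decomposition.inductionOn M.grading with
  | zero => exact zero
  | homogeneous m => exact homogeneous _ _ m.2
  | add _ _ h h' => exact add _ _ h h'

theorem exists_sum_component (M : GrMod 𝒜) (m : M.carrier) :
    ∃ s : Finset ℤ, ∑ i ∈ s, M.component i m = m := by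
  classical
  let _ := M.isInternal.chooseDecomposition
  exact ⟨_, DirectSum.sum_support_decompose M.grading m⟩

theorem component_map {M N : GrMod 𝒜} (φ : M.carrier →+ N.carrier) (a : ℤ)
    (hφ : ∀ i, ∀ m ∈ M.grading i, φ m ∈ N.grading (i + a)) (i : ℤ) (m : M.carrier) :
    N.component (i + a) (φ m) = φ (M.component i m) := by
  refine M.homogeneous_induction (p := fun m => N.component (i + a) (φ m) = φ (M.component i m))
    (by simp) ?_ (fun m m' h h' => by simp [h, h']) m
  intro j m hm
  by_cases h : j = i
  · subst h
    rw [component_of_mem _ (hφ _ _ hm), component_of_mem _ hm]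
  · rw [component_of_mem_ne _ (hφ _ _ hm) (fun h' => h (add_right_cancel h')),
      component_of_mem_ne _ hm h, map_zero]

/-- The case of shift zero. It allows cycles, kernels and preimages to be split into homogeneous
parts. -/
theorem component_lin {M N : GrMod 𝒜} (φ : M ⟶ N) (i : ℤ) (m : M.carrier) :
    N.component i (Hom.lin φ m) = Hom.lin φ (M.component i m) := by
  have h := component_map (Hom.lin φ).toAddMonoidHom 0
    (fun i m hm => by rw [add_zero]; exact Hom.mem φ hm) i m
  rwa [add_zero] at h

@[simp]
theorem Hom.lin_zero {M N : GrMod 𝒜} : Hom.lin (0 : M ⟶ N) = 0 := rfl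

theorem Hom.lin_comp_apply {L M N : GrMod 𝒜} (φ : L ⟶ M) (ψ : M ⟶ N) (x : L.carrier) :
    Hom.lin (φ ≫ ψ) x = Hom.lin ψ (Hom.lin φ x) := rfl

/-- The zero graded module. -/
def zeroObj : GrMod 𝒜 where
  carrier := PUnit.{u + 1}
  grading := fun _ => ⊤
  isInternal := isInternal_of_detect (P := PUnit.{u + 1}) _ (fun _ => 0) (fun _ _ _ _ _ => rfl)
    (fun _ _ _ _ => rfl) (by
      rw [eq_top_iff]
      exact fun t _ => AddSubmonoid.subset_closure ⟨0, AddSubgroup.mem_top _⟩)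
  smul_mem := fun _ _ => AddSubgroup.mem_top _

/-- Needed, with the biproducts below, for mapping cones and the triangulated structure on the
homotopy category. -/
instance : Limits.HasZeroObject (GrMod 𝒜) where
  zero := ⟨zeroObj, (Limits.IsZero.iff_id_eq_zero _).2
    (Hom.ext (LinearMap.ext fun x => (rfl : x = (PUnit.unit : PUnit.{u + 1}))))⟩

/-- The product of two graded modules. -/
def prodObj (M N : GrMod 𝒜) : GrMod 𝒜 where
  carrier := M.carrier × N.carrier
  grading := fun i => (M.grading i).prod (N.grading i)
  isInternal := isInternal_of_detect _
    (fun i => (M.component i).prodMap (N.component i))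
    (fun _ _ _ h hne => Prod.ext (M.component_of_mem_ne h.1 hne) (N.component_of_mem_ne h.2 hne))
    (fun i t h h0 => by
      rw [← h0]
      exact Prod.ext (M.component_of_mem h.1).symm (N.component_of_mem h.2).symm)
    (by
      rw [eq_top_iff]
      rintro ⟨m, n⟩ -
      have h : ((m, n) : M.carrier × N.carrier) = (m, 0) + (0, n) := by simp
      rw [h]
      refine add_mem ?_ ?_
      · refine M.homogeneous_induction (p := fun m => (m, 0) ∈ AddSubmonoid.closure
          {t | ∃ i, t ∈ (M.grading i).prod (N.grading i)})
          (zero_mem _) (fun i m hm => AddSubmonoid.subset_closure ⟨i, ⟨hm, zero_mem _⟩⟩) ?_ m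
        intro m m' h h'
        have := add_mem h h'
        simpa using this
      · refine N.homogeneous_induction (p := fun n => (0, n) ∈ AddSubmonoid.closure
          {t | ∃ i, t ∈ (M.grading i).prod (N.grading i)})
          (zero_mem _) (fun i m hm => AddSubmonoid.subset_closure ⟨i, ⟨zero_mem _, hm⟩⟩) ?_ n
        intro m m' h h'
        have := add_mem h h'
        simpa using this)
  smul_mem := fun hr h => ⟨M.smul_mem hr h.1, N.smul_mem hr h.2⟩

/-- The product of two graded modules as a biproduct. -/
def prodBicone (M N : GrMod 𝒜) : Limits.BinaryBicone M N where
  pt := prodObj M N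
  fst := Hom.mk (M := prodObj M N) (LinearMap.fst R M.carrier N.carrier) fun _ _ h => h.1
  snd := Hom.mk (M := prodObj M N) (LinearMap.snd R M.carrier N.carrier) fun _ _ h => h.2
  inl := Hom.mk (N := prodObj M N) (LinearMap.inl R M.carrier N.carrier)
    fun _ _ h => ⟨h, zero_mem _⟩
  inr := Hom.mk (N := prodObj M N) (LinearMap.inr R M.carrier N.carrier)
    fun _ _ h => ⟨zero_mem _, h⟩
  inl_fst := rfl
  inl_snd := rfl
  inr_fst := rfl
  inr_snd := rfl

instance : Limits.HasBinaryBiproducts (GrMod 𝒜) where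
  has_binary_biproduct M N := Limits.hasBinaryBiproduct_of_total (prodBicone M N)
    (Hom.ext (LinearMap.ext fun x => Prod.ext (add_zero x.1) (zero_add x.2)))

/-- The direct sum of a sequence of graded modules. -/
def directSum (M : ℕ → GrMod 𝒜) : GrMod 𝒜 where
  carrier := Π₀ n, (M n).carrier
  grading := fun i =>
    { carrier := {x | ∀ n, x n ∈ (M n).grading i}
      zero_mem' := fun n => zero_mem ((M n).grading i)
      add_mem' := fun h h' n => add_mem (h n) (h' n)
      neg_mem' := fun h n => neg_mem (h n) }
  isInternal := isInternal_of_detect _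
    (fun i => DFinsupp.mapRange.addMonoidHom fun n => (M n).component i)
    (fun _ _ _ h hne => DFinsupp.ext fun n => (M n).component_of_mem_ne (h n) hne)
    (fun i t h h0 => by
      rw [← h0]
      exact DFinsupp.ext fun n => ((M n).component_of_mem (h n)).symm)
    (by
      suffices h : ∀ H : AddSubmonoid (Π₀ n, (M n).carrier),
          (∀ i x, (∀ n, x n ∈ (M n).grading i) → x ∈ H) → H = ⊤ from
        h _ fun i x hx => AddSubmonoid.subset_closure ⟨i, hx⟩
      intro H hH
      rw [eq_top_iff]
      intro x _
      induction x using DFinsupp.induction with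
      | h0 => exact zero_mem _
      | ha n m f _ _ hf =>
        refine add_mem ?_ (hf trivial)
        refine (M n).homogeneous_induction (p := fun m => DFinsupp.single n m ∈ H)
          (by rw [DFinsupp.single_zero]; exact zero_mem _) ?_
          (fun m m' h h' => by rw [DFinsupp.single_add]; exact add_mem h h') m
        intro i m hm
        refine hH i _ fun n' => ?_
        by_cases h : n' = n
        · subst h
          rwa [DFinsupp.single_eq_same]
        · rw [DFinsupp.single_eq_of_ne h]
          exact zero_mem _)
  smul_mem := fun hr h n => (M n).smul_mem hr (h n)

/-- The kernel of a morphism of graded modules. -/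
def ker {M N : GrMod 𝒜} (φ : M ⟶ N) : GrMod 𝒜 where
  carrier := LinearMap.ker (Hom.lin φ)
  grading := fun i => (M.grading i).comap (LinearMap.ker (Hom.lin φ)).subtype.toAddMonoidHom
  isInternal := isInternal_of_detect _
    (fun i => (M.component i).comp (LinearMap.ker (Hom.lin φ)).subtype.toAddMonoidHom)
    (fun _ _ _ h hne => M.component_of_mem_ne h hne)
    (fun i t h h0 => Subtype.ext ((M.component_of_mem h).symm.trans h0))
    (by
      rw [eq_top_iff]
      rintro ⟨x, hx⟩ -
      have hx' : ∀ i, M.component i x ∈ LinearMap.ker (Hom.lin φ) := fun i => by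
        rw [LinearMap.mem_ker, ← component_lin, LinearMap.mem_ker.1 hx, map_zero]
      obtain ⟨s, hs⟩ := M.exists_sum_component x
      have h : (⟨x, hx⟩ : LinearMap.ker (Hom.lin φ)) = ∑ i ∈ s, ⟨M.component i x, hx' i⟩ :=
        Subtype.ext (by
          rw [Submodule.coe_sum]
          exact hs.symm)
      rw [h]
      exact sum_mem fun i _ => AddSubmonoid.subset_closure ⟨i, M.component_mem i x⟩)
  smul_mem := fun hr h => M.smul_mem hr h

end Basic

section Free

variable (𝒜 : ℤ → Submodule k R) [GradedAlgebra 𝒜]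

/-- The free graded module on generators of given degrees. -/
noncomputable def free (Γ : Type u) (deg : Γ → ℤ) : GrMod 𝒜 where
  carrier := Γ →₀ R
  grading := fun i =>
    { carrier := {c | ∀ γ, c γ ∈ 𝒜 (i - deg γ)}
      zero_mem' := fun γ => zero_mem (𝒜 (i - deg γ))
      add_mem' := fun h h' γ => add_mem (h γ) (h' γ)
      neg_mem' := fun h γ => neg_mem (h γ) }
  isInternal := isInternal_of_detect (P := Γ → R) _
    (fun i => AddMonoidHom.pi fun γ =>
      (GradedRing.proj 𝒜 (i - deg γ)).comp (Finsupp.applyAddHom γ))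
    (fun i j t h hne => funext fun γ => DirectSum.decompose_of_mem_ne 𝒜 (h γ)
      fun h' => hne (sub_left_injective h'))
    (fun i t h h0 => Finsupp.ext fun γ =>
      (DirectSum.decompose_of_mem_same 𝒜 (h γ)).symm.trans (congrFun h0 γ))
    (by
      classical
      rw [eq_top_iff]
      intro x _
      induction x using Finsupp.induction_linear with
      | zero => exact zero_mem _
      | add x y hx hy => exact add_mem (hx trivial) (hy trivial)
      | single γ r =>
        induction r using DirectSum.Decomposition.inductionOn 𝒜 with
        | zero => rw [Finsupp.single_zero]; exact zero_mem _
        | add _ _ h h' => rw [Finsupp.single_add]; exact add_mem (h trivial) (h' trivial)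
        | @homogeneous i r =>
          refine AddSubmonoid.subset_closure ⟨i + deg γ, fun γ' => ?_⟩
          rw [Finsupp.single_apply]
          split_ifs with h
          · subst h
            rw [add_sub_cancel_right]
            exact r.2
          · exact zero_mem _)
  smul_mem := fun {i j r m} hr h γ => by
    have := SetLike.mul_mem_graded hr (h γ)
    rwa [← add_sub_assoc] at this

end Free

end GrMod
end Constructions

/-! ### The homotopy category of graded modules -/

section Homotopy

variable {k : Type w} {R : Type u} [CommRing k] [CommRing R] [Algebra k R]

namespace GrMod

variable (𝒜 : ℤ → Submodule k R)

/-- The homotopy category of graded modules. -/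
abbrev HoCat := HomotopyCategory (GrMod 𝒜) (ComplexShape.up ℤ)

/-- The complexes with vanishing cohomology. -/
def acyclic : ObjectProperty (HoCat 𝒜) :=
  (HomotopyCategory.subcategoryAcyclic (ModuleCat.{u} R)).inverseImage
    ((forget 𝒜).mapHomotopyCategory (ComplexShape.up ℤ))

instance : (acyclic 𝒜).IsTriangulated := by
  unfold acyclic; infer_instance

instance : (acyclic 𝒜).IsClosedUnderIsomorphisms := by
  unfold acyclic; infer_instance

variable {𝒜}

/-- Quasi-isomorphisms are the maps with acyclic cone. This holds for complexes of modules and is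
pulled back along the triangulated forgetful functor. -/
theorem quasiIso_iff {X Y : CochainComplex (GrMod 𝒜) ℤ} (f : X ⟶ Y) :
    quasiIso 𝒜 f ↔ (acyclic 𝒜).trW ((HomotopyCategory.quotient _ _).map f) := by
  rw [acyclic, ObjectProperty.inverseImage_trW_iff,
    ← HomotopyCategory.quasiIso_eq_trW_subcategoryAcyclic, Functor.mapHomotopyCategory_map]
  exact (HomotopyCategory.quotient_map_mem_quasiIso_iff
    (((forget 𝒜).mapHomologicalComplex (ComplexShape.up ℤ)).map f)).symm

/-- Exactness of a complex of graded modules, in terms of elements. -/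
def IsExact (X : CochainComplex (GrMod 𝒜) ℤ) : Prop :=
  ∀ i : ℤ, Function.Exact (Hom.lin (X.d (i - 1) i)) (Hom.lin (X.d i (i + 1)))

theorem acyclic_iff (X : CochainComplex (GrMod 𝒜) ℤ) :
    acyclic 𝒜 ((HomotopyCategory.quotient _ _).obj X) ↔ IsExact X := by
  have h : acyclic 𝒜 ((HomotopyCategory.quotient _ _).obj X) ↔
      HomotopyCategory.subcategoryAcyclic (ModuleCat.{u} R)
        ((HomotopyCategory.quotient _ _).obj
          (((forget 𝒜).mapHomologicalComplex (ComplexShape.up ℤ)).obj X)) := Iff.rfl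
  rw [h, HomotopyCategory.quotient_obj_mem_subcategoryAcyclic_iff_exactAt]
  refine forall_congr' fun i => ?_
  rw [HomologicalComplex.exactAt_iff' _ (i - 1) i (i + 1) (by simp) (by simp),
    ShortComplex.ShortExact.moduleCat_exact_iff_function_exact]
  rfl

/-- Homotopy equivalences are quasi-isomorphisms, and a functor that inverts homotopy equivalences
cannot distinguish homotopic maps. -/
theorem map_eq_of_homotopic {D : Type*} [Category* D] (F : CochainComplex (GrMod 𝒜) ℤ ⥤ D)
    (hF : (quasiIso 𝒜).IsInvertedBy F) {X Y : CochainComplex (GrMod 𝒜) ℤ} (f g : X ⟶ Y)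
    (h : (HomotopyCategory.quotient _ _).map f = (HomotopyCategory.quotient _ _).map g) :
    F.map f = F.map g := by
  refine (HomotopyCategory.homotopyOfEq _ _ h).map_eq_of_inverts_homotopyEquivalences
    (fun j => ⟨j - 1, by simp⟩) F fun X Y f hf => hF f ?_
  rw [quasiIso_iff]
  have := HomotopyCategory.quotient_inverts_homotopyEquivalences (GrMod 𝒜) (ComplexShape.up ℤ) f hf
  exact ObjectProperty.trW_of_isIso _ _

variable (𝒜) in
/-- The complexes `P` such that all maps from `P` to acyclic complexes are homotopic to zero. -/
def kProjective : ObjectProperty (CochainComplex (GrMod 𝒜) ℤ) := fun P =>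
  (acyclic 𝒜).leftOrthogonal ((HomotopyCategory.quotient _ _).obj P)

theorem kProjective_iff (P : CochainComplex (GrMod 𝒜) ℤ) :
    kProjective 𝒜 P ↔ ∀ (A : CochainComplex (GrMod 𝒜) ℤ) (f : P ⟶ A), IsExact A →
      Nonempty (Homotopy f 0) := by
  constructor
  · intro h A f hA
    rw [← acyclic_iff] at hA
    exact ⟨HomotopyCategory.homotopyOfEq _ _ ((h ((HomotopyCategory.quotient _ _).map f) hA).trans
      (Functor.map_zero _ _ _).symm)⟩
  · intro h A f hA
    obtain ⟨A, rfl⟩ := HomotopyCategory.quotient_obj_surjective A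
    obtain ⟨f, rfl⟩ := (HomotopyCategory.quotient _ _).map_surjective f
    rw [acyclic_iff] at hA
    obtain ⟨H⟩ := h A f hA
    rw [HomotopyCategory.eq_of_homotopy f 0 H, Functor.map_zero]

/-- Being left orthogonal to the acyclic complexes is the same as being colocal for the maps with
acyclic cone, which is the required bijectivity on homotopy classes. -/
theorem isResolving (hres : ∀ X : CochainComplex (GrMod 𝒜) ℤ,
    ∃ (P : CochainComplex (GrMod 𝒜) ℤ) (p : P ⟶ X), kProjective 𝒜 P ∧ quasiIso 𝒜 p) :
    IsResolving (quasiIso 𝒜) (HomotopyCategory.quotient (GrMod 𝒜) (ComplexShape.up ℤ))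
      (kProjective 𝒜) where
  full := inferInstance
  exists_resolution := hres
  bijective s hY hs := by
    rw [quasiIso_iff] at hs
    unfold kProjective at hY
    rw [← ObjectProperty.isColocal_trW] at hY
    exact hY _ hs

theorem quasiIso_of_homotopic {X Y : CochainComplex (GrMod 𝒜) ℤ} (f g : X ⟶ Y)
    (h : (HomotopyCategory.quotient _ _).map f = (HomotopyCategory.quotient _ _).map g)
    (hf : quasiIso 𝒜 f) : quasiIso 𝒜 g := by
  rwa [quasiIso_iff, ← h, ← quasiIso_iff]

instance : (quasiIso 𝒜).HasTwoOutOfThreeProperty := by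
  unfold quasiIso; infer_instance

section

variable {S : Type u} [CommRing S] [Algebra k S] {ℬ : ℤ → Submodule k S}
  (F : GrMod 𝒜 ⥤ GrMod ℬ) [F.Additive]

theorem toDerived_map_eq {X Y : CochainComplex (GrMod 𝒜) ℤ} (f g : X ⟶ Y)
    (h : (HomotopyCategory.quotient _ _).map f = (HomotopyCategory.quotient _ _).map g) :
    (toDerived F).map f = (toDerived F).map g :=
  map_eq_of_homotopic (quasiIso ℬ).Q (Localization.inverts _ _) _ _
    (HomotopyCategory.eq_of_homotopy _ _
      (F.mapHomotopy (HomotopyCategory.homotopyOfEq _ _ h)))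

/-- An additive functor that preserves exact complexes preserves quasi-isomorphisms. -/
theorem quasiIso_map (hF : ∀ X : CochainComplex (GrMod 𝒜) ℤ, IsExact X →
      IsExact ((F.mapHomologicalComplex (ComplexShape.up ℤ)).obj X))
    {X Y : CochainComplex (GrMod 𝒜) ℤ} (f : X ⟶ Y) (hf : quasiIso 𝒜 f) :
    quasiIso ℬ ((F.mapHomologicalComplex (ComplexShape.up ℤ)).map f) := by
  rw [quasiIso_iff] at hf ⊢
  -- `F` carries cones to cones, so preserving acyclic complexes is enough to preserve maps with
  -- acyclic cone.
  have h : acyclic 𝒜 ≤ (acyclic ℬ).inverseImage (F.mapHomotopyCategory (ComplexShape.up ℤ)) := by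
    intro A hA
    obtain ⟨A, rfl⟩ := HomotopyCategory.quotient_obj_surjective A
    rw [acyclic_iff] at hA
    exact (acyclic_iff _).2 (hF A hA)
  have := ObjectProperty.trW_monotone h _ hf
  rw [ObjectProperty.inverseImage_trW_iff] at this
  exact this

end

end GrMod
end Homotopy

/-! ### Semi-free complexes -/

section SemiFree

variable {k : Type w} {R : Type u} [CommRing k] [CommRing R] [Algebra k R]

namespace GrMod

variable {𝒜 : ℤ → Submodule k R}

theorem IsExact.exists_eq {A : CochainComplex (GrMod 𝒜) ℤ} (hA : IsExact A) {j i l : ℤ}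
    (hj : j + 1 = i) (hl : i + 1 = l) {e : ℤ} {x : (A.X i).carrier}
    (hx : x ∈ (A.X i).grading e) (h : Hom.lin (A.d i l) x = 0) :
    ∃ y ∈ (A.X j).grading e, Hom.lin (A.d j i) y = x := by
  obtain rfl : j = i - 1 := by omega
  subst hl
  obtain ⟨y, rfl⟩ := (hA i x).1 h
  -- Exactness gives a preimage that need not be homogeneous; its component of degree `e` still maps
  -- to `x`.
  refine ⟨(A.X (i - 1)).component e y, component_mem _ _ _, ?_⟩
  rw [← component_lin, component_of_mem _ hx]

theorem d_d_apply (X : CochainComplex (GrMod 𝒜) ℤ) (i j l : ℤ) (x : (X.X i).carrier) :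
    Hom.lin (X.d j l) (Hom.lin (X.d i j) x) = 0 := by
  rw [← Hom.lin_comp_apply, X.d_comp_d, Hom.lin_zero, LinearMap.zero_apply]

theorem hom_d_apply {X Y : CochainComplex (GrMod 𝒜) ℤ} (f : X ⟶ Y) (i j : ℤ)
    (x : (X.X i).carrier) :
    Hom.lin (Y.d i j) (Hom.lin (f.f i) x) = Hom.lin (f.f j) (Hom.lin (X.d i j) x) := by
  rw [← Hom.lin_comp_apply, f.comm, Hom.lin_comp_apply]

/-- A complex of free graded modules, with generators of a finite rank, such that the
differential of each generator involves only generators of lower rank. -/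
structure SemiFree (P : CochainComplex (GrMod 𝒜) ℤ) where
  /-- the generators -/
  Γ : ℤ → Type u
  /-- the generators, as elements of the complex -/
  basis : ∀ i, Module.Basis (Γ i) R (P.X i).carrier
  /-- the degree of a generator -/
  deg : ∀ i, Γ i → ℤ
  /-- the rank of a generator -/
  rank : ∀ i, Γ i → ℕ
  basis_mem : ∀ i γ, basis i γ ∈ (P.X i).grading (deg i γ)
  repr_mem : ∀ i e, ∀ m ∈ (P.X i).grading e, ∀ γ, (basis i).repr m γ ∈ 𝒜 (e - deg i γ)
  d_mem : ∀ i γ, Hom.lin (P.d i (i + 1)) (basis i γ) ∈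
    Submodule.span R (basis (i + 1) '' {γ' | rank (i + 1) γ' < rank i γ})

namespace SemiFree

variable {P : CochainComplex (GrMod 𝒜) ℤ} (B : SemiFree P)

/-- The morphism with prescribed values on the generators. -/
noncomputable def desc {i : ℤ} {N : GrMod 𝒜} (v : B.Γ i → N.carrier)
    (hv : ∀ γ, v γ ∈ N.grading (B.deg i γ)) : P.X i ⟶ N :=
  Hom.mk ((B.basis i).constr R v) fun e m hm => by
    rw [Module.Basis.constr_apply]
    refine sum_mem fun γ _ => ?_
    have := N.smul_mem (B.repr_mem i e m hm γ) (hv γ)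
    rwa [sub_add_cancel] at this

@[simp]
theorem desc_basis {i : ℤ} {N : GrMod 𝒜} (v : B.Γ i → N.carrier)
    (hv : ∀ γ, v γ ∈ N.grading (B.deg i γ)) (γ : B.Γ i) :
    Hom.lin (B.desc v hv) (B.basis i γ) = v γ :=
  (B.basis i).constr_basis R v γ

variable {A : CochainComplex (GrMod 𝒜) ℤ} (f : P ⟶ A)

open Classical in
/-- A value for the homotopy on a generator, given the homotopy on generators of lower rank. -/
noncomputable def step (h : ∀ i j : ℤ, P.X i ⟶ A.X j) (i j : ℤ) (γ : B.Γ i) : (A.X j).carrier :=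
  -- The value solves d y = f(γ) − h(dγ). The default 0 keeps the definition total; for exact `A`
  -- and `j + 1 = i` a solution exists at the stages used below.
  if hy : ∃ y ∈ (A.X j).grading (B.deg i γ), Hom.lin (A.d j i) y =
      Hom.lin (f.f i) (B.basis i γ) - Hom.lin (h (i + 1) i) (Hom.lin (P.d i (i + 1)) (B.basis i γ))
  then hy.choose else 0

theorem step_mem (h : ∀ i j : ℤ, P.X i ⟶ A.X j) (i j : ℤ) (γ : B.Γ i) :
    B.step f h i j γ ∈ (A.X j).grading (B.deg i γ) := by
  unfold step
  split_ifs with hy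
  · exact hy.choose_spec.1
  · exact zero_mem _

/-- The homotopy on generators of rank less than `n`. -/
noncomputable def partialHomotopy : ℕ → ∀ i j : ℤ, P.X i ⟶ A.X j
  | 0 => fun _ _ => 0
  | n + 1 => fun i j => B.desc
      -- Only generators of rank exactly `n` receive a new value; those of higher rank still have
      -- the value 0.
      (fun γ => if B.rank i γ = n then B.step f (partialHomotopy n) i j γ
        else Hom.lin (partialHomotopy n i j) (B.basis i γ))
      (fun γ => by
        split_ifs
        · exact B.step_mem f _ i j γ
        · exact Hom.mem _ (B.basis_mem i γ))

theorem partialHomotopy_rank (i j : ℤ) (γ : B.Γ i) :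
    Hom.lin (B.partialHomotopy f (B.rank i γ + 1) i j) (B.basis i γ) =
      B.step f (B.partialHomotopy f (B.rank i γ)) i j γ := by
  rw [partialHomotopy, desc_basis, if_pos rfl]

theorem partialHomotopy_of_lt (i j : ℤ) (γ : B.Γ i) (n : ℕ) (hn : B.rank i γ < n) :
    Hom.lin (B.partialHomotopy f n i j) (B.basis i γ) =
      Hom.lin (B.partialHomotopy f (B.rank i γ + 1) i j) (B.basis i γ) := by
  induction n with
  | zero => omega
  | succ n ih =>
    by_cases h : B.rank i γ = n
    · rw [h]
    · rw [← ih (by omega)]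
      conv_lhs => rw [partialHomotopy, desc_basis, if_neg h]

/-- The homotopy. -/
noncomputable def totalHomotopy (i j : ℤ) : P.X i ⟶ A.X j :=
  B.desc (fun γ => Hom.lin (B.partialHomotopy f (B.rank i γ + 1) i j) (B.basis i γ))
    fun γ => Hom.mem _ (B.basis_mem i γ)

/-- Values on generators stabilize once their rank is passed. Hence the partial homotopy seen when a
generator is treated is already the final one on its differential. -/
theorem totalHomotopy_eq (n : ℕ) (i j : ℤ) (m : (P.X i).carrier)
    (hm : m ∈ Submodule.span R (B.basis i '' {γ | B.rank i γ < n})) :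
    Hom.lin (B.totalHomotopy f i j) m = Hom.lin (B.partialHomotopy f n i j) m := by
  refine LinearMap.eqOn_span' (f := Hom.lin (B.totalHomotopy f i j)) ?_ hm
  rintro _ ⟨γ, hγ, rfl⟩
  rw [totalHomotopy, desc_basis, B.partialHomotopy_of_lt f i j γ n hγ]

/-- Induction on rank. The differential of γ involves only lower rank, where the homotopy identity
is known; so f(γ) − h(dγ) is a cycle, and exactness makes it a boundary, as the choice in `step`
requires. -/
theorem d_totalHomotopy (hA : IsExact A) (n : ℕ) : ∀ (i j : ℤ) (_ : j + 1 = i) (γ : B.Γ i),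
    B.rank i γ = n → Hom.lin (A.d j i) (Hom.lin (B.totalHomotopy f i j) (B.basis i γ)) =
      Hom.lin (f.f i) (B.basis i γ) -
        Hom.lin (B.totalHomotopy f (i + 1) i) (Hom.lin (P.d i (i + 1)) (B.basis i γ)) := by
  induction n using Nat.strong_induction_on with
  | _ n ih =>
  intro i j hj γ hγ
  have hd := B.d_mem i γ
  have hspan : ∀ m ∈ Submodule.span R (B.basis (i + 1) '' {γ' | B.rank (i + 1) γ' < B.rank i γ}),
      Hom.lin (A.d i (i + 1)) (Hom.lin (B.totalHomotopy f (i + 1) i) m) =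
      Hom.lin (f.f (i + 1)) m - Hom.lin (B.totalHomotopy f (i + 1 + 1) (i + 1))
        (Hom.lin (P.d (i + 1) (i + 1 + 1)) m) := by
    intro m hm
    refine LinearMap.eqOn_span'
      (f := (Hom.lin (A.d i (i + 1))).comp (Hom.lin (B.totalHomotopy f (i + 1) i)))
      (g := Hom.lin (f.f (i + 1)) - (Hom.lin (B.totalHomotopy f (i + 1 + 1) (i + 1))).comp
        (Hom.lin (P.d (i + 1) (i + 1 + 1)))) ?_ hm
    rintro _ ⟨γ', hγ', rfl⟩
    exact ih _ (hγ ▸ hγ') (i + 1) i rfl γ' rfl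
  have hex : ∃ y ∈ (A.X j).grading (B.deg i γ), Hom.lin (A.d j i) y =
      Hom.lin (f.f i) (B.basis i γ) - Hom.lin (B.partialHomotopy f (B.rank i γ) (i + 1) i)
        (Hom.lin (P.d i (i + 1)) (B.basis i γ)) := by
    refine hA.exists_eq hj rfl ?_ ?_
    · exact sub_mem (Hom.mem _ (B.basis_mem i γ)) (Hom.mem _ (Hom.mem _ (B.basis_mem i γ)))
    · rw [← B.totalHomotopy_eq f _ _ _ _ hd, map_sub, hspan _ hd, d_d_apply, map_zero, sub_zero,
        hom_d_apply, sub_self]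
  rw [B.totalHomotopy_eq f (B.rank i γ) (i + 1) i _ hd, totalHomotopy, desc_basis,
    partialHomotopy_rank, step, dif_pos hex]
  exact hex.choose_spec.2

include B in
theorem kProjective : kProjective 𝒜 P := by
  rw [kProjective_iff]
  intro A f hA
  refine ⟨{ hom := fun i j => if j + 1 = i then B.totalHomotopy f i j else 0
            zero := fun i j h => if_neg h
            comm := fun i => ?_ }⟩
  rw [dNext_eq _ (show (ComplexShape.up ℤ).Rel i (i + 1) from rfl),
    prevD_eq _ (show (ComplexShape.up ℤ).Rel (i - 1) i from sub_add_cancel i 1),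
    if_pos rfl, if_pos (sub_add_cancel i 1)]
  refine Hom.ext ((B.basis i).ext fun γ => ?_)
  have h := B.d_totalHomotopy f hA _ i (i - 1) (sub_add_cancel i 1) γ rfl
  simp only [Hom.lin_add, LinearMap.add_apply, Hom.lin_comp_apply, HomologicalComplex.zero_f, add_zero]
  rw [h]
  abel

end SemiFree

end GrMod
end SemiFree

/-! ### Semi-free resolutions -/

section Resolution

variable {k : Type w} {R : Type u} [CommRing k] [CommRing R] [Algebra k R]

namespace GrMod

variable {𝒜 : ℤ → Submodule k R}

open CochainComplex CochainComplex.HomComplex in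
/-- A criterion for quasi-isomorphisms in terms of elements. -/
theorem quasiIso_of_elements {P X : CochainComplex (GrMod 𝒜) ℤ} (φ : P ⟶ X)
    (hsurj : ∀ (i : ℤ) (z : (X.X i).carrier), Hom.lin (X.d i (i + 1)) z = 0 →
      ∃ p, Hom.lin (P.d i (i + 1)) p = 0 ∧ Hom.lin (φ.f i) p = z)
    (hinj : ∀ (i : ℤ) (p : (P.X (i + 1)).carrier),
      Hom.lin (P.d (i + 1) (i + 1 + 1)) p = 0 →
      (∃ y, Hom.lin (X.d i (i + 1)) y = Hom.lin (φ.f (i + 1)) p) →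
      ∃ q, Hom.lin (P.d i (i + 1)) q = p) :
    quasiIso 𝒜 φ := by
  rw [quasiIso_iff]
  -- It suffices that the mapping cone is exact. The maps `inl`, `inr`, `fst`, `snd` below are the
  -- coordinates that write its elements as pairs.
  refine ObjectProperty.trW.mk _ (HomotopyCategory.mappingCone_triangleh_distinguished φ) ?_
  refine (acyclic_iff (mappingCone φ)).2 fun i => ?_
  obtain ⟨j, rfl⟩ : ∃ j, i = j + 1 := ⟨i - 1, by omega⟩
  have hj : j + 1 - 1 = j := by omega
  rw [hj]
  let inl : ∀ i : ℤ, P.X (i + 1) ⟶ (mappingCone φ).X i := fun i =>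
    (mappingCone.inl φ).v (i + 1) i (by omega)
  let inr : ∀ i : ℤ, X.X i ⟶ (mappingCone φ).X i := fun i => (mappingCone.inr φ).f i
  let fst : ∀ i : ℤ, (mappingCone φ).X i ⟶ P.X (i + 1) := fun i =>
    (mappingCone.fst φ).1.v i (i + 1) rfl
  let snd : ∀ i : ℤ, (mappingCone φ).X i ⟶ X.X i := fun i =>
    (mappingCone.snd φ).v i i (add_zero i)
  have hid : ∀ (i : ℤ) x, Hom.lin (inl i) (Hom.lin (fst i) x) +
      Hom.lin (inr i) (Hom.lin (snd i) x) = x := fun i x =>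
    LinearMap.congr_fun (congrArg Hom.lin (mappingCone.id_X φ i (i + 1) rfl)) x
  have hinl : ∀ (i : ℤ) x, Hom.lin ((mappingCone φ).d i (i + 1)) (Hom.lin (inl i) x) =
      Hom.lin (inr (i + 1)) (Hom.lin (φ.f (i + 1)) x) -
        Hom.lin (inl (i + 1)) (Hom.lin (P.d (i + 1) (i + 1 + 1)) x) := fun i x =>
    LinearMap.congr_fun (congrArg Hom.lin
      (mappingCone.inl_v_d φ (i + 1) i (i + 1 + 1) (by omega) (by omega))) x
  have hinr : ∀ (i : ℤ) x, Hom.lin ((mappingCone φ).d i (i + 1)) (Hom.lin (inr i) x) =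
      Hom.lin (inr (i + 1)) (Hom.lin (X.d i (i + 1)) x) := fun i x =>
    LinearMap.congr_fun (congrArg Hom.lin (mappingCone.inr_f_d φ i (i + 1))) x
  have hfl : ∀ (i : ℤ) x, Hom.lin (fst i) (Hom.lin (inl i) x) = x := fun i x =>
    LinearMap.congr_fun (congrArg Hom.lin (mappingCone.inl_v_fst_v φ (i + 1) i rfl)) x
  have hsl : ∀ (i : ℤ) x, Hom.lin (snd i) (Hom.lin (inl i) x) = 0 := fun i x =>
    LinearMap.congr_fun (congrArg Hom.lin (mappingCone.inl_v_snd_v φ (i + 1) i (by omega))) x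
  have hfr : ∀ (i : ℤ) x, Hom.lin (fst i) (Hom.lin (inr i) x) = 0 := fun i x =>
    LinearMap.congr_fun (congrArg Hom.lin (mappingCone.inr_f_fst_v φ i (i + 1) rfl)) x
  have hsr : ∀ (i : ℤ) x, Hom.lin (snd i) (Hom.lin (inr i) x) = x := fun i x =>
    LinearMap.congr_fun (congrArg Hom.lin (mappingCone.inr_f_snd_v φ i)) x
  intro c
  constructor
  · intro hc
    obtain ⟨a, ha⟩ : ∃ a, a = Hom.lin (fst (j + 1)) c := ⟨_, rfl⟩
    obtain ⟨b, hb⟩ : ∃ b, b = Hom.lin (snd (j + 1)) c := ⟨_, rfl⟩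
    have hcab : c = Hom.lin (inl (j + 1)) a + Hom.lin (inr (j + 1)) b := by
      rw [ha, hb, hid]
    rw [hcab, map_add, hinl, hinr] at hc
    have h1 := congrArg (Hom.lin (fst (j + 1 + 1))) hc
    have h2 := congrArg (Hom.lin (snd (j + 1 + 1))) hc
    simp only [map_add, map_sub, hfl, hsl, hfr, hsr, map_zero, zero_sub, add_zero, sub_zero,
      neg_eq_zero] at h1 h2
    -- For a cycle (a, b) of the cone, a is a cycle and φ(a) = −d b, so a = d q. Then φ(q) + b is a
    -- cycle, lifted to a cycle p, and (p − q, 0) has boundary (a, b).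
    obtain ⟨q, hq⟩ := hinj (j + 1) a h1 ⟨-b, by rw [map_neg]; exact (eq_neg_of_add_eq_zero_left h2).symm⟩
    obtain ⟨p, hp, hp'⟩ := hsurj (j + 1) (Hom.lin (φ.f (j + 1)) q + b) (by
      rw [map_add, hom_d_apply, hq, h2])
    refine ⟨Hom.lin (inl j) (p - q), ?_⟩
    rw [hinl, map_sub (Hom.lin (φ.f (j + 1))), map_sub (Hom.lin (P.d (j + 1) (j + 1 + 1))), hp, hp',
      hq, hcab, zero_sub, map_neg, add_sub_cancel_left, sub_neg_eq_add]
    exact add_comm _ _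
  · rintro ⟨x, rfl⟩
    exact d_d_apply _ _ _ _ _

/-! ### Free covers, surjective on elements and on cycles -/

section Cover

variable [GradedAlgebra 𝒜]

/-- The morphism from a free graded module with prescribed values on the generators. -/
noncomputable def freeDesc {Γ : Type u} {deg : Γ → ℤ} {N : GrMod 𝒜} (v : Γ → N.carrier)
    (hv : ∀ γ, v γ ∈ N.grading (deg γ)) : free 𝒜 Γ deg ⟶ N :=
  Hom.mk (M := free 𝒜 Γ deg) (Finsupp.linearCombination R v) fun e m hm => by
    change Finsupp.sum m (fun γ r => r • v γ) ∈ N.grading e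
    refine sum_mem fun γ _ => ?_
    have := N.smul_mem (hm γ) (hv γ)
    rwa [sub_add_cancel] at this

/-- A generator of a free graded module. -/
noncomputable def gen {Γ : Type u} {deg : Γ → ℤ} (γ : Γ) : (free 𝒜 Γ deg).carrier :=
  Finsupp.single γ 1

theorem gen_mem {Γ : Type u} {deg : Γ → ℤ} (γ : Γ) :
    (gen γ : (free 𝒜 Γ deg).carrier) ∈ (free 𝒜 Γ deg).grading (deg γ) := by
  classical
  intro γ'
  change Finsupp.single γ (1 : R) γ' ∈ _
  rw [Finsupp.single_apply]
  split_ifs with h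
  · subst h
    rw [sub_self]
    exact SetLike.one_mem_graded 𝒜
  · exact zero_mem _

@[simp]
theorem freeDesc_gen {Γ : Type u} {deg : Γ → ℤ} {N : GrMod 𝒜} (v : Γ → N.carrier)
    (hv : ∀ γ, v γ ∈ N.grading (deg γ)) (γ : Γ) :
    Hom.lin (freeDesc (deg := deg) v hv) (gen γ) = v γ := by
  refine (Finsupp.linearCombination_single R (1 : R) γ).trans (one_smul _ _)

theorem free_hom_ext {Γ : Type u} {deg : Γ → ℤ} {N : GrMod 𝒜} {φ ψ : free 𝒜 Γ deg ⟶ N}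
    (h : ∀ γ, Hom.lin φ (gen γ) = Hom.lin ψ (gen γ)) : φ = ψ := by
  refine Hom.ext (Finsupp.lhom_ext' (φ := Hom.lin φ) (ψ := Hom.lin ψ) fun γ => ?_)
  exact LinearMap.ext_ring (h γ)

variable (X : CochainComplex (GrMod 𝒜) ℤ)

/-- The homogeneous elements of a complex in a given cohomological degree. -/
abbrev Chain (i : ℤ) : Type u := Σ e : ℤ, (X.X i).grading e

/-- The generators of the cover of a complex: the homogeneous elements and, once more,
the homogeneous cycles. -/
abbrev Cell (i : ℤ) : Type u :=
  Chain X i ⊕ {x : Chain X i // Hom.lin (X.d i (i + 1)) (x.2 : (X.X i).carrier) = 0}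

variable {X}

/-- The element of the complex to which a generator of the cover is mapped. -/
def Cell.val {i : ℤ} : Cell X i → (X.X i).carrier :=
  Sum.elim (fun x => x.2) (fun z => z.1.2)

/-- The degree of a generator of the cover. -/
def Cell.deg {i : ℤ} : Cell X i → ℤ := Sum.elim (fun x => x.1) (fun z => z.1.1)

omit [GradedAlgebra 𝒜] in
theorem Cell.val_mem {i : ℤ} (c : Cell X i) : c.val ∈ (X.X i).grading c.deg := by
  rcases c with x | z
  · exact x.2.2
  · exact z.1.2.2

/-- The cell that is attached to the boundary of a homogeneous element. -/
def Chain.boundary {i : ℤ} (x : Chain X i) : Cell X (i + 1) :=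
  Sum.inr ⟨⟨x.1, ⟨Hom.lin (X.d i (i + 1)) x.2, Hom.mem _ x.2.2⟩⟩, d_d_apply _ _ _ _ _⟩

/-- The differential of the cover, on generators. -/
noncomputable def Cell.dVal {i : ℤ} :
    Cell X i → (free 𝒜 (Cell X (i + 1)) Cell.deg).carrier :=
  Sum.elim (fun x => gen (Chain.boundary x)) (fun _ => 0)

theorem Cell.dVal_mem {i : ℤ} (c : Cell X i) :
    c.dVal ∈ (free 𝒜 (Cell X (i + 1)) Cell.deg).grading c.deg := by
  rcases c with x | z
  · exact gen_mem (𝒜 := 𝒜) (deg := Cell.deg) (Chain.boundary x)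
  · exact zero_mem _

variable (X)

/-- The differential of the cover. -/
noncomputable def coverD (i : ℤ) :
    free 𝒜 (Cell X i) Cell.deg ⟶ free 𝒜 (Cell X (i + 1)) Cell.deg :=
  freeDesc Cell.dVal Cell.dVal_mem

theorem coverD_gen {i : ℤ} (c : Cell X i) : Hom.lin (coverD X i) (gen c) = c.dVal :=
  freeDesc_gen _ _ _

/-- A chain cell goes to the cycle cell of its boundary, and cycle cells have zero differential. -/
theorem coverD_comp (i : ℤ) : coverD X i ≫ coverD X (i + 1) = 0 := by
  refine free_hom_ext fun c => ?_
  rw [Hom.lin_comp_apply, coverD_gen]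
  rcases c with x | z
  · exact coverD_gen X _
  · exact map_zero _

/-- A complex of free modules which maps onto `X`, such that the cycles map onto those of `X`. -/
noncomputable def cover : CochainComplex (GrMod 𝒜) ℤ :=
  CochainComplex.of (fun i => free 𝒜 (Cell X i) Cell.deg) (coverD X) (coverD_comp X)

variable {X} in
/-- A generator of the cover. -/
noncomputable def coverGen {i : ℤ} (c : Cell X i) : ((cover X).X i).carrier :=
  gen (deg := Cell.deg) c

theorem cover_d (i : ℤ) : (cover X).d i (i + 1) = coverD X i :=
  CochainComplex.of_d (fun i => free 𝒜 (Cell X i) Cell.deg) (coverD X) i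

theorem cover_d_gen {i : ℤ} (c : Cell X i) :
    Hom.lin ((cover X).d i (i + 1)) (coverGen c) = c.dVal := by
  rw [cover_d]
  exact coverD_gen X c

theorem cover_d_chain {i : ℤ} (x : Chain X i) :
    Hom.lin ((cover X).d i (i + 1)) (coverGen (Sum.inl x)) = coverGen x.boundary :=
  cover_d_gen X (Sum.inl x)

theorem cover_d_cycle {i : ℤ} (z : {x : Chain X i //
    Hom.lin (X.d i (i + 1)) (x.2 : (X.X i).carrier) = 0}) :
    Hom.lin ((cover X).d i (i + 1)) (coverGen (Sum.inr z)) = 0 :=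
  cover_d_gen X (Sum.inr z)

theorem cover_hom_ext {i : ℤ} {N : GrMod 𝒜} {φ ψ : (cover X).X i ⟶ N}
    (h : ∀ c : Cell X i, Hom.lin φ (coverGen c) = Hom.lin ψ (coverGen c)) : φ = ψ :=
  free_hom_ext h

/-- The map from the cover to `X`, in each degree. -/
noncomputable def coverMapApp (i : ℤ) : (cover X).X i ⟶ X.X i :=
  freeDesc Cell.val Cell.val_mem

theorem coverMapApp_gen {i : ℤ} (c : Cell X i) :
    Hom.lin (coverMapApp X i) (coverGen c) = c.val :=
  freeDesc_gen _ Cell.val_mem _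

/-- The map from the cover to `X`. -/
noncomputable def coverMap : cover X ⟶ X :=
  CochainComplex.ofHom (coverMapApp X) fun i => by
    refine cover_hom_ext X fun c => ?_
    rw [Hom.lin_comp_apply, Hom.lin_comp_apply, coverMapApp_gen]
    rcases c with x | z
    · rw [cover_d_chain, coverMapApp_gen]
      rfl
    · rw [cover_d_cycle, map_zero]
      exact z.2

theorem coverMap_gen {i : ℤ} (c : Cell X i) : Hom.lin ((coverMap X).f i) (coverGen c) = c.val :=
  coverMapApp_gen X c

theorem coverMap_surjective {i : ℤ} (x : (X.X i).carrier) :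
    ∃ y, Hom.lin ((coverMap X).f i) y = x := by
  refine (X.X i).homogeneous_induction (p := fun x => ∃ y, Hom.lin ((coverMap X).f i) y = x)
    ⟨0, map_zero _⟩ (fun e m hm => ⟨coverGen (Sum.inl ⟨e, m, hm⟩), coverMap_gen X _⟩) ?_ x
  rintro _ _ ⟨y, rfl⟩ ⟨y', rfl⟩
  exact ⟨y + y', map_add _ _ _⟩

/-- The homogeneous components of a cycle are cycles, and each of them is the value of a cycle cell.
This is why cycles are listed a second time among the generators. -/
theorem coverMap_surjective_cycles {i : ℤ} (z : (X.X i).carrier)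
    (hz : Hom.lin (X.d i (i + 1)) z = 0) :
    ∃ y, Hom.lin ((cover X).d i (i + 1)) y = 0 ∧ Hom.lin ((coverMap X).f i) y = z := by
  obtain ⟨s, hs⟩ := (X.X i).exists_sum_component z
  let c : ℤ → Cell X i := fun e => Sum.inr ⟨⟨e, (X.X i).component e z, component_mem _ _ _⟩, by
    change Hom.lin (X.d i (i + 1)) ((X.X i).component e z) = 0
    rw [← component_lin, hz, map_zero]⟩
  refine ⟨∑ e ∈ s, coverGen (c e), ?_, ?_⟩
  · rw [map_sum]
    refine Finset.sum_eq_zero fun e _ => ?_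
    exact cover_d_cycle X _
  · rw [map_sum, ← hs]
    exact Finset.sum_congr rfl fun e _ => coverMap_gen X _

end Cover

end GrMod
end Resolution

/-! ### Iterated syzygies and their total complex -/

section Resolution

variable {k : Type w} {R : Type u} [CommRing k] [CommRing R] [Algebra k R]

namespace GrMod

variable {𝒜 : ℤ → Submodule k R} [GradedAlgebra 𝒜] (X : CochainComplex (GrMod 𝒜) ℤ)

/-- The inclusion of the kernel of a morphism of graded modules. -/
def kerSubtype {M N : GrMod 𝒜} (φ : M ⟶ N) : ker φ ⟶ M :=
  Hom.mk (M := ker φ) (LinearMap.ker (Hom.lin φ)).subtype fun _ _ h => h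

omit [GradedAlgebra 𝒜] in
theorem kerSubtype_injective {M N : GrMod 𝒜} (φ : M ⟶ N) :
    Function.Injective (Hom.lin (kerSubtype φ)) := Subtype.val_injective

omit [GradedAlgebra 𝒜] in
theorem lin_kerSubtype {M N : GrMod 𝒜} (φ : M ⟶ N) (x : (ker φ).carrier) :
    Hom.lin φ (Hom.lin (kerSubtype φ) x) = 0 := x.2

omit [GradedAlgebra 𝒜] in
theorem exists_kerSubtype {M N : GrMod 𝒜} (φ : M ⟶ N) (x : M.carrier) (hx : Hom.lin φ x = 0) :
    ∃ y, Hom.lin (kerSubtype φ) y = x := ⟨⟨x, hx⟩, rfl⟩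

/-- The differential of the shifted kernel of the cover. -/
noncomputable def syzygyD (i : ℤ) :
    ker ((coverMap X).f (i + 1)) ⟶ ker ((coverMap X).f (i + 1 + 1)) :=
  Hom.mk (M := ker ((coverMap X).f (i + 1))) (N := ker ((coverMap X).f (i + 1 + 1)))
    -- The sign of a shifted complex: with it the inclusion into the cover anticommutes with the
    -- differentials, as the total differential needs.
    ((-Hom.lin ((cover X).d (i + 1) (i + 1 + 1))).restrict fun x hx => by
      rw [LinearMap.mem_ker] at hx ⊢
      rw [LinearMap.neg_apply, map_neg, ← hom_d_apply, hx, map_zero, neg_zero])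
    (fun e m hm => neg_mem (Hom.mem ((cover X).d (i + 1) (i + 1 + 1)) hm))

theorem kerSubtype_syzygyD (i : ℤ) (x : (ker ((coverMap X).f (i + 1))).carrier) :
    Hom.lin (kerSubtype _) (Hom.lin (syzygyD X i) x) =
      -Hom.lin ((cover X).d (i + 1) (i + 1 + 1)) (Hom.lin (kerSubtype _) x) := rfl

/-- The kernel of the cover of a complex, shifted by one. -/
noncomputable def syzygy : CochainComplex (GrMod 𝒜) ℤ :=
  CochainComplex.of (fun i => ker ((coverMap X).f (i + 1))) (syzygyD X) fun i => by
    refine Hom.ext (LinearMap.ext fun x => kerSubtype_injective _ ?_)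
    rw [Hom.lin_comp_apply, kerSubtype_syzygyD, kerSubtype_syzygyD, map_neg, d_d_apply]
    simp

/-- The inclusion of the shifted kernel in the cover. -/
noncomputable def syzygyIncl (i : ℤ) : (syzygy X).X i ⟶ (cover X).X (i + 1) :=
  kerSubtype ((coverMap X).f (i + 1))

theorem syzygyIncl_injective (i : ℤ) : Function.Injective (Hom.lin (syzygyIncl X i)) :=
  kerSubtype_injective _

theorem coverMap_syzygyIncl (i : ℤ) (x : ((syzygy X).X i).carrier) :
    Hom.lin ((coverMap X).f (i + 1)) (Hom.lin (syzygyIncl X i) x) = 0 := lin_kerSubtype _ x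

theorem exists_syzygyIncl {i : ℤ} (x : ((cover X).X (i + 1)).carrier)
    (hx : Hom.lin ((coverMap X).f (i + 1)) x = 0) : ∃ y, Hom.lin (syzygyIncl X i) y = x :=
  exists_kerSubtype _ x hx

theorem syzygyIncl_d (i : ℤ) (x : ((syzygy X).X i).carrier) :
    Hom.lin (syzygyIncl X (i + 1)) (Hom.lin ((syzygy X).d i (i + 1)) x) =
      -Hom.lin ((cover X).d (i + 1) (i + 1 + 1)) (Hom.lin (syzygyIncl X i) x) := by
  have h : (syzygy X).d i (i + 1) = syzygyD X i :=
    CochainComplex.of_d (fun i => ker ((coverMap X).f (i + 1))) (syzygyD X) i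
  rw [h]
  rfl

/-- The iterated syzygies. -/
noncomputable def syzygies : ℕ → CochainComplex (GrMod 𝒜) ℤ
  | 0 => X
  | n + 1 => syzygy (syzygies n)

/-- The map from the cover of a syzygy to the preceding cover. -/
noncomputable def link (n : ℕ) (i : ℤ) :
    (cover (syzygies X (n + 1))).X i ⟶ (cover (syzygies X n)).X (i + 1) :=
  (coverMap (syzygies X (n + 1))).f i ≫ syzygyIncl (syzygies X n) i

theorem link_apply (n : ℕ) (i : ℤ) (x) : Hom.lin (link X n i) x =
    Hom.lin (syzygyIncl (syzygies X n) i) (Hom.lin ((coverMap (syzygies X (n + 1))).f i) x) := rfl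

/-- The first link lands in a syzygy, which by definition the next cover map kills. -/
theorem link_link (n : ℕ) (i : ℤ) (x) :
    Hom.lin (link X n (i + 1)) (Hom.lin (link X (n + 1) i) x) = 0 := by
  rw [link_apply, link_apply]
  exact (congrArg _ (coverMap_syzygyIncl (syzygies X (n + 1)) i _)).trans (map_zero _)

theorem link_d (n : ℕ) (i : ℤ) (x) :
    Hom.lin (link X n (i + 1)) (Hom.lin ((cover (syzygies X (n + 1))).d i (i + 1)) x) =
      -Hom.lin ((cover (syzygies X n)).d (i + 1) (i + 1 + 1)) (Hom.lin (link X n i) x) := by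
  rw [link_apply, link_apply, ← hom_d_apply]
  exact syzygyIncl_d (syzygies X n) i _

/-- The projection of a direct sum to one of its summands. -/
def directSumProj (M : ℕ → GrMod 𝒜) (n : ℕ) : directSum M ⟶ M n :=
  Hom.mk (M := directSum M)
    { toFun := fun x => DFunLike.coe (F := Π₀ n, (M n).carrier) x n
      map_add' := fun _ _ => rfl
      map_smul' := fun _ _ => rfl }
    fun _ _ h => h n

omit [GradedAlgebra 𝒜] in
theorem directSum_ext {M : ℕ → GrMod 𝒜} {x y : (directSum M).carrier}
    (h : ∀ n, Hom.lin (directSumProj M n) x = Hom.lin (directSumProj M n) y) : x = y :=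
  DFinsupp.ext h

/-- The elements of a direct sum that are concentrated in one index. -/
def directSumSingle {M : ℕ → GrMod 𝒜} (n : ℕ) (m : (M n).carrier) : (directSum M).carrier :=
  DFinsupp.single n m

omit [GradedAlgebra 𝒜] in
theorem directSumProj_single {M : ℕ → GrMod 𝒜} (n : ℕ) (m : (M n).carrier) :
    Hom.lin (directSumProj M n) (directSumSingle n m) = m :=
  DFinsupp.single_eq_same (β := fun n => (M n).carrier)

omit [GradedAlgebra 𝒜] in
theorem directSumProj_single_ne {M : ℕ → GrMod 𝒜} (n n' : ℕ) (m : (M n).carrier) (h : n' ≠ n) :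
    Hom.lin (directSumProj M n') (directSumSingle n m) = 0 :=
  DFinsupp.single_eq_of_ne (β := fun n => (M n).carrier) h

omit [GradedAlgebra 𝒜] in
theorem exists_directSumProj_eq_zero {M : ℕ → GrMod 𝒜} (x : (directSum M).carrier) :
    ∃ N, ∀ n, N ≤ n → Hom.lin (directSumProj M n) x = 0 := by
  classical
  let y : Π₀ n, (M n).carrier := x
  refine ⟨y.support.sup id + 1, fun n hn => ?_⟩
  by_contra h
  have h1 : n ∈ y.support := DFinsupp.mem_support_iff.2 h
  have h2 : id n ≤ y.support.sup id := Finset.le_sup h1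
  simp only [id] at h2
  omega

/-- The components of the differential of the total complex. -/
noncomputable def totDComponent (i : ℤ) (n : ℕ) :
    (directSum fun n => (cover (syzygies X n)).X i).carrier →ₗ[R]
      ((cover (syzygies X n)).X (i + 1)).carrier :=
  (Hom.lin ((cover (syzygies X n)).d i (i + 1))).comp (Hom.lin (directSumProj _ n)) +
    (Hom.lin (link X n i)).comp (Hom.lin (directSumProj _ (n + 1)))

/-- The differential of the total complex. -/
noncomputable def totD (i : ℤ) :
    directSum (fun n => (cover (syzygies X n)).X i) ⟶
      directSum (fun n => (cover (syzygies X n)).X (i + 1)) :=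
  Hom.mk (M := directSum fun n => (cover (syzygies X n)).X i)
    (N := directSum fun n => (cover (syzygies X n)).X (i + 1))
    { toFun := fun x =>
        DFinsupp.mapRange (fun n => Hom.lin ((cover (syzygies X n)).d i (i + 1)))
            (fun _ => map_zero _) x +
          DFinsupp.mapRange (fun n => Hom.lin (link X n i)) (fun _ => map_zero _)
            (DFinsupp.comapDomain Nat.succ Nat.succ_injective x)
      map_add' := fun x y => DFinsupp.ext fun n =>
        map_add (totDComponent X i n) x y
      map_smul' := fun r x => DFinsupp.ext fun n =>
        map_smul (totDComponent X i n) r x }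
    fun _ _ hx n => add_mem (Hom.mem ((cover (syzygies X n)).d i (i + 1)) (hx n))
      (Hom.mem (link X n i) (hx (n + 1)))

theorem totD_apply (i : ℤ) (x) (n : ℕ) :
    Hom.lin (directSumProj _ n) (Hom.lin (totD X i) x) =
      Hom.lin ((cover (syzygies X n)).d i (i + 1)) (Hom.lin (directSumProj _ n) x) +
        Hom.lin (link X n i) (Hom.lin (directSumProj _ (n + 1)) x) := rfl

/-- The total complex of the covers of the iterated syzygies. -/
noncomputable def tot : CochainComplex (GrMod 𝒜) ℤ :=
  CochainComplex.of (fun i => directSum fun n => (cover (syzygies X n)).X i) (totD X) fun i => by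
    refine Hom.ext (LinearMap.ext fun x => directSum_ext fun n => ?_)
    -- Three contributions: the internal differential squares to zero, two successive links vanish,
    -- and the mixed terms cancel because links anticommute with the differentials.
    rw [Hom.lin_comp_apply, totD_apply, totD_apply, totD_apply, map_add, map_add, d_d_apply,
      link_link, link_d]
    simp only [zero_add, add_zero, add_neg_cancel]
    rfl

/-- The projection of the total complex to the part of index `n`, in each degree. -/
noncomputable def totProj (i : ℤ) (n : ℕ) : (tot X).X i ⟶ (cover (syzygies X n)).X i :=
  directSumProj _ n

/-- The elements of the total complex that are concentrated in one index. -/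
noncomputable def totSingle {i : ℤ} (n : ℕ) (x : ((cover (syzygies X n)).X i).carrier) :
    ((tot X).X i).carrier := directSumSingle n x

theorem tot_ext {i : ℤ} {x y : ((tot X).X i).carrier}
    (h : ∀ n, Hom.lin (totProj X i n) x = Hom.lin (totProj X i n) y) : x = y := directSum_ext h

theorem totProj_single {i : ℤ} (n : ℕ) (x : ((cover (syzygies X n)).X i).carrier) :
    Hom.lin (totProj X i n) (totSingle X n x) = x :=
  directSumProj_single (M := fun n => (cover (syzygies X n)).X i) n x

theorem totProj_single_ne {i : ℤ} (n n' : ℕ) (x : ((cover (syzygies X n)).X i).carrier)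
    (h : n' ≠ n) : Hom.lin (totProj X i n') (totSingle X n x) = 0 :=
  directSumProj_single_ne (M := fun n => (cover (syzygies X n)).X i) n n' x h

theorem totProj_d (i : ℤ) (x) (n : ℕ) :
    Hom.lin (totProj X (i + 1) n) (Hom.lin ((tot X).d i (i + 1)) x) =
      Hom.lin ((cover (syzygies X n)).d i (i + 1)) (Hom.lin (totProj X i n) x) +
        Hom.lin (link X n i) (Hom.lin (totProj X i (n + 1)) x) := by
  have h : (tot X).d i (i + 1) = totD X i :=
    CochainComplex.of_d (fun i => directSum fun n => (cover (syzygies X n)).X i) (totD X) i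
  rw [h]
  exact totD_apply X i x n

theorem coverMap_link (n : ℕ) (i : ℤ) (x) :
    Hom.lin ((coverMap (syzygies X n)).f (i + 1)) (Hom.lin (link X n i) x) = 0 :=
  coverMap_syzygyIncl _ _ _

/-- The augmentation of the total complex. -/
noncomputable def totMap : tot X ⟶ syzygies X 0 :=
  CochainComplex.ofHom (fun i => totProj X i 0 ≫ (coverMap (syzygies X 0)).f i) fun i => by
    refine Hom.ext (LinearMap.ext fun x => ?_)
    rw [Hom.lin_comp_apply, Hom.lin_comp_apply, Hom.lin_comp_apply, Hom.lin_comp_apply,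
      totProj_d, hom_d_apply, map_add, coverMap_link, add_zero]

theorem totMap_apply (i : ℤ) (x) : Hom.lin ((totMap X).f i) x =
    Hom.lin ((coverMap (syzygies X 0)).f i) (Hom.lin (totProj X i 0) x) := rfl

/-- A cycle in a cover which is mapped to a boundary is a boundary, up to the image of a cycle
in the next cover. -/
theorem exists_eq_d_add_link (n : ℕ) (i : ℤ) (z : ((cover (syzygies X n)).X (i + 1)).carrier)
    (hz : Hom.lin ((cover (syzygies X n)).d (i + 1) (i + 1 + 1)) z = 0)
    (y : ((syzygies X n).X i).carrier) (hy : Hom.lin ((syzygies X n).d i (i + 1)) y =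
      Hom.lin ((coverMap (syzygies X n)).f (i + 1)) z) :
    ∃ v w, Hom.lin ((cover (syzygies X (n + 1))).d i (i + 1)) w = 0 ∧
      Hom.lin ((cover (syzygies X n)).d i (i + 1)) v + Hom.lin (link X n i) w = z := by
  -- With v over y, the element z − d v dies in `syzygies X n`, so it is a cycle of the next syzygy,
  -- and such cycles lift to cycles of the next cover.
  obtain ⟨v, rfl⟩ := coverMap_surjective _ y
  obtain ⟨t, ht⟩ := exists_syzygyIncl (syzygies X n)
    (z - Hom.lin ((cover (syzygies X n)).d i (i + 1)) v) (by
      rw [map_sub, ← hy, hom_d_apply, sub_self])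
  have ht' : Hom.lin ((syzygies X (n + 1)).d i (i + 1)) t = 0 := by
    refine syzygyIncl_injective (syzygies X n) (i + 1) ?_
    refine (syzygyIncl_d (syzygies X n) i t).trans ?_
    rw [ht, map_sub, hz, d_d_apply, sub_zero]
    exact neg_zero.trans (map_zero _).symm
  obtain ⟨w, hw, hw'⟩ := coverMap_surjective_cycles (syzygies X (n + 1)) t ht'
  refine ⟨v, w, hw, ?_⟩
  rw [link_apply, hw', ht, add_sub_cancel]

/-- If the image of a cycle in the preceding cover is a boundary, then so is its image in the
syzygy. -/
theorem exists_d_eq_coverMap (n : ℕ) (i : ℤ)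
    (z : ((cover (syzygies X (n + 1))).X (i + 1)).carrier)
    (u : ((cover (syzygies X n)).X (i + 1)).carrier)
    (hu : Hom.lin ((cover (syzygies X n)).d (i + 1) (i + 1 + 1)) u +
      Hom.lin (link X n (i + 1)) z = 0) :
    ∃ y, Hom.lin ((syzygies X (n + 1)).d i (i + 1)) y =
      Hom.lin ((coverMap (syzygies X (n + 1))).f (i + 1)) z := by
  -- The image of u is a cycle because the cover map kills links. Correcting u by a cycle u' with
  -- the same image gives an element of the syzygy whose differential is the image of z.
  obtain ⟨u', hu', hu''⟩ := coverMap_surjective_cycles (syzygies X n)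
    (Hom.lin ((coverMap (syzygies X n)).f (i + 1)) u) (by
      have h := congrArg (Hom.lin ((coverMap (syzygies X n)).f (i + 1 + 1))) hu
      rwa [map_add, coverMap_link, add_zero, map_zero, ← hom_d_apply] at h)
  obtain ⟨t, ht⟩ := exists_syzygyIncl (syzygies X n) (u - u') (by
    rw [map_sub, hu'', sub_self])
  refine ⟨t, syzygyIncl_injective (syzygies X n) (i + 1) ?_⟩
  refine (syzygyIncl_d (syzygies X n) i t).trans ?_
  rw [ht, map_sub, hu', sub_zero]
  exact neg_eq_of_add_eq_zero_right hu

/-- Induction on the number of indices in which x may be nonzero. Subtracting a boundary kills the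
highest component; direct sums make the process finite. -/
theorem exists_tot_d_eq (N : ℕ) : ∀ (i : ℤ) (x : ((tot X).X (i + 1)).carrier),
    (∀ n, N ≤ n → Hom.lin (totProj X (i + 1) n) x = 0) →
    Hom.lin ((tot X).d (i + 1) (i + 1 + 1)) x = 0 →
    (∃ y, Hom.lin ((syzygies X 0).d i (i + 1)) y = Hom.lin ((totMap X).f (i + 1)) x) →
    ∃ q, Hom.lin ((tot X).d i (i + 1)) q = x := by
  induction N with
  | zero =>
    intro i x hx _ _
    refine ⟨0, tot_ext X fun n => ?_⟩
    rw [hx n (Nat.zero_le n), map_zero, map_zero]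
  | succ N ih =>
    intro i x hx hd hy
    have hcomp : ∀ n, Hom.lin ((cover (syzygies X n)).d (i + 1) (i + 1 + 1))
        (Hom.lin (totProj X (i + 1) n) x) +
        Hom.lin (link X n (i + 1)) (Hom.lin (totProj X (i + 1) (n + 1)) x) = 0 := fun n => by
      rw [← totProj_d, hd, map_zero]
    have hz : Hom.lin ((cover (syzygies X N)).d (i + 1) (i + 1 + 1))
        (Hom.lin (totProj X (i + 1) N) x) = 0 := by
      have h := hcomp N
      rwa [hx (N + 1) le_rfl, map_zero, add_zero] at h
    -- At index 0 this is the hypothesis on the augmentation. At a higher index it follows from the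
    -- component of d x = 0 just below.
    have hb : ∃ y, Hom.lin ((syzygies X N).d i (i + 1)) y =
        Hom.lin ((coverMap (syzygies X N)).f (i + 1)) (Hom.lin (totProj X (i + 1) N) x) := by
      rcases N with _ | N
      · exact hy
      · exact exists_d_eq_coverMap X N i _ _ (hcomp N)
    obtain ⟨y, hy'⟩ := hb
    obtain ⟨v, w, hw, hvw⟩ := exists_eq_d_add_link X N i _ hz y hy'
    -- Its boundary agrees with x in index N and introduces nothing above N: w is a cycle, so index
    -- N + 1 receives no contribution from it.
    let q := totSingle X N v + totSingle X (N + 1) w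
    have hq : ∀ n, Hom.lin (totProj X i n) q = Hom.lin (totProj X i n) (totSingle X N v) +
        Hom.lin (totProj X i n) (totSingle X (N + 1) w) := fun n => map_add _ _ _
    obtain ⟨q', hq'⟩ := ih i (x - Hom.lin ((tot X).d i (i + 1)) q) (by
      intro n hn
      rw [map_sub, totProj_d, hq n, hq (n + 1)]
      rcases eq_or_lt_of_le hn with rfl | hn
      · rw [totProj_single, totProj_single_ne X (N + 1) N w (by omega),
          totProj_single_ne X N (N + 1) v (by omega), totProj_single, add_zero, zero_add, hvw,
          sub_self]
      · rw [hx n hn, totProj_single_ne X N n v (by omega),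
          totProj_single_ne X N (n + 1) v (by omega),
          totProj_single_ne X (N + 1) (n + 1) w (by omega)]
        simp only [zero_add, map_zero, add_zero, zero_sub, neg_eq_zero]
        rcases eq_or_ne n (N + 1) with rfl | hn'
        · rw [totProj_single, hw]
        · rw [totProj_single_ne X (N + 1) n w hn', map_zero])
      (by rw [map_sub, hd, d_d_apply, sub_zero])
      (by
        obtain ⟨y, hy⟩ := hy
        refine ⟨y - Hom.lin ((totMap X).f i) q, ?_⟩
        rw [map_sub, map_sub, hy, hom_d_apply])
    exact ⟨q' + q, by rw [map_add, hq', sub_add_cancel]⟩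

/-- Cycles of X already lift to cycles of the cover of index 0, which are cycles of the total
complex. Cycles over boundaries are handled by descending induction on the top index. -/
theorem quasiIso_totMap : quasiIso 𝒜 (totMap X) := by
  refine quasiIso_of_elements _ ?_ ?_
  · intro i z hz
    obtain ⟨p, hp, hp'⟩ := coverMap_surjective_cycles (syzygies X 0) z hz
    refine ⟨totSingle X 0 p, tot_ext X fun n => ?_, ?_⟩
    · rw [totProj_d, totProj_single_ne X 0 (n + 1) p (by omega), map_zero, map_zero, add_zero]
      rcases eq_or_ne n 0 with rfl | hn
      · rw [totProj_single, hp]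
      · rw [totProj_single_ne X 0 n p hn, map_zero]
    · rw [totMap_apply, totProj_single, hp']
  · intro i p hp hy
    obtain ⟨N, hN⟩ := exists_directSumProj_eq_zero p
    exact exists_tot_d_eq X N i p hN hp hy

end GrMod
end Resolution

/-! ### Semi-freeness of the total complex -/

section Resolution

variable {k : Type w} {R : Type u} [CommRing k] [CommRing R] [Algebra k R]

namespace GrMod

variable {𝒜 : ℤ → Submodule k R} [GradedAlgebra 𝒜] (X : CochainComplex (GrMod 𝒜) ℤ)

/-- The coefficient of a generator in an element of a cover. -/
noncomputable def coverCoeff {i : ℤ} (c : Cell X i) : ((cover X).X i).carrier →ₗ[R] R :=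
  Finsupp.lapply c

theorem coverCoeff_mem {i e : ℤ} (c : Cell X i) {x : ((cover X).X i).carrier}
    (hx : x ∈ ((cover X).X i).grading e) : coverCoeff X c x ∈ 𝒜 (e - c.deg) := hx c

theorem coverCoeff_gen_ne {i : ℤ} {c c' : Cell X i} (h : c' ≠ c) :
    coverCoeff X c' (coverGen c) = 0 :=
  Finsupp.single_eq_of_ne h

/-- The rank of a generator of the total complex. -/
def totRank {i : ℤ} (γ : Σ n, Cell (syzygies X n) i) : ℕ :=
  -- The differential takes a chain cell to a cycle cell of the same index, and the link lowers the
  -- index by one. Weighting the index by 2 makes the rank drop in both cases.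
  2 * γ.1 + Sum.elim (fun _ => 1) (fun _ => 0) γ.2

/-- The generators of the total complex. -/
noncomputable def totBasis (i : ℤ) :
    Module.Basis (Σ n, Cell (syzygies X n) i) R ((tot X).X i).carrier :=
  DFinsupp.basis (M := fun n => Cell (syzygies X n) i →₀ R) fun _ => Finsupp.basisSingleOne

theorem totBasis_repr {i : ℤ} (x : ((tot X).X i).carrier) (γ : Σ n, Cell (syzygies X n) i) :
    (totBasis X i).repr x γ = coverCoeff _ γ.2 (Hom.lin (totProj X i γ.1) x) := rfl

theorem totBasis_apply {i : ℤ} (γ : Σ n, Cell (syzygies X n) i) :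
    totBasis X i γ = totSingle X γ.1 (coverGen γ.2) := by
  rw [← (totBasis X i).repr.injective.eq_iff]
  classical
  refine Finsupp.ext fun γ' => ?_
  rw [Module.Basis.repr_self, totBasis_repr]
  obtain ⟨n, c⟩ := γ
  obtain ⟨n', c'⟩ := γ'
  rcases eq_or_ne n' n with rfl | hn
  · rw [totProj_single]
    rcases eq_or_ne c' c with rfl | hc
    · rw [Finsupp.single_eq_same]
      exact Finsupp.single_eq_same.symm
    · rw [coverCoeff_gen_ne _ hc, Finsupp.single_eq_of_ne]
      rintro h
      exact hc (by simpa using h)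
  · rw [totProj_single_ne X n n' _ hn, map_zero, Finsupp.single_eq_of_ne]
    rintro h
    exact hn (congrArg Sigma.fst h)

theorem totSingle_mem {i e : ℤ} (n : ℕ) {x : ((cover (syzygies X n)).X i).carrier}
    (hx : x ∈ ((cover (syzygies X n)).X i).grading e) :
    totSingle X n x ∈ ((tot X).X i).grading e := by
  intro n'
  change Hom.lin (totProj X i n') (totSingle X n x) ∈ _
  rcases eq_or_ne n' n with rfl | hn
  · rwa [totProj_single]
  · rw [totProj_single_ne X n n' _ hn]
    exact zero_mem _

/-- The total complex is semi-free. -/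
noncomputable def totSemiFree : SemiFree (tot X) where
  Γ i := Σ n, Cell (syzygies X n) i
  basis := totBasis X
  deg i γ := γ.2.deg
  rank i γ := totRank X γ
  basis_mem i γ := by
    rw [totBasis_apply]
    exact totSingle_mem X _ (gen_mem (deg := Cell.deg) γ.2)
  repr_mem i e m hm γ := by
    rw [totBasis_repr]
    exact coverCoeff_mem _ _ (Hom.mem _ hm)
  d_mem i γ := by
    rw [Module.Basis.mem_span_image]
    rintro ⟨m, c'⟩ h
    rw [Finset.mem_coe, Finsupp.mem_support_iff, totBasis_repr, totProj_d, totBasis_apply] at h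
    obtain ⟨n, c⟩ := γ
    change totRank X ⟨m, c'⟩ < totRank X ⟨n, c⟩
    -- A generator occurring in the differential comes from the internal differential if its index
    -- is unchanged, and from the link if its index is one lower.
    rcases eq_or_ne m n with rfl | hm
    · rw [totProj_single, totProj_single_ne X m (m + 1) _ (by omega), map_zero, add_zero] at h
      rcases c with x | z
      · rw [cover_d_chain] at h
        obtain rfl : c' = x.boundary := by
          by_contra hc
          exact h (coverCoeff_gen_ne _ hc)
        simp [totRank, Chain.boundary]
      · rw [cover_d_cycle, map_zero] at h
        exact absurd rfl h
    · rw [totProj_single_ne X n m _ hm, map_zero, zero_add] at h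
      obtain rfl : m + 1 = n := by
        by_contra hm'
        rw [totProj_single_ne X n (m + 1) _ hm', map_zero, map_zero] at h
        exact h rfl
      rcases c' with c' | c' <;> simp [totRank] <;> omega

/-- Every complex of graded modules has a K-projective resolution. -/
theorem exists_kProjective_resolution : ∃ (P : CochainComplex (GrMod 𝒜) ℤ) (p : P ⟶ X),
    kProjective 𝒜 P ∧ quasiIso 𝒜 p :=
  ⟨tot X, totMap X, (totSemiFree X).kProjective, quasiIso_totMap X⟩

theorem isResolving_kProjective :
    IsResolving (quasiIso 𝒜) (HomotopyCategory.quotient (GrMod 𝒜) (ComplexShape.up ℤ))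
      (kProjective 𝒜) :=
  isResolving exists_kProjective_resolution

/-! ### Derived functors and their compositions -/

section Derived

variable {S T : Type u} [CommRing S] [Algebra k S] [CommRing T] [Algebra k T]
  {ℬ : ℤ → Submodule k S} {𝒞 : ℤ → Submodule k T}

theorem hasLeftDerived (F : GrMod 𝒜 ⥤ GrMod ℬ) [F.Additive] : HasLeftDerived F :=
  isResolving_kProjective.hasLeftDerivedFunctor _ (toDerived_map_eq F) quasiIso_of_homotopic
    (map_eq_of_homotopic _ (Localization.inverts _ _))

/-- The counit of the total left derived functor. -/
noncomputable def leftDerivedCounit (F : GrMod 𝒜 ⥤ GrMod ℬ) [F.Additive] [HasLeftDerived F] :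
    (quasiIso 𝒜).Q ⋙ leftDerived F ⟶ toDerived F :=
  (toDerived F).totalLeftDerivedCounit (quasiIso 𝒜).Q (quasiIso 𝒜)

instance (F : GrMod 𝒜 ⥤ GrMod ℬ) [F.Additive] [HasLeftDerived F] :
    (leftDerived F).IsLeftDerivedFunctor (leftDerivedCounit F) (quasiIso 𝒜) := by
  unfold leftDerived leftDerivedCounit
  infer_instance

theorem isIso_leftDerivedCounit_app (F : GrMod 𝒜 ⥤ GrMod ℬ) [F.Additive] [HasLeftDerived F]
    {P : CochainComplex (GrMod 𝒜) ℤ} (hP : kProjective 𝒜 P) :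
    IsIso ((leftDerivedCounit F).app P) :=
  isResolving_kProjective.isIso_counit_app _ (toDerived_map_eq F) (quasiIso 𝒜).Q
    quasiIso_of_homotopic (map_eq_of_homotopic _ (Localization.inverts _ _)) _ _ hP

/-- For an additive functor which preserves exact complexes, the counit of the left derived
functor is an isomorphism. -/
theorem isIso_leftDerivedCounit_app_of_exact (F : GrMod 𝒜 ⥤ GrMod ℬ) [F.Additive]
    [HasLeftDerived F] (hF : ∀ X : CochainComplex (GrMod 𝒜) ℤ, IsExact X →
      IsExact ((F.mapHomologicalComplex (ComplexShape.up ℤ)).obj X))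
    (X : CochainComplex (GrMod 𝒜) ℤ) : IsIso ((leftDerivedCounit F).app X) := by
  obtain ⟨P, p, hP, hp⟩ := exists_kProjective_resolution X
  have h1 := isIso_leftDerivedCounit_app F hP
  have h2 : IsIso ((toDerived F).map p) :=
    Localization.inverts (quasiIso ℬ).Q (quasiIso ℬ) _ (quasiIso_map F hF p hp)
  have h3 : IsIso ((quasiIso 𝒜).Q.map p) := Localization.inverts _ (quasiIso 𝒜) _ hp
  have h3' : IsIso (((quasiIso 𝒜).Q ⋙ leftDerived F).map p) :=
    Functor.map_isIso (leftDerived F) ((quasiIso 𝒜).Q.map p)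
  have h4 := (leftDerivedCounit F).naturality p
  -- Naturality along a resolution p expresses the counit at X through three isomorphisms; F(p)
  -- becomes one since F preserves quasi-isomorphisms.
  have h5 : (leftDerivedCounit F).app X =
      inv (((quasiIso 𝒜).Q ⋙ leftDerived F).map p) ≫ (leftDerivedCounit F).app P ≫
        (toDerived F).map p := by
    rw [IsIso.eq_inv_comp, h4]
  rw [h5]
  infer_instance

/-- A composition of two functors, followed by passage to the derived category. -/
noncomputable def compCounit (F : GrMod 𝒜 ⥤ GrMod ℬ) [F.Additive] [HasLeftDerived F]
    (G : GrMod ℬ ⥤ GrMod 𝒞) [G.Additive] [HasLeftDerived G] :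
    (quasiIso 𝒜).Q ⋙ leftDerived F ⋙ leftDerived G ⟶ toDerived (F ⋙ G) where
  app X := (leftDerived G).map ((leftDerivedCounit F).app X) ≫
    (leftDerivedCounit G).app ((F.mapHomologicalComplex (ComplexShape.up ℤ)).obj X)
  naturality X Y f := by
    have h1 : (leftDerived F).map ((quasiIso 𝒜).Q.map f) ≫ (leftDerivedCounit F).app Y =
        (leftDerivedCounit F).app X ≫ (toDerived F).map f := (leftDerivedCounit F).naturality f
    have h2 := (leftDerivedCounit G).naturality
      ((F.mapHomologicalComplex (ComplexShape.up ℤ)).map f)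
    have h3 := congrArg (leftDerived G).map h1
    rw [Functor.map_comp, Functor.map_comp] at h3
    refine Eq.trans ?_ (Category.assoc _ _ _).symm
    refine Eq.trans ?_ (congrArg ((leftDerived G).map ((leftDerivedCounit F).app X) ≫ ·) h2)
    refine (Category.assoc _ _ _).symm.trans (Eq.trans ?_ (Category.assoc _ _ _))
    exact congrArg (· ≫ (leftDerivedCounit G).app _) h3

/-- The composition of the derived functors is the derived functor of the composition if
the second functor can be computed on the values of the first functor on K-projective
complexes. -/
theorem isLeftDerivedFunctor_comp (F : GrMod 𝒜 ⥤ GrMod ℬ) [F.Additive] [HasLeftDerived F]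
    (G : GrMod ℬ ⥤ GrMod 𝒞) [G.Additive] [HasLeftDerived G]
    (h : ∀ P, kProjective 𝒜 P → IsIso ((leftDerivedCounit G).app
      ((F.mapHomologicalComplex (ComplexShape.up ℤ)).obj P))) :
    (leftDerived F ⋙ leftDerived G).IsLeftDerivedFunctor (compCounit F G) (quasiIso 𝒜) := by
  refine isResolving_kProjective.isLeftDerivedFunctor (toDerived (F ⋙ G)) (quasiIso 𝒜).Q
    (map_eq_of_homotopic _ (Localization.inverts _ _)) _ _ fun P hP => ?_
  have h1 := isIso_leftDerivedCounit_app F hP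
  have h2 := h P hP
  exact IsIso.comp_isIso' inferInstance h2

/-- Functors which agree up to isomorphism have isomorphic derived functors, also if these are
presented as compositions. -/
theorem nonempty_leftDerived_comp_iso {T' : Type u} [CommRing T'] [Algebra k T']
    {𝒟 : ℤ → Submodule k T'}
    (F : GrMod 𝒜 ⥤ GrMod ℬ) [F.Additive] [HasLeftDerived F]
    (G : GrMod ℬ ⥤ GrMod 𝒟) [G.Additive] [HasLeftDerived G]
    (F' : GrMod 𝒜 ⥤ GrMod 𝒞) [F'.Additive] [HasLeftDerived F']
    (G' : GrMod 𝒞 ⥤ GrMod 𝒟) [G'.Additive] [HasLeftDerived G'] (e : F ⋙ G ≅ F' ⋙ G')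
    (h : ∀ P, kProjective 𝒜 P → IsIso ((leftDerivedCounit G).app
      ((F.mapHomologicalComplex (ComplexShape.up ℤ)).obj P)))
    (h' : ∀ P, kProjective 𝒜 P → IsIso ((leftDerivedCounit G').app
      ((F'.mapHomologicalComplex (ComplexShape.up ℤ)).obj P))) :
    Nonempty (leftDerived F ⋙ leftDerived G ≅ leftDerived F' ⋙ leftDerived G') := by
  have h1 := isLeftDerivedFunctor_comp F G h
  have h2 := isLeftDerivedFunctor_comp F' G' h'
  exact ⟨Functor.leftDerivedNatIso _ _ (compCounit F G) (compCounit F' G') (quasiIso 𝒜)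
    (Functor.isoWhiskerRight (NatIso.mapHomologicalComplex e _) _)⟩

end Derived

end GrMod
end Resolution

/-! ### Base change along a strongly étale map -/

section BaseChange

variable {k : Type w} {R S : Type u} [CommRing k] [CommRing R] [CommRing S] [Algebra k R]
  [Algebra k S] {𝒜 : ℤ → Submodule k R} {ℬ : ℤ → Submodule k S} [GradedAlgebra 𝒜]
  [GradedAlgebra ℬ]

theorem IsStronglyEtale.flat_zeroHom {f : 𝒜 →ₐᵍ[k] ℬ} (hf : IsStronglyEtale f) :
    Module.Flat (𝒜 0) (Along (zeroHom f)) :=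
  ((RingHom.etale_iff_formallyUnramified_and_smooth (zeroHom f)).1 hf.etale).2.flat

/-- S is the base change to R of the flat R₀-module S₀. -/
theorem IsStronglyEtale.flat {f : 𝒜 →ₐᵍ[k] ℬ} (hf : IsStronglyEtale f) :
    Module.Flat R (Along (f.toAlgHom : R →+* S)) := by
  obtain ⟨e, he⟩ := hf.exists_equiv
  have := hf.flat_zeroHom
  let ρ : Along (algebraMap (𝒜 0) R) →+* R := (Along.of (algebraMap (𝒜 0) R)).symm
  -- Flatness of the base change is stated over the copy of R that carries the R₀-algebra structure.
  -- Scalars are transported along the identity to that copy.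
  let _ : Module (Along (algebraMap (𝒜 0) R)) (Along (f.toAlgHom : R →+* S)) :=
    Module.compHom _ ρ
  have hsmul : ∀ (r : R) (x : Along (algebraMap (𝒜 0) R) ⊗[𝒜 0] Along (zeroHom f)),
      e (Along.of (algebraMap (𝒜 0) R) r • x) = f r * e x := by
    intro r x
    induction x using TensorProduct.induction_on with
    | zero => simp
    | add x y hx hy => rw [smul_add, map_add, hx, hy, map_add, mul_add]
    | tmul a b =>
      obtain ⟨a, rfl⟩ := (Along.of (algebraMap (𝒜 0) R)).surjective a
      obtain ⟨b, rfl⟩ := (Along.of (zeroHom f)).surjective b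
      rw [TensorProduct.smul_tmul', smul_eq_mul, ← map_mul, he, he, map_mul, mul_assoc]
  let l : (Along (algebraMap (𝒜 0) R) ⊗[𝒜 0] Along (zeroHom f)) ≃ₗ[Along (algebraMap (𝒜 0) R)]
      Along (f.toAlgHom : R →+* S) :=
    { (e.toAddEquiv.trans (Along.of (f.toAlgHom : R →+* S)).toAddEquiv) with
      map_smul' := fun r x => hsmul r x }
  have h : Module.Flat (Along (algebraMap (𝒜 0) R)) (Along (f.toAlgHom : R →+* S)) :=
    Module.Flat.of_linearEquiv l.symm
  exact h

namespace Kernel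

variable (K : Kernel 𝒜 ℬ)

omit [GradedAlgebra 𝒜] [GradedAlgebra ℬ] in
theorem tmul_mem {M : GrMod 𝒜} {y : K.ι} {z : ℤ} {b : K.B} {m : M.carrier} (hb : b ∈ K.gr y)
    (hm : m ∈ M.grading z) : K.tmul b m ∈ K.tensGrading M (y + K.srcDeg z) := by
  rw [mem_tensGrading_iff]
  exact AddSubgroup.subset_closure ⟨y, z, b, m, hb, hm, rfl, rfl⟩

omit [GradedAlgebra 𝒜] [GradedAlgebra ℬ] in
theorem tmul_add {M : Type u} [AddCommGroup M] [Module R M] (b : K.B) (m m' : M) :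
    K.tmul b (m + m') = K.tmul b m + K.tmul b m' := TensorProduct.tmul_add _ _ _

omit [GradedAlgebra 𝒜] [GradedAlgebra ℬ] in
theorem add_tmul {M : Type u} [AddCommGroup M] [Module R M] (b b' : K.B) (m : M) :
    K.tmul (b + b') m = K.tmul b m + K.tmul b' m := TensorProduct.add_tmul _ _ _

omit [GradedAlgebra 𝒜] [GradedAlgebra ℬ] in
theorem zero_tmul {M : Type u} [AddCommGroup M] [Module R M] (m : M) :
    K.tmul 0 m = 0 := TensorProduct.zero_tmul _ _

omit [GradedAlgebra 𝒜] [GradedAlgebra ℬ] in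
theorem tmul_zero {M : Type u} [AddCommGroup M] [Module R M] (b : K.B) :
    K.tmul b (0 : M) = 0 := TensorProduct.tmul_zero _ _

omit [GradedAlgebra 𝒜] [GradedAlgebra ℬ] in
theorem tmul_smul {M : Type u} [AddCommGroup M] [Module R M] (r : R) (b : K.B) (m : M) :
    K.tmul b (r • m) = K.tmul (K.src r * b) m := by
  refine (TensorProduct.smul_tmul r (Along.of (K.src : R →+* K.B) b) m).symm.trans ?_
  rw [Along.smul_of]
  rfl

omit [GradedAlgebra 𝒜] [GradedAlgebra ℬ] in
theorem iSup_tensGrading (M : GrMod 𝒜) : ⨆ x, K.tensGrading M x = ⊤ := by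
  rw [eq_top_iff]
  intro t _
  refine K.tens_induction (P := fun t => t ∈ ⨆ x, K.tensGrading M x) (zero_mem _)
    (fun _ _ h h' => add_mem h h') (fun b m => ?_) t
  induction b using DirectSum.Decomposition.inductionOn K.gr with
  | zero => rw [zero_tmul]; exact zero_mem _
  | add _ _ h h' => rw [add_tmul]; exact add_mem h h'
  | @homogeneous y b =>
    refine M.homogeneous_induction (p := fun m => K.tmul (b : K.B) m ∈ ⨆ x, K.tensGrading M x)
      (by rw [tmul_zero]; exact zero_mem _) (fun z m hm => ?_)
      (fun _ _ h h' => by rw [tmul_add]; exact add_mem h h') m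
    exact le_iSup (K.tensGrading M) _ (K.tmul_mem b.2 hm)

omit [GradedAlgebra 𝒜] in
theorem subm_eq_top (hK : Function.Surjective K.tgtDeg) (M : GrMod 𝒜) : K.subm M = ⊤ := by
  rw [eq_top_iff]
  intro t _
  have h : t ∈ ⨆ x, K.tensGrading M x := K.iSup_tensGrading M ▸ AddSubgroup.mem_top t
  have h' : ⨆ x, K.tensGrading M x ≤ ⨆ a : ℤ, K.tensGrading M (K.tgtDeg a) := by
    refine iSup_le fun x => ?_
    obtain ⟨a, rfl⟩ := hK x
    exact le_iSup (fun a : ℤ => K.tensGrading M (K.tgtDeg a)) a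
  exact h' h

end Kernel

theorem mem_subm_pullbackKernel (f : 𝒜 →ₐᵍ[k] ℬ) (M : GrMod 𝒜)
    (t : (pullbackKernel f).Tens M.carrier) : t ∈ (pullbackKernel f).subm M := by
  rw [(pullbackKernel f).subm_eq_top (fun x => ⟨x, rfl⟩)]
  exact Submodule.mem_top

/-- The pullback along a flat map preserves exact complexes. -/
theorem isExact_pullback {f : 𝒜 →ₐᵍ[k] ℬ} (hf : Module.Flat R (Along (f.toAlgHom : R →+* S)))
    (X : CochainComplex (GrMod 𝒜) ℤ) (hX : GrMod.IsExact X) :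
    GrMod.IsExact (((pullback f).mapHomologicalComplex (ComplexShape.up ℤ)).obj X) := by
  intro i t
  have h := @Module.Flat.lTensor_exact R (Along (f.toAlgHom : R →+* S)) _ _ _ hf _ _ _ _ _ _ _ _ _
    _ _ (hX i)
  constructor
  · intro ht
    obtain ⟨t', ht'⟩ := (h t.1).1 (congrArg Subtype.val ht)
    exact ⟨⟨t', mem_subm_pullbackKernel f _ t'⟩, Subtype.ext ht'⟩
  · rintro ⟨t', rfl⟩
    exact GrMod.d_d_apply _ _ _ _ _

/-! ### Restriction of scalars -/

/-- A graded `S`-module as a graded `R`-module. -/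
def restrictObj (f : 𝒜 →ₐᵍ[k] ℬ) (N : GrMod ℬ) : GrMod 𝒜 where
  carrier := N.carrier
  module := Module.compHom N.carrier (f.toAlgHom : R →+* S)
  grading := N.grading
  isInternal := N.isInternal
  smul_mem := fun hr hm => N.smul_mem (f.map_mem hr) hm

/-- Restriction of scalars. -/
def restrict (f : 𝒜 →ₐᵍ[k] ℬ) : GrMod ℬ ⥤ GrMod 𝒜 where
  obj N := restrictObj f N
  map {N N'} φ := GrMod.Hom.mk (M := restrictObj f N) (N := restrictObj f N')
    { toFun := fun n => GrMod.Hom.lin φ n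
      map_add' := fun n n' => map_add (GrMod.Hom.lin φ) n n'
      map_smul' := fun r n => map_smul (GrMod.Hom.lin φ) (f r) (show N.carrier from n) }
    fun _ _ h => GrMod.Hom.mem φ h
  map_id _ := rfl
  map_comp _ _ := rfl

instance (f : 𝒜 →ₐᵍ[k] ℬ) : (restrict f).Additive where

/-- The map `m ↦ 1 ⊗ m`. -/
noncomputable def pullbackUnitApp (f : 𝒜 →ₐᵍ[k] ℬ) (M : GrMod 𝒜) :
    M ⟶ (restrict f).obj ((pullback f).obj M) :=
  GrMod.Hom.mk (N := restrictObj f ((pullbackKernel f).onObj M))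
    { toFun := fun m => ⟨(pullbackKernel f).tmul (1 : S) m, mem_subm_pullbackKernel f M _⟩
      map_add' := fun m m' => Subtype.ext ((pullbackKernel f).tmul_add _ m m')
      map_smul' := fun r m => Subtype.ext ((pullbackKernel f).tmul_smul r (1 : S) m) }
    fun i m hm => by
      have h := (pullbackKernel f).tmul_mem (y := 0) (b := 1)
        (SetLike.one_mem_graded (pullbackKernel f).gr) hm
      rw [zero_add] at h
      exact h

/-- The map `S ⊗ N → N`, `s ⊗ n ↦ s n`, for an `S`-module `N`. -/
noncomputable def pullbackCounitAux (f : 𝒜 →ₐᵍ[k] ℬ) (N : GrMod ℬ) :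
    (pullbackKernel f).Tens (restrictObj f N).carrier →ₗ[S] N.carrier :=
  let L : (pullbackKernel f).Tens (restrictObj f N).carrier →+ N.carrier :=
    TensorProduct.liftAddHom (R := R) (M := Along (f.toAlgHom : R →+* S))
      (N := (restrictObj f N).carrier)
      ((smulAddHom S N.carrier).comp (Along.of (f.toAlgHom : R →+* S)).symm.toAddMonoidHom)
      (fun r s n => by
        let n' : N.carrier := n
        let s' : S := s
        change (f r * s') • n' = s' • f r • n'
        rw [smul_smul, mul_comm])
  { L with
    map_smul' := fun r => by
      refine (pullbackKernel f).tens_induction ?_ ?_ ?_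
      · change L (r • 0) = r • L 0
        rw [smul_zero, map_zero, smul_zero]
      · intro t t' h h'
        change L (r • (t + t')) = r • L (t + t')
        change L (r • t) = r • L t at h
        change L (r • t') = r • L t' at h'
        rw [smul_add, map_add, h, h', map_add, smul_add]
      · intro b m
        exact mul_smul r (show S from b) (show N.carrier from m) }

/-- The map `S ⊗ N → N`, `s ⊗ n ↦ s n`, as a morphism of graded modules. -/
noncomputable def pullbackCounitApp (f : 𝒜 →ₐᵍ[k] ℬ) (N : GrMod ℬ) :
    (pullback f).obj ((restrict f).obj N) ⟶ N :=
  GrMod.Hom.mk (M := (pullbackKernel f).onObj (restrictObj f N))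
    ((pullbackCounitAux f N).comp ((pullbackKernel f).subm (restrictObj f N)).subtype)
    fun i t ht => by
      have ht' : t.1 ∈ (pullbackKernel f).tensGrading (restrictObj f N) i := ht
      change pullbackCounitAux f N t.1 ∈ N.grading i
      replace ht' := (Kernel.mem_tensGrading_iff _ _ _).le ht'
      generalize t.1 = t at ht' ⊢
      induction ht' using AddSubgroup.closure_induction with
      | zero => rw [map_zero]; exact zero_mem _
      | add _ _ _ _ h h' => rw [map_add]; exact add_mem h h'
      | neg _ _ h => rw [map_neg]; exact neg_mem h
      | mem t ht =>
        obtain ⟨y, z, b, m, hb, hm, rfl, rfl⟩ := ht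
        exact N.smul_mem hb hm

/-- The unit `M → S ⊗ M`. -/
noncomputable def pullbackUnit (f : 𝒜 →ₐᵍ[k] ℬ) :
    𝟭 (GrMod 𝒜) ⟶ pullback f ⋙ restrict f where
  app := pullbackUnitApp f
  naturality _ _ _ := rfl

/-- Pure tensors suffice. The free choice of `L` serves both the naturality of the counit and the
triangle identity. -/
theorem pullbackCounitAux_tensMap {f : 𝒜 →ₐᵍ[k] ℬ} {M : GrMod 𝒜} {N : GrMod ℬ}
    (φ : M ⟶ restrictObj f N) (L : (pullbackKernel f).Tens M.carrier →+ N.carrier)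
    (h : ∀ (s : S) m, pullbackCounitAux f N ((pullbackKernel f).tmul s (GrMod.Hom.lin φ m)) =
      L ((pullbackKernel f).tmul s m)) (t : (pullbackKernel f).Tens M.carrier) :
    pullbackCounitAux f N ((pullbackKernel f).tensMap φ t) = L t := by
  refine (pullbackKernel f).tens_induction (P := fun t =>
    pullbackCounitAux f N ((pullbackKernel f).tensMap φ t) = L t) ?_ ?_ h t
  · rw [map_zero, map_zero, map_zero]
  · intro t t' h h'
    rw [map_add, map_add, map_add, h, h']

/-- The counit `S ⊗ N → N`. -/
noncomputable def pullbackCounit (f : 𝒜 →ₐᵍ[k] ℬ) :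
    restrict f ⋙ pullback f ⟶ 𝟭 (GrMod ℬ) where
  app := pullbackCounitApp f
  naturality N N' φ := GrMod.Hom.ext <| LinearMap.ext fun t =>
    pullbackCounitAux_tensMap (N := N') ((restrict f).map φ)
      ((GrMod.Hom.lin φ).toAddMonoidHom.comp (pullbackCounitAux f N).toAddMonoidHom)
      (fun s m => (map_smul (GrMod.Hom.lin φ) s (show N.carrier from m)).symm) t.1

theorem pullback_map_unit_counit (f : 𝒜 →ₐᵍ[k] ℬ) (M : GrMod 𝒜) :
    (pullback f).map ((pullbackUnit f).app M) ≫ (pullbackCounit f).app ((pullback f).obj M) =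
      𝟙 _ :=
  GrMod.Hom.ext <| LinearMap.ext fun t =>
    pullbackCounitAux_tensMap (N := (pullbackKernel f).onObj M) ((pullbackUnit f).app M)
      { toFun := fun t => ⟨t, mem_subm_pullbackKernel f M t⟩
        map_zero' := rfl
        map_add' := fun _ _ => rfl }
      (fun s m => Subtype.ext (congrArg (fun s : S => (pullbackKernel f).tmul s m) (mul_one s)))
      t.1

/-- A left adjoint of an exact functor preserves K-projectives: a map from f^*P to an acyclic A
corresponds to a map from P to the restriction of A, which is still acyclic, and a null-homotopy
transfers back. -/
theorem kProjective_pullback (f : 𝒜 →ₐᵍ[k] ℬ) {P : CochainComplex (GrMod 𝒜) ℤ}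
    (hP : GrMod.kProjective 𝒜 P) :
    GrMod.kProjective ℬ (((pullback f).mapHomologicalComplex (ComplexShape.up ℤ)).obj P) := by
  rw [GrMod.kProjective_iff] at hP ⊢
  intro A g hA
  let η : P ⟶ ((restrict f).mapHomologicalComplex (ComplexShape.up ℤ)).obj
      (((pullback f).mapHomologicalComplex (ComplexShape.up ℤ)).obj P) :=
    { f := fun i => (pullbackUnit f).app (P.X i)
      comm' := fun i j _ => ((pullbackUnit f).naturality (P.d i j)).symm }
  let ε : ((pullback f).mapHomologicalComplex (ComplexShape.up ℤ)).obj
      (((restrict f).mapHomologicalComplex (ComplexShape.up ℤ)).obj A) ⟶ A :=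
    { f := fun i => (pullbackCounit f).app (A.X i)
      comm' := fun i j _ => ((pullbackCounit f).naturality (A.d i j)).symm }
  have hA' : GrMod.IsExact (((restrict f).mapHomologicalComplex (ComplexShape.up ℤ)).obj A) := hA
  obtain ⟨H⟩ := hP _ (η ≫ ((restrict f).mapHomologicalComplex (ComplexShape.up ℤ)).map g) hA'
  -- Recovers g from its adjoint, by naturality of the counit and the triangle identity.
  have e : g = ((pullback f).mapHomologicalComplex (ComplexShape.up ℤ)).map
      (η ≫ ((restrict f).mapHomologicalComplex (ComplexShape.up ℤ)).map g) ≫ ε := by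
    refine HomologicalComplex.hom_ext _ _ fun i => ?_
    have h1 : (pullback f).map ((restrict f).map (g.f i)) ≫ (pullbackCounit f).app (A.X i) =
        (pullbackCounit f).app ((pullback f).obj (P.X i)) ≫ g.f i :=
      (pullbackCounit f).naturality (g.f i)
    have h2 : (pullback f).map ((pullbackUnit f).app (P.X i) ≫ (restrict f).map (g.f i)) =
        (pullback f).map ((pullbackUnit f).app (P.X i)) ≫
          (pullback f).map ((restrict f).map (g.f i)) := Functor.map_comp _ _ _
    exact (((congrArg (· ≫ (pullbackCounit f).app (A.X i)) h2).trans
      (Category.assoc _ _ _)).trans ((congrArg ((pullback f).map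
        ((pullbackUnit f).app (P.X i)) ≫ ·) h1).trans ((Category.assoc _ _ _).symm.trans
          ((congrArg (· ≫ g.f i) (pullback_map_unit_counit f (P.X i))).trans
            (Category.id_comp _))))).symm
  rw [e]
  exact ⟨((((pullback f).mapHomotopy H).compRight ε).trans (Homotopy.ofEq (by simp)))⟩

end BaseChange

/-! ### Base change of `Q(R)` -/

section TensorQ

/-- Subgroups of the homogeneous parts which generate everything are the homogeneous parts. -/
theorem eq_of_le_of_iSup_eq_top {ι T : Type*} [DecidableEq ι] [AddCommGroup T]
    {A B : ι → AddSubgroup T} (hB : DirectSum.IsInternal B) (hAB : ∀ x, A x ≤ B x)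
    (hA : ⨆ x, A x = ⊤) (x : ι) : A x = B x := by
  let _ := hB.chooseDecomposition
  refine le_antisymm (hAB x) fun t ht => ?_
  -- Decomposing a sum of elements of the `A y` with respect to `B` collects exactly the summands
  -- from `A x`.
  have key : ∀ t ∈ ⨆ x, A x, (DirectSum.decompose B t x : T) ∈ A x := by
    intro t ht
    induction ht using AddSubgroup.iSup_induction' with
    | h1 => rw [DirectSum.decompose_zero]; exact zero_mem _
    | hadd _ _ _ _ h h' => rw [DirectSum.decompose_add]; exact add_mem h h'
    | hp y t h =>
      by_cases hxy : y = x
      · subst hxy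
        rw [DirectSum.decompose_of_mem_same B (hAB y h)]
        exact h
      · rw [DirectSum.decompose_of_mem_ne B (hAB y h) hxy]
        exact zero_mem _
  have h := key t (hA ▸ AddSubgroup.mem_top t)
  rwa [DirectSum.decompose_of_mem_same B ht] at h

theorem iSup_tensorPiece {R N M ι₁ ι₂ ι : Type*} [CommRing R] [AddCommGroup N] [AddCommGroup M]
    [Module R N] [Module R M] {𝒩 : ι₁ → AddSubgroup N} {ℳ : ι₂ → AddSubgroup M}
    (h𝒩 : ⨆ y, 𝒩 y = ⊤) (hℳ : ⨆ z, ℳ z = ⊤) (δ : ι₁ → ι₂ → ι) :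
    ⨆ x, tensorPiece (R := R) 𝒩 ℳ δ x = ⊤ := by
  rw [eq_top_iff]
  intro t ht
  clear ht
  induction t using TensorProduct.induction_on with
  | zero => exact zero_mem _
  | add _ _ h h' => exact add_mem h h'
  | tmul n m =>
    have hn : n ∈ ⨆ y, 𝒩 y := h𝒩 ▸ AddSubgroup.mem_top n
    induction hn using AddSubgroup.iSup_induction' with
    | h1 => rw [TensorProduct.zero_tmul]; exact zero_mem _
    | hadd _ _ _ _ h h' => rw [TensorProduct.add_tmul]; exact add_mem h h'
    | hp y n hn =>
      have hm : m ∈ ⨆ z, ℳ z := hℳ ▸ AddSubgroup.mem_top m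
      induction hm using AddSubgroup.iSup_induction' with
      | h1 => rw [TensorProduct.tmul_zero]; exact zero_mem _
      | hadd _ _ _ _ h h' => rw [TensorProduct.tmul_add]; exact add_mem h h'
      | hp z m hm =>
        exact le_iSup (tensorPiece (R := R) 𝒩 ℳ δ) (δ y z)
          (AddSubgroup.subset_closure ⟨y, z, n, m, hn, hm, rfl, rfl⟩)

theorem iSup_map_of {k R B ι : Type*} [CommRing k] [CommRing R] [CommRing B] [Algebra k B]
    [DecidableEq ι] [AddMonoid ι] (𝒢 : ι → Submodule k B) [GradedAlgebra 𝒢] (t : R →+* B) :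
    ⨆ x, (𝒢 x).toAddSubgroup.map (Along.of t).toAddMonoidHom = ⊤ := by
  rw [eq_top_iff]
  intro b _
  obtain ⟨b, rfl⟩ := (Along.of t).surjective b
  induction b using DirectSum.Decomposition.inductionOn 𝒢 with
  | zero => rw [map_zero]; exact zero_mem _
  | add _ _ h h' => rw [map_add]; exact add_mem (h trivial) (h' trivial)
  | @homogeneous i m =>
    exact le_iSup (fun x => (𝒢 x).toAddSubgroup.map (Along.of t).toAddMonoidHom) i ⟨m, m.2, rfl⟩

variable {k : Type w} {R S : Type u} [CommRing k] [CommRing R] [CommRing S] [Algebra k R]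
  [Algebra k S] {𝒜 : ℤ → Submodule k R} {ℬ : ℤ → Submodule k S} [GradedAlgebra 𝒜]
  [GradedAlgebra ℬ]

theorem IsStronglyEtale.induction {f : 𝒜 →ₐᵍ[k] ℬ} (hf : IsStronglyEtale f) {p : S → Prop}
    (zero : p 0) (add : ∀ x y, p x → p y → p (x + y)) (mul : ∀ (r : R) (x : ℬ 0), p (f r * x))
    (x : S) : p x := by
  obtain ⟨e, he⟩ := hf.exists_equiv
  obtain ⟨t, rfl⟩ := e.surjective x
  induction t using TensorProduct.induction_on with
  | zero => rw [map_zero]; exact zero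
  | add _ _ h h' => rw [map_add]; exact add _ _ h h'
  | tmul a b => exact (he a b).symm ▸ mul a b

/-- Scalars from k already lie in p(R), so a subring containing the generators suffices. This
applies to the range of a mere ring homomorphism. -/
theorem Q.mem_subring (𝒜 : ℤ → Submodule k R) [GradedAlgebra 𝒜] {H : Subring (Q 𝒜)}
    (hp : ∀ r, Q.p 𝒜 r ∈ H) (hs : ∀ r, Q.s 𝒜 r ∈ H)
    (hu : (⟨LaurentPolynomial.T 1, Algebra.subset_adjoin (Or.inr rfl)⟩ : Q 𝒜) ∈ H) (q : Q 𝒜) :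
    q ∈ H := by
  obtain ⟨q, hq⟩ := q
  have hq' : q ∈ Algebra.adjoin k
    (Set.range (proj k R) ∪ Set.range (coact 𝒜) ∪ {LaurentPolynomial.T 1}) := hq
  induction hq' using Algebra.adjoin_induction with
  | mem q hq' =>
    rcases hq' with (⟨r, rfl⟩ | ⟨r, rfl⟩) | rfl
    · exact hp r
    · exact hs r
    · exact hu
  | algebraMap c =>
    have := hp (algebraMap k R c)
    rw [AlgHom.commutes] at this
    exact this
  | add q q' h₁ h₂ h h' => exact H.add_mem (h h₁) (h' h₂)
  | mul q q' h₁ h₂ h h' =>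
    have e : (⟨q * q', hq⟩ : Q 𝒜) = ⟨q, h₁⟩ * ⟨q', h₂⟩ := Subtype.ext rfl
    rw [e]
    exact H.mul_mem (h h₁) (h' h₂)

theorem Q.map_p (f : 𝒜 →ₐᵍ[k] ℬ) (r : R) : Q.map f (Q.p 𝒜 r) = Q.p ℬ (f r) :=
  Subtype.ext (AddMonoidAlgebra.mapAlgHom_single _ _ _)

theorem Q.map_s (f : 𝒜 →ₐᵍ[k] ℬ) (r : R) : Q.map f (Q.s 𝒜 r) = Q.s ℬ (f r) :=
  Subtype.ext (mapAlgHom_coact f r)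

theorem Q.map_mem (f : 𝒜 →ₐᵍ[k] ℬ) {d : ℤ × ℤ} {q : Q 𝒜} (hq : q ∈ Q.gr 𝒜 d) :
    Q.map f q ∈ Q.gr ℬ d := by
  obtain ⟨r, hr, h⟩ := hq
  refine ⟨f r, f.map_mem hr, ?_⟩
  change AddMonoidAlgebra.mapAlgHom ℤ f.toAlgHom (q : R[T;T⁻¹]) = _
  rw [h, ← LaurentPolynomial.single_eq_C_mul_T, ← LaurentPolynomial.single_eq_C_mul_T,
    AddMonoidAlgebra.mapAlgHom_single]
  rfl

/-- The coaction multiplies by u⁰ in degree zero. This lets the `s`-side and the `p`-side be treated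
by one argument. -/
theorem Q.s_eq_p (r : 𝒜 0) : Q.s 𝒜 r = Q.p 𝒜 r :=
  Subtype.ext ((coact_of_mem 𝒜 r.2).trans (by rw [LaurentPolynomial.T_zero, mul_one]; rfl))

/-- The map `S ⊗ Q(R) → Q(S)`, `x ⊗ q ↦ t(x) Q(f)(q)`, the tensor product being formed
along a map `R → Q(R)` that is compatible with `t : S → Q(S)`. -/
noncomputable def tensorQHom (f : 𝒜 →ₐᵍ[k] ℬ) (t : R →+* Q 𝒜) (t' : S →+* Q ℬ)
    (h : ∀ r, Q.map f (t r) = t' (f r)) :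
    Along (f.toAlgHom : R →+* S) ⊗[R] Along t →+* Q ℬ :=
  let _ : Algebra R (Q ℬ) := (t'.comp (f.toAlgHom : R →+* S)).toAlgebra
  (Algebra.TensorProduct.productMap (R := R) (A := Along (f.toAlgHom : R →+* S)) (B := Along t)
    (S := Q ℬ)
    { t'.comp (Along.of (f.toAlgHom : R →+* S)).symm.toRingHom with commutes' := fun _ => rfl }
    { ((Q.map f : Q 𝒜 →+* Q ℬ)).comp (Along.of t).symm.toRingHom with
      commutes' := fun r => h r }).toRingHom

theorem tensorQHom_tmul (f : 𝒜 →ₐᵍ[k] ℬ) (t : R →+* Q 𝒜) (t' : S →+* Q ℬ)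
    (h : ∀ r, Q.map f (t r) = t' (f r)) (x : S) (q : Q 𝒜) :
    tensorQHom f t t' h (Along.of _ x ⊗ₜ Along.of _ q) = t' x * Q.map f q := rfl

/-- The range contains Q(f)(Q(R)), in particular u, and its multiples by S₀. As S is spanned by the
f(r)x with x in S₀, where p = s, the range contains both p(S) and s(S), whichever of them the tensor
product uses. -/
theorem tensorQHom_surjective {f : 𝒜 →ₐᵍ[k] ℬ} (hf : IsStronglyEtale f) (t : R →+* Q 𝒜)
    (t' : S →+* Q ℬ) (h : ∀ r, Q.map f (t r) = t' (f r)) (h' : ∀ x : ℬ 0, t' x = Q.p ℬ x) :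
    Function.Surjective (tensorQHom f t t' h) := by
  have h0 : ∀ (x : ℬ 0) (q : Q 𝒜), Q.p ℬ x * Q.map f q ∈ (tensorQHom f t t' h).range := by
    intro x q
    rw [← h', ← tensorQHom_tmul f t t' h]
    exact ⟨_, rfl⟩
  have hmap : ∀ q : Q 𝒜, Q.map f q ∈ (tensorQHom f t t' h).range := by
    intro q
    have := h0 1 q
    rwa [show Q.p ℬ ((1 : ℬ 0) : S) = 1 from map_one (Q.p ℬ), one_mul] at this
  have hp : ∀ x, Q.p ℬ x ∈ (tensorQHom f t t' h).range := by
    intro x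
    refine hf.induction (p := fun x => Q.p ℬ x ∈ (tensorQHom f t t' h).range) ?_ ?_ ?_ x
    · rw [map_zero]; exact zero_mem _
    · intro x y hx hy
      rw [map_add]; exact add_mem hx hy
    · intro r x
      rw [map_mul, mul_comm, ← Q.map_p]
      exact h0 x _
  have hs : ∀ x, Q.s ℬ x ∈ (tensorQHom f t t' h).range := by
    intro x
    refine hf.induction (p := fun x => Q.s ℬ x ∈ (tensorQHom f t t' h).range) ?_ ?_ ?_ x
    · rw [map_zero]; exact zero_mem _
    · intro x y hx hy
      rw [map_add]; exact add_mem hx hy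
    · intro r x
      rw [map_mul, mul_comm, ← Q.map_s, Q.s_eq_p]
      exact h0 x _
  have hu : (⟨LaurentPolynomial.T 1, Algebra.subset_adjoin (Or.inr rfl)⟩ : Q ℬ) ∈
      (tensorQHom f t t' h).range := by
    have hu' : (⟨LaurentPolynomial.T 1, Algebra.subset_adjoin (Or.inr rfl)⟩ : Q ℬ) =
        Q.map f ⟨LaurentPolynomial.T 1, Algebra.subset_adjoin (Or.inr rfl)⟩ :=
      Subtype.ext ((AddMonoidAlgebra.mapAlgHom_single _ _ _).trans (by rw [map_one]; rfl)).symm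
    rw [hu']
    exact hmap _
  exact fun q => Q.mem_subring ℬ hp hs hu q

/-- S₀ ⊗_{R₀} Q(R) surjects onto the source, and by flatness it embeds in S₀ ⊗_{R₀} R[u,u⁻¹] ≅
S[u,u⁻¹]. That embedding is the composite with `tensorQHom`. -/
theorem tensorQHom_injective {f : 𝒜 →ₐᵍ[k] ℬ} (hf : IsStronglyEtale f) (t : R →+* Q 𝒜)
    (t' : S →+* Q ℬ) (h : ∀ r, Q.map f (t r) = t' (f r)) (ht : ∀ r : 𝒜 0, t r = Q.p 𝒜 r)
    (h' : ∀ x : ℬ 0, t' x = Q.p ℬ x) :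
    Function.Injective (tensorQHom f t t' h) := by
  obtain ⟨e, he⟩ := hf.exists_equiv
  have hflat := hf.flat_zeroHom
  let t₀ : 𝒜 0 →+* Q 𝒜 := t.comp (algebraMap (𝒜 0) R)
  -- The canonical map x ⊗ q ↦ x ⊗ q. It is onto because f(r)x ⊗ q = x ⊗ r q.
  let α : Along (zeroHom f) ⊗[𝒜 0] Along t₀ →+ Along (f.toAlgHom : R →+* S) ⊗[R] Along t :=
    TensorProduct.liftAddHom
      { toFun := fun x =>
          { toFun := fun q => Along.of (f.toAlgHom : R →+* S)
              (((Along.of (zeroHom f)).symm x : ℬ 0) : S) ⊗ₜ Along.of t ((Along.of t₀).symm q)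
            map_zero' := by rw [map_zero, map_zero, TensorProduct.tmul_zero]
            map_add' := fun _ _ => by rw [map_add, map_add, TensorProduct.tmul_add] }
        map_zero' := by
          ext
          simp
        map_add' := fun _ _ => by
          ext
          simp [TensorProduct.add_tmul] }
      (fun r x q => TensorProduct.smul_tmul (R := R) (r : R) (Along.of (f.toAlgHom : R →+* S)
        (((Along.of (zeroHom f)).symm x : ℬ 0) : S)) (Along.of t ((Along.of t₀).symm q)))
  have hα : Function.Surjective α := by
    intro y
    induction y using TensorProduct.induction_on with
    | zero => exact ⟨0, map_zero α⟩
    | add _ _ h h' =>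
      obtain ⟨a, rfl⟩ := h
      obtain ⟨b, rfl⟩ := h'
      exact ⟨a + b, map_add α a b⟩
    | tmul x q =>
      obtain ⟨x, rfl⟩ := (Along.of (f.toAlgHom : R →+* S)).surjective x
      refine hf.induction (p := fun x => ∃ a, α a = Along.of (f.toAlgHom : R →+* S) x ⊗ₜ q)
        ?_ ?_ ?_ x
      · exact ⟨0, by rw [map_zero, map_zero, TensorProduct.zero_tmul]⟩
      · rintro x y ⟨a, ha⟩ ⟨b, hb⟩
        exact ⟨a + b, by rw [map_add, map_add, TensorProduct.add_tmul, ha, hb]⟩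
      · intro r x
        refine ⟨Along.of (zeroHom f) x ⊗ₜ Along.of t₀ ((Along.of t).symm (r • q)), ?_⟩
        exact (TensorProduct.smul_tmul (R := R) r (Along.of (f.toAlgHom : R →+* S)
          (x : S)) q).symm
  -- The inclusion of Q(R) in R[u,u⁻¹] by coefficients. It is linear over R₀ because `t` agrees
  -- there with `p`, so R₀ acts coefficientwise.
  let γ : Along t₀ →ₗ[𝒜 0] (ℤ →₀ Along (algebraMap (𝒜 0) R)) :=
    { toFun := fun q => (((Along.of t₀).symm q : Q 𝒜) : R[T;T⁻¹]).coeff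
      map_add' := fun _ _ => rfl
      map_smul' := fun r q => by
        obtain ⟨q, rfl⟩ := (Along.of t₀).surjective q
        have h1 : t₀ r = Q.p 𝒜 r := ht r
        rw [Along.smul_of, h1]
        change ((LaurentPolynomial.C (r : R) * (q : R[T;T⁻¹]) : R[T;T⁻¹])).coeff = _
        rw [← LaurentPolynomial.smul_eq_C_mul]
        rfl }
  have hγ : Function.Injective γ := fun q q' hq =>
    (Along.of t₀).symm.injective (Subtype.ext (AddMonoidAlgebra.coeff_injective hq))
  have hγ' := Module.Flat.lTensor_preserves_injective_linearMap (M := Along (zeroHom f)) γ hγ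
  -- The coefficient of uⁱ in the image is read off, through S ≅ R ⊗_{R₀} S₀, from the i-th
  -- coordinate of the flat embedding.
  have key : ∀ (a : Along (zeroHom f) ⊗[𝒜 0] Along t₀) (i : ℤ),
      ((tensorQHom f t t' h (α a) : Q ℬ) : S[T;T⁻¹]).coeff i =
        e (TensorProduct.comm (𝒜 0) _ _
          (TensorProduct.finsuppRight (𝒜 0) (𝒜 0) _ _ ℤ (γ.lTensor _ a) i)) := by
    intro a i
    induction a using TensorProduct.induction_on with
    | zero => simp only [map_zero]; exact (map_zero e).symm
    | add a b ha hb =>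
      simp only [map_add, Finsupp.add_apply] at ha hb ⊢
      rw [← ha, ← hb]
      rfl
    | tmul x q =>
      rw [LinearMap.lTensor_tmul, TensorProduct.finsuppRight_apply_tmul_apply,
        TensorProduct.comm_tmul]
      refine Eq.trans ?_ (he _ _).symm
      obtain ⟨x, rfl⟩ := (Along.of (zeroHom f)).surjective x
      obtain ⟨q, rfl⟩ := (Along.of t₀).surjective q
      change ((t' x * Q.map f q : Q ℬ) : S[T;T⁻¹]).coeff i = f ((q : R[T;T⁻¹]).coeff i) * x
      rw [h']
      change ((LaurentPolynomial.C (x : S) * AddMonoidAlgebra.mapAlgHom ℤ f.toAlgHom q :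
        S[T;T⁻¹])).coeff i = _
      rw [← LaurentPolynomial.smul_eq_C_mul, AddMonoidAlgebra.coeff_smul_apply,
        AddMonoidAlgebra.coeff_mapAlgHom, smul_eq_mul, mul_comm]
      rfl
  rw [injective_iff_map_eq_zero]
  intro y hy
  obtain ⟨a, rfl⟩ := hα y
  have ha : a = 0 := by
    refine hγ' (((TensorProduct.finsuppRight (𝒜 0) (𝒜 0) _ _ ℤ).injective
      (Finsupp.ext fun i => ?_)).trans (map_zero _).symm)
    refine (TensorProduct.comm (𝒜 0) _ _).injective (e.injective ?_)
    rw [← key, hy]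
    simp only [map_zero]
    exact (map_zero e).symm
  rw [ha, map_zero]

/-- `S ⊗ Q(R) → Q(S)` as an isomorphism. -/
theorem exists_tensorQEquiv {f : 𝒜 →ₐᵍ[k] ℬ} (hf : IsStronglyEtale f) (t : R →+* Q 𝒜)
    (t' : S →+* Q ℬ) (h : ∀ r, Q.map f (t r) = t' (f r)) (ht : ∀ r : 𝒜 0, t r = Q.p 𝒜 r)
    (h' : ∀ x : ℬ 0, t' x = Q.p ℬ x) :
    ∃ e : Along (f.toAlgHom : R →+* S) ⊗[R] Along t ≃+* Q ℬ,
      ∀ (x : S) (q : Q 𝒜), e (Along.of _ x ⊗ₜ Along.of _ q) = t' x * Q.map f q :=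
  ⟨RingEquiv.ofBijective (tensorQHom f t t' h)
    ⟨tensorQHom_injective hf t t' h ht h', tensorQHom_surjective hf t t' h h'⟩,
    fun _ _ => rfl⟩

/-- An isomorphism onto `Q(S)` that carries subgroups which generate everything into the
homogeneous parts of `Q(S)` carries them onto these. -/
theorem map_eq_gr_of_le {T : Type*} [CommRing T] (e : T ≃+* Q ℬ) {A : ℤ × ℤ → AddSubgroup T}
    (hA : ⨆ d, A d = ⊤) (h : ∀ d, (A d).map e.toAddMonoidHom ≤ (Q.gr ℬ d).toAddSubgroup)
    (d : ℤ × ℤ) : (A d).map e.toAddMonoidHom = (Q.gr ℬ d).toAddSubgroup := by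
  refine eq_of_le_of_iSup_eq_top (B := fun d => (Q.gr ℬ d).toAddSubgroup)
    (A := fun d => (A d).map e.toAddMonoidHom) (Q.isInternal_gr ℬ) h ?_ d
  rw [← AddSubgroup.map_iSup, hA, ← AddMonoidHom.range_eq_map, AddMonoidHom.range_eq_top]
  exact e.surjective

theorem exists_sTensorQEquiv {f : 𝒜 →ₐᵍ[k] ℬ} (hf : IsStronglyEtale f) :
    ∃ e₁ : STensorQ f ≃+* Q ℬ,
      (∀ (x : S) (q : Q 𝒜), e₁ (Along.of _ x ⊗ₜ Along.of _ q) = Q.s ℬ x * Q.map f q) ∧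
      ∀ d, (STensorQ.gr f d).map e₁.toAddMonoidHom = (Q.gr ℬ d).toAddSubgroup := by
  obtain ⟨e, he⟩ := exists_tensorQEquiv hf (Q.s 𝒜 : R →+* Q 𝒜) (Q.s ℬ : S →+* Q ℬ) (Q.map_s f)
    Q.s_eq_p Q.s_eq_p
  refine ⟨e, he, map_eq_gr_of_le e (iSup_tensorPiece (iSup_map_of ℬ _)
    (iSup_map_of (Q.gr 𝒜) _) _) fun d => ?_⟩
  rw [AddSubgroup.map_le_iff_le_comap, STensorQ.gr, tensorPiece, AddSubgroup.closure_le]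
  rintro _ ⟨i, y, _, _, ⟨x, hx, rfl⟩, ⟨q, hq, rfl⟩, rfl, rfl⟩
  change e (Along.of _ x ⊗ₜ Along.of _ q) ∈ Q.gr ℬ (y.1, y.2 + i)
  rw [he]
  have := SetLike.mul_mem_graded (A := Q.gr ℬ) (Q.s_mem ℬ hx) (Q.map_mem f hq)
  rwa [show ((0 : ℤ), i) + y = (y.1, y.2 + i) from
    Prod.ext (zero_add _) (add_comm _ _)] at this

theorem exists_qTensorSEquiv {f : 𝒜 →ₐᵍ[k] ℬ} (hf : IsStronglyEtale f) :
    ∃ e₂ : QTensorS f ≃+* Q ℬ,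
      (∀ (q : Q 𝒜) (x : S), e₂ (Along.of _ q ⊗ₜ Along.of _ x) = Q.map f q * Q.p ℬ x) ∧
      ∀ d, (QTensorS.gr f d).map e₂.toAddMonoidHom = (Q.gr ℬ d).toAddSubgroup := by
  obtain ⟨e, he⟩ := exists_tensorQEquiv hf (Q.p 𝒜 : R →+* Q 𝒜) (Q.p ℬ : S →+* Q ℬ) (Q.map_p f)
    (fun _ => rfl) (fun _ => rfl)
  have he' : ∀ (q : Q 𝒜) (x : S), (Algebra.TensorProduct.comm R _ _).toRingEquiv.trans e
      (Along.of _ q ⊗ₜ Along.of _ x) = Q.map f q * Q.p ℬ x :=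
    fun q x => (he x q).trans (mul_comm _ _)
  refine ⟨(Algebra.TensorProduct.comm R _ _).toRingEquiv.trans e, he', map_eq_gr_of_le _
    (iSup_tensorPiece (iSup_map_of (Q.gr 𝒜) _) (iSup_map_of ℬ _) _) fun d => ?_⟩
  rw [AddSubgroup.map_le_iff_le_comap, QTensorS.gr, tensorPiece, AddSubgroup.closure_le]
  rintro _ ⟨y, i, _, _, ⟨q, hq, rfl⟩, ⟨x, hx, rfl⟩, rfl, rfl⟩
  change (Algebra.TensorProduct.comm R _ _).toRingEquiv.trans e
    (Along.of _ q ⊗ₜ Along.of _ x) ∈ Q.gr ℬ (y.1 + i, y.2)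
  rw [he']
  have := SetLike.mul_mem_graded (A := Q.gr ℬ) (Q.map_mem f hq) (Q.p_mem ℬ hx)
  rwa [show y + (i, (0 : ℤ)) = (y.1 + i, y.2) from Prod.ext rfl (add_zero _)] at this

end TensorQ

/-! ### Kernels that are compatible with base change -/

section KernelBaseChange

variable {k : Type w} {R S : Type u} [CommRing k] [CommRing R] [CommRing S] [Algebra k R]
  [Algebra k S] {𝒜 : ℤ → Submodule k R} {ℬ : ℤ → Submodule k S}

/-- The linear inverse preserves degrees because φ commutes with the projections to components. -/
theorem GrMod.isIso_of_bijective {M N : GrMod 𝒜} (φ : M ⟶ N)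
    (h : Function.Bijective (Hom.lin φ)) : IsIso φ := by
  let e := LinearEquiv.ofBijective (Hom.lin φ) h
  have he : ∀ i, ∀ n ∈ N.grading i, e.symm n ∈ M.grading i := by
    intro i n hn
    have h1 : Hom.lin φ (e.symm n) = n := e.apply_symm_apply n
    have h2 : e.symm n = M.component i (e.symm n) := by
      refine h.1 ?_
      rw [← component_lin, h1, component_of_mem _ hn]
    rw [h2]
    exact M.component_mem i _
  refine ⟨Hom.mk e.symm.toLinearMap he, ?_, ?_⟩
  · exact Hom.ext (LinearMap.ext fun m => e.symm_apply_apply m)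
  · exact Hom.ext (LinearMap.ext fun n => e.apply_symm_apply n)

theorem Kernel.tens_addHom_ext (K : Kernel 𝒜 ℬ) {M A : Type u} [AddCommGroup M] [Module R M]
    [AddCommGroup A] {φ ψ : K.Tens M →+ A} (h : ∀ b m, φ (K.tmul b m) = ψ (K.tmul b m))
    (t : K.Tens M) : φ t = ψ t :=
  K.tens_induction (P := fun t => φ t = ψ t) (by rw [map_zero, map_zero])
    (fun t t' h₁ h₂ => by rw [map_add, map_add, h₁, h₂]) h t

/-- The additive map on `B ⊗[R] M` given by a balanced biadditive map. -/
noncomputable def Kernel.tensLift (K : Kernel 𝒜 ℬ) {M A : Type u} [AddCommGroup M] [Module R M]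
    [AddCommGroup A] (φ : K.B → M → A) (hB : ∀ b b' m, φ (b + b') m = φ b m + φ b' m)
    (hM : ∀ b m m', φ b (m + m') = φ b m + φ b m')
    (h : ∀ r b m, φ (K.src r * b) m = φ b (r • m)) : K.Tens M →+ A :=
  TensorProduct.liftAddHom (R := R) (M := Along (K.src : R →+* K.B)) (N := M)
    ((AddMonoidHom.mk' (fun b => AddMonoidHom.mk' (φ b) (hM b))
      fun b b' => AddMonoidHom.ext (hB b b')).comp
        (Along.of (K.src : R →+* K.B)).symm.toAddMonoidHom)
    (fun r b m => by
      obtain ⟨b, rfl⟩ := (Along.of (K.src : R →+* K.B)).surjective b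
      rw [Along.smul_of]
      exact h r b m)

variable [GradedAlgebra 𝒜] [GradedAlgebra ℬ]

/-- The kernel `L` on the side of `S` is the base change, along `f` and the target map, of the
kernel `K` on the side of `R`. -/
structure Kernel.BaseChange (f : 𝒜 →ₐᵍ[k] ℬ) (K : Kernel 𝒜 𝒜) (L : Kernel ℬ ℬ) where
  /-- the map of algebras -/
  map : K.B →+* L.B
  /-- the map of degrees -/
  deg : K.ι →+ L.ι
  deg_injective : Function.Injective deg
  map_mem : ∀ {x b}, b ∈ K.gr x → map b ∈ L.gr (deg x)
  map_src : ∀ r, map (K.src r) = L.src (f r)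
  deg_src : ∀ i, deg (K.srcDeg i) = L.srcDeg i
  map_tgt : ∀ r, map (K.tgt r) = L.tgt (f r)
  deg_tgt : ∀ i, deg (K.tgtDeg i) = L.tgtDeg i
  /-- the isomorphism of `L.B` with the base change -/
  equiv : Along (f.toAlgHom : R →+* S) ⊗[R] Along (K.tgt : R →+* K.B) ≃+* L.B
  equiv_tmul : ∀ (x : S) (b : K.B), equiv (Along.of _ x ⊗ₜ Along.of _ b) = L.tgt x * map b
  -- The graded part of the base change condition, which gives surjectivity within the selected
  -- degrees.
  mem_closure : ∀ {y b}, b ∈ L.gr y → b ∈ AddSubgroup.closure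
    {c | ∃ i z x b', x ∈ ℬ i ∧ b' ∈ K.gr z ∧ L.tgtDeg i + deg z = y ∧ c = L.tgt x * map b'}

/-! ### The comparison map S ⊗ (B ⊗ M) → B' ⊗ (S ⊗ M) -/

namespace Kernel.BaseChange

variable {f : 𝒜 →ₐᵍ[k] ℬ} {K : Kernel 𝒜 𝒜} {L : Kernel ℬ ℬ} (θ : Kernel.BaseChange f K L)

/-- The map `m ↦ 1 ⊗ m`. -/
noncomputable def unit (f : 𝒜 →ₐᵍ[k] ℬ) (M : GrMod 𝒜) :
    M.carrier →+ ((pullbackKernel f).onObj M).carrier :=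
  (GrMod.Hom.lin (pullbackUnitApp f M)).toAddMonoidHom

theorem unit_smul (f : 𝒜 →ₐᵍ[k] ℬ) (M : GrMod 𝒜) (r : R) (m : M.carrier) :
    unit f M (r • m) = f r • unit f M m :=
  map_smul (GrMod.Hom.lin (pullbackUnitApp f M)) r m

theorem unit_mem (f : 𝒜 →ₐᵍ[k] ℬ) (M : GrMod 𝒜) {i : ℤ} {m : M.carrier} (hm : m ∈ M.grading i) :
    unit f M m ∈ ((pullbackKernel f).onObj M).grading i :=
  GrMod.Hom.mem (pullbackUnitApp f M) hm

/-- The map `b ⊗ m ↦ θ b ⊗ (1 ⊗ m)`. -/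
noncomputable def tensHom (M : GrMod 𝒜) :
    K.Tens M.carrier →+ L.Tens ((pullbackKernel f).onObj M).carrier :=
  K.tensLift (fun b m => L.tmul (θ.map b) (unit f M m))
    (fun b b' m => by rw [map_add, L.add_tmul])
    (fun b m m' => by rw [map_add, L.tmul_add])
    (fun r b m => by rw [unit_smul, L.tmul_smul, map_mul, θ.map_src])

theorem tensHom_tmul (M : GrMod 𝒜) (b : K.B) (m : M.carrier) :
    θ.tensHom M (K.tmul b m) = L.tmul (θ.map b) (unit f M m) := rfl

theorem tensHom_smul (M : GrMod 𝒜) (r : R) (t : K.Tens M.carrier) :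
    θ.tensHom M (r • t) = f r • θ.tensHom M t := by
  refine K.tens_addHom_ext (φ := (θ.tensHom M).comp (DistribSMul.toAddMonoidHom _ r))
    (ψ := (DistribSMul.toAddMonoidHom _ (f r)).comp (θ.tensHom M)) (fun b m => ?_) t
  change θ.tensHom M (r • K.tmul b m) = f r • θ.tensHom M (K.tmul b m)
  rw [K.smul_tmul, tensHom_tmul, tensHom_tmul, L.smul_tmul, map_mul, θ.map_tgt]

theorem tensHom_mem (M : GrMod 𝒜) {x : K.ι} {t : K.Tens M.carrier}
    (ht : t ∈ K.tensGrading M x) :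
    θ.tensHom M t ∈ L.tensGrading ((pullbackKernel f).onObj M) (θ.deg x) := by
  rw [mem_tensGrading_iff] at ht
  induction ht using AddSubgroup.closure_induction with
  | zero => rw [map_zero]; exact zero_mem _
  | add _ _ _ _ h h' => rw [map_add]; exact add_mem h h'
  | neg _ _ h => rw [map_neg]; exact neg_mem h
  | mem t ht =>
    obtain ⟨y, z, b, m, hb, hm, rfl, rfl⟩ := ht
    rw [tensHom_tmul, map_add, θ.deg_src]
    exact L.tmul_mem (θ.map_mem hb) (unit_mem f M hm)

theorem tensHom_mem_subm (M : GrMod 𝒜) {t : K.Tens M.carrier} (ht : t ∈ K.subm M) :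
    θ.tensHom M t ∈ L.subm ((pullbackKernel f).onObj M) := by
  have ht' : t ∈ (⨆ a : ℤ, K.tensGrading M (K.tgtDeg a) : AddSubgroup (K.Tens M.carrier)) := ht
  induction ht' using AddSubgroup.iSup_induction' with
  | h1 => rw [map_zero]; exact zero_mem _
  | hadd t t' h₁ h₂ h h' => rw [map_add]; exact add_mem (h h₁) (h' h₂)
  | hp a t h =>
    have h' := θ.tensHom_mem M h
    rw [θ.deg_tgt] at h'
    exact (le_iSup (fun a : ℤ => L.tensGrading ((pullbackKernel f).onObj M) (L.tgtDeg a)) a) h'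

/-- The map `b ⊗ m ↦ θ b ⊗ (1 ⊗ m)`, as a morphism of graded modules. -/
noncomputable def restrictHom (M : GrMod 𝒜) :
    K.onObj M ⟶ restrictObj f (L.onObj ((pullbackKernel f).onObj M)) :=
  GrMod.Hom.mk (N := restrictObj f (L.onObj ((pullbackKernel f).onObj M)))
    { toFun := fun t => ⟨θ.tensHom M t.1, θ.tensHom_mem_subm M t.2⟩
      map_add' := fun t t' => Subtype.ext (map_add (θ.tensHom M) t.1 t'.1)
      map_smul' := fun r t => Subtype.ext (θ.tensHom_smul M r t.1) }
    fun i t ht => by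
      have h' := θ.tensHom_mem M (show t.1 ∈ K.tensGrading M (K.tgtDeg i) from ht)
      rw [θ.deg_tgt] at h'
      exact h'

/-- The natural map from `M ↦ B ⊗ M` to the restriction of `M ↦ B' ⊗ (S ⊗ M)`. -/
noncomputable def restrictNat : K.functor ⟶ (pullback f ⋙ L.functor) ⋙ restrict f where
  app := θ.restrictHom
  naturality M N φ := GrMod.Hom.ext <| LinearMap.ext fun t => Subtype.ext <|
    K.tens_addHom_ext (φ := (θ.tensHom N).comp (K.tensMap φ).toAddMonoidHom)
      (ψ := (L.tensMap ((pullback f).map φ)).toAddMonoidHom.comp (θ.tensHom M))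
      (fun _ _ => rfl) t.1

/-- The natural map `S ⊗ (B ⊗ M) → B' ⊗ (S ⊗ M)`. -/
noncomputable def nat : K.functor ⋙ pullback f ⟶ pullback f ⋙ L.functor :=
  Functor.whiskerRight θ.restrictNat (pullback f) ≫
    Functor.whiskerLeft (pullback f ⋙ L.functor) (pullbackCounit f)

/-- The additive map underlying `nat`, with values in the full tensor product. -/
noncomputable def natHom (M : GrMod 𝒜) :
    (pullbackKernel f).Tens (K.onObj M).carrier →+
      L.Tens ((pullbackKernel f).onObj M).carrier :=
  (L.subm ((pullbackKernel f).onObj M)).subtype.toAddMonoidHom.comp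
    ((pullbackCounitAux f (L.onObj ((pullbackKernel f).onObj M))).toAddMonoidHom.comp
      ((pullbackKernel f).tensMap (θ.restrictHom M)).toAddMonoidHom)

/-- The map `b ↦ b ⊗ m`, from `B` as an `R`-module through the target map. -/
noncomputable def tmulRight (K : Kernel 𝒜 𝒜) (M : Type u) [AddCommGroup M] [Module R M] :
    M →+ (Along (K.tgt : R →+* K.B) →ₗ[R] K.Tens M) :=
  AddMonoidHom.mk'
    (fun m =>
      { toFun := fun b => K.tmul ((Along.of (K.tgt : R →+* K.B)).symm b) m
        map_add' := fun _ _ => K.add_tmul _ _ m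
        map_smul' := fun r b => by
          obtain ⟨b, rfl⟩ := (Along.of (K.tgt : R →+* K.B)).surjective b
          rw [Along.smul_of]
          rfl })
    fun m m' => LinearMap.ext fun b => K.tmul_add _ m m'

/-- The map `x ⊗ b ↦ x ⊗ (b ⊗ m)`. -/
noncomputable def lTensRight (f : 𝒜 →ₐᵍ[k] ℬ) (K : Kernel 𝒜 𝒜) (M : Type u) [AddCommGroup M]
    [Module R M] : M →+ (Along (f.toAlgHom : R →+* S) ⊗[R] Along (K.tgt : R →+* K.B) →ₗ[R]
      Along (f.toAlgHom : R →+* S) ⊗[R] K.Tens M) :=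
  (LinearMap.lTensorHom (R := R) (Along (f.toAlgHom : R →+* S))).toAddMonoidHom.comp
    (tmulRight K M)

theorem lTensRight_tmul (f : 𝒜 →ₐᵍ[k] ℬ) (K : Kernel 𝒜 𝒜) {M : Type u} [AddCommGroup M]
    [Module R M] (m : M) (x : Along (f.toAlgHom : R →+* S)) (b : K.B) :
    lTensRight f K M m (x ⊗ₜ Along.of _ b) = x ⊗ₜ K.tmul b m := rfl

theorem lTensRight_smul (f : 𝒜 →ₐᵍ[k] ℬ) (K : Kernel 𝒜 𝒜) {M : Type u} [AddCommGroup M]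
    [Module R M] (r : R) (m : M)
    (y : Along (f.toAlgHom : R →+* S) ⊗[R] Along (K.tgt : R →+* K.B)) :
    lTensRight f K M (r • m) y = lTensRight f K M m (1 ⊗ₜ Along.of _ (K.src r) * y) := by
  induction y using TensorProduct.induction_on with
  | zero => rw [mul_zero, map_zero, map_zero]
  | add _ _ h h' => rw [mul_add, map_add, map_add, h, h']
  | tmul x b =>
    obtain ⟨b, rfl⟩ := (Along.of (K.tgt : R →+* K.B)).surjective b
    rw [Algebra.TensorProduct.tmul_mul_tmul, one_mul, ← map_mul, lTensRight_tmul,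
      lTensRight_tmul, K.tmul_smul]

/-- `equiv` sends `1 ⊗ K.src r` to `L.src (f r)`. With `lTensRight_smul` this makes `retractionAux`
balanced over R. -/
theorem equiv_symm_src (r : R) (b : L.B) :
    θ.equiv.symm (L.src (f r) * b) = 1 ⊗ₜ Along.of _ (K.src r) * θ.equiv.symm b := by
  refine θ.equiv.injective ?_
  have h := θ.equiv_tmul 1 (K.src r)
  rw [map_one, map_one, one_mul, θ.map_src] at h
  rw [RingEquiv.apply_symm_apply, map_mul, h, RingEquiv.apply_symm_apply]

/-- The map `x ⊗ m ↦ x ⊗ (b ⊗ m)`, for a fixed element `b` of `B' = S ⊗ B`. -/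
noncomputable def retractionAux (M : GrMod 𝒜) (b : L.B) :
    (pullbackKernel f).Tens M.carrier →+
      Along (f.toAlgHom : R →+* S) ⊗[R] K.Tens M.carrier :=
  (pullbackKernel f).tensLift
    (fun x m => lTensRight f K M.carrier m (θ.equiv.symm (L.src (show S from x) * b)))
    (fun x x' m => (congrArg (fun c => lTensRight f K M.carrier m (θ.equiv.symm (c * b)))
      (map_add L.src (show S from x) (show S from x'))).trans
        (by rw [add_mul, map_add, map_add]))
    (fun x m m' => by rw [map_add, LinearMap.add_apply])
    (fun r x m => by
      refine (congrArg (fun c => lTensRight f K M.carrier m (θ.equiv.symm (c * b)))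
        (map_mul L.src (f r) (show S from x))).trans ?_
      rw [mul_assoc, equiv_symm_src, lTensRight_smul])

theorem retractionAux_tmul (M : GrMod 𝒜) (b : L.B) (x : S) (m : M.carrier) :
    θ.retractionAux M b ((pullbackKernel f).tmul x m) =
      lTensRight f K M.carrier m (θ.equiv.symm (L.src x * b)) := rfl

theorem retractionAux_add (M : GrMod 𝒜) (b b' : L.B) (t : (pullbackKernel f).Tens M.carrier) :
    θ.retractionAux M (b + b') t = θ.retractionAux M b t + θ.retractionAux M b' t := by
  refine (pullbackKernel f).tens_addHom_ext
    (ψ := θ.retractionAux M b + θ.retractionAux M b') (fun x m => ?_) t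
  have h := fun c => θ.retractionAux_tmul M c x m
  refine (h _).trans (Eq.trans ?_ (congrArg₂ (· + ·) (h b) (h b')).symm)
  rw [mul_add, map_add, map_add]

theorem retractionAux_src (M : GrMod 𝒜) (b : L.B) (x : S)
    (t : (pullbackKernel f).Tens M.carrier) :
    θ.retractionAux M (L.src x * b) t = θ.retractionAux M b (x • t) := by
  refine (pullbackKernel f).tens_addHom_ext
    (ψ := (θ.retractionAux M b).comp (DistribSMul.toAddMonoidHom _ x)) (fun (y : S) m => ?_) t
  change _ = θ.retractionAux M b (x • (pullbackKernel f).tmul y m)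
  refine (θ.retractionAux_tmul M _ y m).trans
    (Eq.trans ?_ (θ.retractionAux_tmul M b (x * y) m).symm)
  rw [map_mul L.src, mul_left_comm, mul_assoc]

/-- The inverse `B' ⊗ (S ⊗ M) → S ⊗ (B ⊗ M)`. -/
noncomputable def retraction (M : GrMod 𝒜) :
    L.Tens ((pullbackKernel f).onObj M).carrier →+
      Along (f.toAlgHom : R →+* S) ⊗[R] K.Tens M.carrier :=
  L.tensLift (fun b t => θ.retractionAux M b (((pullbackKernel f).subm M).subtype t))
    (fun _ _ _ => θ.retractionAux_add M _ _ _)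
    (fun b t t' => map_add (θ.retractionAux M b) t.1 t'.1)
    (fun x b t => θ.retractionAux_src M b x t.1)

theorem retraction_tmul (M : GrMod 𝒜) (b : L.B) (t : ((pullbackKernel f).onObj M).carrier) :
    θ.retraction M (L.tmul b t) = θ.retractionAux M b t.1 := rfl

theorem retraction_smul_tensHom (M : GrMod 𝒜) (x : S) (t : K.Tens M.carrier) :
    θ.retraction M (x • θ.tensHom M t) = Along.of _ x ⊗ₜ t := by
  refine K.tens_addHom_ext
    (φ := (θ.retraction M).comp ((DistribSMul.toAddMonoidHom _ x).comp (θ.tensHom M)))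
    (ψ := (TensorProduct.mk R (Along (f.toAlgHom : R →+* S)) (K.Tens M.carrier)
      (Along.of _ x)).toAddMonoidHom) (fun b m => ?_) t
  change θ.retraction M (x • θ.tensHom M (K.tmul b m)) = Along.of _ x ⊗ₜ K.tmul b m
  rw [tensHom_tmul, L.smul_tmul, retraction_tmul]
  refine (θ.retractionAux_tmul M _ 1 m).trans ?_
  rw [map_one, one_mul, ← θ.equiv_tmul, RingEquiv.symm_apply_apply, lTensRight_tmul]

/-- The retraction undoes the comparison map on full tensor products; on the selected part only the
inclusion, tensored with S, remains. -/
theorem retraction_natHom (M : GrMod 𝒜) (t : (pullbackKernel f).Tens (K.onObj M).carrier) :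
    θ.retraction M (θ.natHom M t) =
      LinearMap.lTensor (Along (f.toAlgHom : R →+* S)) (K.subm M).subtype t :=
  (pullbackKernel f).tens_addHom_ext (φ := (θ.retraction M).comp (θ.natHom M))
    (ψ := (LinearMap.lTensor (Along (f.toAlgHom : R →+* S)) (K.subm M).subtype).toAddMonoidHom)
    (fun x t => θ.retraction_smul_tensHom M x t.1) t

/-- By flatness, the inclusion of the selected part of B ⊗ M stays injective after tensoring with S,
and it factors through `natHom`. -/
theorem natHom_injective (hf : Module.Flat R (Along (f.toAlgHom : R →+* S))) (M : GrMod 𝒜) :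
    Function.Injective (θ.natHom M) := by
  intro t t' h
  refine Module.Flat.lTensor_preserves_injective_linearMap (M := Along (f.toAlgHom : R →+* S))
    (K.subm M).subtype Subtype.val_injective ?_
  exact ((θ.retraction_natHom M t).symm.trans (congrArg _ h)).trans (θ.retraction_natHom M t')

/-- For a term `L.tgt x * θ.map b'` of b, the preimage is x ⊗ (b' ⊗ m). The degrees force b' ⊗ m
into the selected part, so it is available. -/
theorem tmul_unit_mem_range (M : GrMod 𝒜) {a l : ℤ} {y : L.ι} {b : L.B} {m : M.carrier}
    (hb : b ∈ L.gr y) (hm : m ∈ M.grading l) (h : y + L.srcDeg l = L.tgtDeg a) :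
    L.tmul b (unit f M m) ∈ (θ.natHom M).range := by
  replace hb := θ.mem_closure hb
  induction hb using AddSubgroup.closure_induction with
  | zero => rw [L.zero_tmul]; exact zero_mem _
  | add _ _ _ _ h h' => rw [L.add_tmul]; exact add_mem h h'
  | neg b _ h =>
    have : L.tmul (-b) (unit f M m) = -L.tmul b (unit f M m) := TensorProduct.neg_tmul _ _
    rw [this]
    exact neg_mem h
  | mem b hb =>
    obtain ⟨i, z, x, b', hx, hb', rfl, rfl⟩ := hb
    have hdeg : z + K.srcDeg l = K.tgtDeg (a - i) := by
      refine θ.deg_injective ?_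
      rw [map_add, θ.deg_src, θ.deg_tgt, map_sub, ← h]
      abel
    have hmem := K.tmul_mem hb' hm
    rw [hdeg] at hmem
    have hmem' : K.tmul b' m ∈ K.subm M :=
      (le_iSup (fun a : ℤ => K.tensGrading M (K.tgtDeg a)) (a - i)) hmem
    exact ⟨(pullbackKernel f).tmul x (⟨_, hmem'⟩ : K.subm M), rfl⟩

/-- The tensor product `S ⊗ M` agrees with the module underlying the pullback of `M`. -/
noncomputable def ofTens (f : 𝒜 →ₐᵍ[k] ℬ) (M : GrMod 𝒜) :
    (pullbackKernel f).Tens M.carrier →+ ((pullbackKernel f).onObj M).carrier :=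
  ((AddMonoidHom.id _).codRestrict ((pullbackKernel f).subm M) (mem_subm_pullbackKernel f M))

theorem tmul_mem_range (M : GrMod 𝒜) {a z : ℤ} {y : L.ι} {b : L.B}
    {t : ((pullbackKernel f).onObj M).carrier} (hb : b ∈ L.gr y)
    (ht : t ∈ ((pullbackKernel f).onObj M).grading z) (h : y + L.srcDeg z = L.tgtDeg a) :
    L.tmul b t ∈ (θ.natHom M).range := by
  let ψ : (pullbackKernel f).Tens M.carrier →+ L.Tens ((pullbackKernel f).onObj M).carrier :=
    AddMonoidHom.mk' (fun t => L.tmul b (ofTens f M t))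
      fun _ _ => by rw [map_add, L.tmul_add]
  have key : ∀ t ∈ (pullbackKernel f).tensGrading M ((pullbackKernel f).tgtDeg z),
      ψ t ∈ (θ.natHom M).range := by
    intro t ht
    rw [mem_tensGrading_iff] at ht
    induction ht using AddSubgroup.closure_induction with
    | zero => rw [map_zero]; exact zero_mem _
    | add _ _ _ _ h h' => rw [map_add]; exact add_mem h h'
    | neg _ _ h => rw [map_neg]; exact neg_mem h
    | mem t ht =>
      obtain ⟨i, l, x, m, hx, hm, hil, rfl⟩ := ht
      -- The scalar x moves across the tensor product over S: b ⊗ (x ⊗ m) = src(x) b ⊗ (1 ⊗ m),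
      -- which reduces to the previous lemma.
      have h1 : ψ ((pullbackKernel f).tmul x m) = L.tmul (L.src x * b) (unit f M m) := by
        refine Eq.trans ?_ (L.tmul_smul x b (unit f M m))
        exact congrArg (L.tmul b) (Subtype.ext (congrArg (fun x : S =>
          (pullbackKernel f).tmul x m) (mul_one x).symm))
      rw [h1]
      refine θ.tmul_unit_mem_range M (a := a) (SetLike.mul_mem_graded (L.src_mem hx) hb) hm ?_
      have h2 : (show ℤ from i) + l = z := hil
      rw [← h, ← h2, map_add]
      abel
  exact key t.1 ht

theorem mem_range_of_mem_subm (M : GrMod 𝒜) {t : L.Tens ((pullbackKernel f).onObj M).carrier}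
    (ht : t ∈ L.subm ((pullbackKernel f).onObj M)) : t ∈ (θ.natHom M).range := by
  have ht' : t ∈ (⨆ a : ℤ, L.tensGrading ((pullbackKernel f).onObj M) (L.tgtDeg a) :
    AddSubgroup _) := ht
  clear ht
  induction ht' using AddSubgroup.iSup_induction' with
  | h1 => exact zero_mem _
  | hadd t t' h₁ h₂ h h' => exact add_mem h h'
  | hp a t h =>
    rw [mem_tensGrading_iff] at h
    refine (AddSubgroup.closure_le _).2 ?_ h
    rintro _ ⟨y, z, b, t, hb, ht, hyz, rfl⟩
    exact θ.tmul_mem_range M hb ht hyz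

theorem isIso_nat_app (hf : Module.Flat R (Along (f.toAlgHom : R →+* S))) (M : GrMod 𝒜) :
    IsIso (θ.nat.app M) := by
  refine GrMod.isIso_of_bijective _ ⟨fun t t' h => ?_, fun t => ?_⟩
  · exact Subtype.ext (θ.natHom_injective hf M (congrArg Subtype.val h))
  · obtain ⟨t', ht'⟩ := θ.mem_range_of_mem_subm M t.2
    exact ⟨⟨t', mem_subm_pullbackKernel f _ t'⟩, Subtype.ext ht'⟩

/-- The functors given by `K` and `L` commute with base change. -/
noncomputable def natIso (hf : Module.Flat R (Along (f.toAlgHom : R →+* S))) :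
    K.functor ⋙ pullback f ≅ pullback f ⋙ L.functor :=
  have := θ.isIso_nat_app hf
  have := NatIso.isIso_of_isIso_app θ.nat
  asIso θ.nat

/-- Both composites are derived functors of isomorphic functors: after `K.functor` no resolution is
needed since the pullback is exact, and after the pullback none is needed since K-projectives stay
K-projective. -/
theorem nonempty_iso {f : 𝒜 →ₐᵍ[k] ℬ} {K : Kernel 𝒜 𝒜} {L : Kernel ℬ ℬ}
    (θ : Kernel.BaseChange f K L) (hf : Module.Flat R (Along (f.toAlgHom : R →+* S)))
    [GrMod.HasLeftDerived (pullback f)] [GrMod.HasLeftDerived K.functor]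
    [GrMod.HasLeftDerived L.functor] :
    Nonempty (GrMod.leftDerived K.functor ⋙ GrMod.leftDerived (pullback f) ≅
      GrMod.leftDerived (pullback f) ⋙ GrMod.leftDerived L.functor) :=
  GrMod.nonempty_leftDerived_comp_iso _ _ _ _ (θ.natIso hf)
    (fun _ _ => GrMod.isIso_leftDerivedCounit_app_of_exact _ (isExact_pullback hf) _)
    (fun _ hP => GrMod.isIso_leftDerivedCounit_app _ (kProjective_pullback f hP))

end Kernel.BaseChange

end KernelBaseChange

/-! ### The two transforms given by Q(R) satisfy base change -/

section QBaseChange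

variable {k : Type w} {R S : Type u} [CommRing k] [CommRing R] [CommRing S] [Algebra k R]
  [Algebra k S] {𝒜 : ℤ → Submodule k R} {ℬ : ℤ → Submodule k S} [GradedAlgebra 𝒜]
  [GradedAlgebra ℬ]

/-- `Q(S)` is the base change of `Q(R)` along `p`. -/
theorem nonempty_baseChange_kernel {f : 𝒜 →ₐᵍ[k] ℬ} (hf : IsStronglyEtale f) :
    Nonempty (Kernel.BaseChange f (Q.kernel 𝒜) (Q.kernel ℬ)) := by
  obtain ⟨e, he, hgr⟩ := exists_qTensorSEquiv hf
  refine ⟨{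
    map := (Q.map f : Q 𝒜 →+* Q ℬ)
    deg := AddMonoidHom.id (ℤ × ℤ)
    deg_injective := fun _ _ h => h
    map_mem := fun h => Q.map_mem f h
    map_src := Q.map_s f
    deg_src := fun _ => rfl
    map_tgt := Q.map_p f
    deg_tgt := fun _ => rfl
    -- The target side of this kernel is `p`, so the isomorphism needed is the one for Q(R) ⊗ S
    -- along `p`, with factors exchanged.
    equiv := (Algebra.TensorProduct.comm R (Along (f.toAlgHom : R →+* S))
      (Along (Q.p 𝒜 : R →+* Q 𝒜))).toRingEquiv.trans e
    equiv_tmul := fun x q => (he q x).trans (mul_comm _ _)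
    mem_closure := ?_ }⟩
  intro (d : ℤ × ℤ) (b : Q ℬ) hb
  obtain ⟨t, ht, rfl⟩ := (hgr d).ge hb
  have ht' : t ∈ AddSubgroup.closure _ := ht
  clear ht hb
  induction ht' using AddSubgroup.closure_induction with
  | zero => rw [map_zero]; exact zero_mem _
  | add _ _ _ _ h h' => rw [map_add]; exact add_mem h h'
  | neg _ _ h => rw [map_neg]; exact neg_mem h
  | mem t ht =>
    obtain ⟨y, i, _, _, ⟨q, hq, rfl⟩, ⟨x, hx, rfl⟩, rfl, rfl⟩ := ht
    exact AddSubgroup.subset_closure ⟨i, y, x, q, hx, hq,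
      (Prod.ext (add_comm _ _) (zero_add _) : ((i, 0) : ℤ × ℤ) + y = (y.1 + i, y.2)),
      (he q x).trans (mul_comm _ _)⟩

/-- `Q(S)` is the base change of `Q(R)` along `s`. -/
theorem nonempty_baseChange_kernelOp {f : 𝒜 →ₐᵍ[k] ℬ} (hf : IsStronglyEtale f) :
    Nonempty (Kernel.BaseChange f (Q.kernelOp 𝒜) (Q.kernelOp ℬ)) := by
  obtain ⟨e, he, hgr⟩ := exists_sTensorQEquiv hf
  refine ⟨{
    map := (Q.map f : Q 𝒜 →+* Q ℬ)
    deg := AddMonoidHom.id (ℤ × ℤ)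
    deg_injective := fun _ _ h => h
    map_mem := fun h => Q.map_mem f h
    map_src := Q.map_p f
    deg_src := fun _ => rfl
    map_tgt := Q.map_s f
    deg_tgt := fun _ => rfl
    equiv := e
    equiv_tmul := he
    mem_closure := ?_ }⟩
  intro (d : ℤ × ℤ) (b : Q ℬ) hb
  obtain ⟨t, ht, rfl⟩ := (hgr d).ge hb
  have ht' : t ∈ AddSubgroup.closure _ := ht
  clear ht hb
  induction ht' using AddSubgroup.closure_induction with
  | zero => rw [map_zero]; exact zero_mem _
  | add _ _ _ _ h h' => rw [map_add]; exact add_mem h h'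
  | neg _ _ h => rw [map_neg]; exact neg_mem h
  | mem t ht =>
    obtain ⟨i, y, _, _, ⟨x, hx, rfl⟩, ⟨q, hq, rfl⟩, rfl, rfl⟩ := ht
    exact AddSubgroup.subset_closure ⟨i, y, x, q, hx, hq,
      (Prod.ext (zero_add _) (add_comm _ _) : ((0, i) : ℤ × ℤ) + y = (y.1, y.2 + i)), he x q⟩

end QBaseChange

end StronglyEtaleQ

theorem mainTheorem9 {k : Type w} {R S : Type u} [CommRing k] [CommRing R] [CommRing S]
    [Algebra k R] [Algebra k S] (𝒜 : ℤ → Submodule k R) (ℬ : ℤ → Submodule k S)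
    [GradedAlgebra 𝒜] [GradedAlgebra ℬ] (f : 𝒜 →ₐᵍ[k] ℬ) (hf : IsStronglyEtale f) :
    (∃ e₁ : STensorQ f ≃+* Q ℬ,
      (∀ (x : S) (q : Q 𝒜), e₁ (Along.of _ x ⊗ₜ Along.of _ q) = Q.s ℬ x * Q.map f q) ∧
      ∀ d, (STensorQ.gr f d).map e₁.toAddMonoidHom = (Q.gr ℬ d).toAddSubgroup) ∧
    (∃ e₂ : QTensorS f ≃+* Q ℬ,
      (∀ (q : Q 𝒜) (x : S), e₂ (Along.of _ q ⊗ₜ Along.of _ x) = Q.map f q * Q.p ℬ x) ∧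
      ∀ d, (QTensorS.gr f d).map e₂.toAddMonoidHom = (Q.gr ℬ d).toAddSubgroup) ∧
    (∃ (_ : GrMod.HasLeftDerived (pullback f))
       (_ : GrMod.HasLeftDerived (Phi 𝒜)) (_ : GrMod.HasLeftDerived (Phi ℬ)),
      Nonempty (GrMod.leftDerived (Phi 𝒜) ⋙ GrMod.leftDerived (pullback f) ≅
        GrMod.leftDerived (pullback f) ⋙ GrMod.leftDerived (Phi ℬ))) ∧
    (∃ (_ : GrMod.HasLeftDerived (pullback f))
       (_ : GrMod.HasLeftDerived (PhiOp 𝒜)) (_ : GrMod.HasLeftDerived (PhiOp ℬ)),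
      Nonempty (GrMod.leftDerived (PhiOp 𝒜) ⋙ GrMod.leftDerived (pullback f) ≅
        GrMod.leftDerived (pullback f) ⋙ GrMod.leftDerived (PhiOp ℬ))) := by
  have h₀ : GrMod.HasLeftDerived (pullback f) := GrMod.hasLeftDerived _
  have h₁ : GrMod.HasLeftDerived (Phi 𝒜) := GrMod.hasLeftDerived _
  have h₂ : GrMod.HasLeftDerived (Phi ℬ) := GrMod.hasLeftDerived _
  have h₃ : GrMod.HasLeftDerived (PhiOp 𝒜) := GrMod.hasLeftDerived _
  have h₄ : GrMod.HasLeftDerived (PhiOp ℬ) := GrMod.hasLeftDerived _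
  obtain ⟨θ⟩ := nonempty_baseChange_kernel hf
  obtain ⟨θ'⟩ := nonempty_baseChange_kernelOp hf
  exact ⟨exists_sTensorQEquiv hf, exists_qTensorSEquiv hf, ⟨h₀, h₁, h₂, θ.nonempty_iso hf.flat⟩,
    ⟨h₀, h₃, h₄, θ'.nonempty_iso hf.flat⟩⟩
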